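/- **Setting.** Let $(X_n)_{n\ge 1}$ be a (strictly) stationary process of real random variables on a probability space, and let $F$ denote the distribution of $X_1$. A *kernel* is a symmetric measurable function $h:\mathbb R^2\to\mathbb R$, and $$U_n(h)=\binom n2^{-1}\sum_{1\le i<j\le n}h(X_i,X_j).$$ With $X,Y$ independent with distribution $F$, the kernel $h$ is *centered* if $E\,h(X,Y)=0$ and *degenerate* if $E\,h(x,Y)=0$ for every $x\in\mathbb R$. It has *uniform $m$-moments* if there is a constant $M$ with $E|h(X,Y)|^m\le M$ and $E|h(X_1,X_k)|^m\le M$ for all $k\ge 1$. $h$ is *$P$-Lipschitz-continuous* if there is $L>0$ such that $E\big[|h(X,Y)-h(X',Y)|\,\mathbf 1_{\{|X-X'|\le\epsilon\}}\big]\le L\epsilon$ for all $\epsilon>0$ and all random variables $X,X',Y$ such that each of $(X,Y)$ and $(X',Y)$ is distributed either as $(X_1,X_k)$ for some $k\ge1$ or as $F\times F$. It satisfies the *variation condition* if there is $L$ such that for every $\epsilon>0$, with $X,Y$ independent with distribution $F$, $$E\Big[\sup\big\{|h(x,y)-h(x',y')| : \|(x,y)-(X,Y)\|\le\epsilon,\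 \|(x',y')-(X,Y)\|\le\epsilon\big\}\Big]\le L\epsilon ,$$ where $\|\cdot\|$ is the Euclidean norm. Let $\mathcal F_a^b$ be the $\sigma$-field generated by the members of a process with index in $[a,b]$ (a one-sided process has only the indices $n\ge1$). Put $$\alpha(k)=\sup\{|P(A\cap B)-P(A)P(B)| : A\in\mathcal F_1^n,\ B\in\mathcal F_{n+k}^\infty,\ n\ge 1\},$$ $$\beta(k)=\sup_{n\ge1}E\sup\{|P(A\mid\mathcal F_{-\infty}^n)-P(A)| : A\in\mathcal F_{n+k}^\infty\},$$ with the inner supremum understood as an essential supremum. The process is *strongly mixing* if $\alpha(k)\to0$ and *absolutely regular* if $\beta(k)\to0$. $(X_n)$ is a *$1$-approximating functional with constants $(a_l)_{l\ge0}$* of a stationary process $(Z_n)_{n\in\mathbb Z}$ if $X_n=f(Z_n,Z_{n+1},\dots)$ for all $n\ge1$, with a measurable $f:\mathbb R^{\mathbb N}\to\mathbb R$, and if $X_1$ is integrable, $E\big|X_1-E(X_1\mid Z_0,\dots,Z_l)\big|\le a_l$ for all $l\ge0$, and $a_l\to0$. **Theorem.** Let $h_2$ be a degenerate, centered kernel with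 uniform $(2+\delta)$-moments for some $\delta>0$. Let $\tau\ge0$ be such that one of the following three conditions holds. 1. $(X_n)$ is absolutely regular and $\sum_{k=0}^n k\,\beta(k)^{\frac{\delta}{2+\delta}}=O(n^\tau)$. 2. $(X_n)$ is strongly mixing, $h_2$ is $P$-Lipschitz-continuous or satisfies the variation condition, and for some $\gamma>0$ we have $E|X_1|^\gamma<\infty$ and $\sum_{k=0}^n k\,\alpha(k)^{\frac{2\gamma\delta}{3\gamma\delta+\delta+5\gamma+2}}=O(n^\tau)$. 3. $(X_n)$ is a $1$-approximating functional, with constants $(a_l)$ satisfying $\sum_l a_l<\infty$, of a stationary absolutely regular process $(Z_n)_{n\in\mathbb Z}$; $h_2$ is $P$-Lipschitz-continuous or satisfies the variation condition; and, with $\beta(k)$ the absolute regularity coefficients of $(Z_n)$ and $\alpha_L=\big(2\sum_{i=L}^\infty a_i\big)^{1/2}$, we have $\sum_{k=0}^n k\big(\beta(k)^{\frac{\delta}{2+\delta}}+\alpha_k^{\frac{\delta}{2+\delta}}\big)=O(n^\tau)$. Then, as $n\to\infty$, $$\frac{n^{1-\frac\tau2}}{\log^{3/2}n\,\log\log n}\;U_n(h_2)\longrightarrow0\qquad\text{almost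 surely.}$$ -/

import Mathlib

open MeasureTheory ProbabilityTheory Filter Topology Asymptotics
open scoped ENNReal

namespace UStat

noncomputable section

/-! ### Processes, stationarity and generated σ-fields

A one-sided process `(X_n)_{n ≥ 1}` is a family `X : ℕ → Ω → ℝ`; only the members `X n` with
`1 ≤ n` are ever used (the value `X 0` is irrelevant). A two-sided process is a family
`Z : ℤ → Ω → ℝ`. -/

variable {Ω : Type*} [MeasurableSpace Ω]

/-- `(X_n)_{n ≥ 1}` is a (strictly) stationary sequence of random variables: the sequence
`(X_{1+m}, X_{2+m}, …)` has the same distribution as `(X_1, X_2, …)` for every `m`. -/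
def StationaryNat (μ : Measure Ω) (X : ℕ → Ω → ℝ) : Prop :=
  (∀ n, 1 ≤ n → Measurable (X n)) ∧
  ∀ m : ℕ, IdentDistrib (fun ω (i : ℕ) => X (i + 1 + m) ω) (fun ω (i : ℕ) => X (i + 1) ω) μ μ

/-- `(Z_n)_{n ∈ ℤ}` is a (strictly) stationary sequence of random variables. -/
def StationaryInt (μ : Measure Ω) (Z : ℤ → Ω → ℝ) : Prop :=
  (∀ n, Measurable (Z n)) ∧
  ∀ m : ℤ, IdentDistrib (fun ω (i : ℤ) => Z (i + m) ω) (fun ω (i : ℤ) => Z i ω) μ μ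

/-- The σ-field generated by the random variables `Y i`, `i ∈ S`. -/
abbrev sigmaOf {Ω : Type*} {ι : Type*} (Y : ι → Ω → ℝ) (S : Set ι) : MeasurableSpace Ω :=
  ⨆ i ∈ S, MeasurableSpace.comap (Y i) inferInstance

/-! ### Mixing coefficients -/

/-- The strong mixing coefficient
`α(k) = sup { |P(A ∩ B) - P(A) P(B)| : A ∈ σ(X_1,…,X_n), B ∈ σ(X_{n+k}, X_{n+k+1}, …), n ≥ 1 }`. -/
def alphaCoeff (μ : Measure Ω) (X : ℕ → Ω → ℝ) (k : ℕ) : ℝ :=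
  sSup {r : ℝ | ∃ n : ℕ, 1 ≤ n ∧ ∃ A B : Set Ω,
    MeasurableSet[sigmaOf X (Set.Icc 1 n)] A ∧ MeasurableSet[sigmaOf X (Set.Ici (n + k))] B ∧
    r = |μ.real (A ∩ B) - μ.real A * μ.real B|}

/-- `E sup { |P(A | 𝓕) - P(A)| : A ∈ 𝓖 }`. Each `P(A | 𝓕)` is only defined up to null sets, so the
supremum is the essential supremum of the family, i.e. the a.s. smallest random variable `g` that
dominates each member of the family almost surely; its expectation is the smallest expectation of
such a `g`. -/
def betaBetween {Ω : Type*} (𝓕 𝓖 : MeasurableSpace Ω) [m₀ : MeasurableSpace Ω]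
    (μ : Measure Ω) : ℝ≥0∞ :=
  ⨅ (g : Ω → ℝ≥0∞) (_ : Measurable[m₀] g)
    (_ : ∀ A : Set Ω, MeasurableSet[𝓖] A →
      ∀ᵐ ω ∂μ, ENNReal.ofReal |(μ[A.indicator (fun _ => (1 : ℝ)) | 𝓕]) ω - μ.real A| ≤ g ω),
    ∫⁻ ω, g ω ∂μ

/-- The absolute regularity coefficient
`β(k) = sup_{n ≥ 1} E sup { |P(A | σ(X_1,…,X_n)) - P(A)| : A ∈ σ(X_{n+k}, X_{n+k+1}, …) }` of a
one-sided process. -/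
def betaCoeffNat (μ : Measure Ω) (X : ℕ → Ω → ℝ) (k : ℕ) : ℝ :=
  (⨆ (n : ℕ) (_ : 1 ≤ n),
    betaBetween (sigmaOf X (Set.Icc 1 n)) (sigmaOf X (Set.Ici (n + k))) μ).toReal

/-- The absolute regularity coefficient
`β(k) = sup_{n ≥ 1} E sup { |P(A | σ(…,Z_{n-1},Z_n)) - P(A)| : A ∈ σ(Z_{n+k}, Z_{n+k+1}, …) }` of a
two-sided process. -/
def betaCoeffInt (μ : Measure Ω) (Z : ℤ → Ω → ℝ) (k : ℕ) : ℝ :=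
  (⨆ (n : ℕ) (_ : 1 ≤ n),
    betaBetween (sigmaOf Z (Set.Iic (n : ℤ))) (sigmaOf Z (Set.Ici ((n : ℤ) + k))) μ).toReal

/-- `(X_n)_{n ≥ 1}` is strongly mixing. -/
def StronglyMixing (μ : Measure Ω) (X : ℕ → Ω → ℝ) : Prop :=
  Tendsto (alphaCoeff μ X) atTop (𝓝 0)

/-- `(X_n)_{n ≥ 1}` is absolutely regular. -/
def AbsRegularNat (μ : Measure Ω) (X : ℕ → Ω → ℝ) : Prop :=
  Tendsto (betaCoeffNat μ X) atTop (𝓝 0)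

/-- `(Z_n)_{n ∈ ℤ}` is absolutely regular. -/
def AbsRegularInt (μ : Measure Ω) (Z : ℤ → Ω → ℝ) : Prop :=
  Tendsto (betaCoeffInt μ Z) atTop (𝓝 0)

/-! ### Approximating functionals -/

/-- `(X_n)_{n ≥ 1}` is a one-sided functional of `(Z_n)_{n ∈ ℤ}`:
`X_n = f (Z_n, Z_{n+1}, …)` for some measurable `f : ℝ^ℕ → ℝ`. -/
def IsFunctionalOf (μ : Measure Ω) (X : ℕ → Ω → ℝ) (Z : ℤ → Ω → ℝ) : Prop :=
  ∃ f : (ℕ → ℝ) → ℝ, Measurable f ∧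
    ∀ n : ℕ, 1 ≤ n → ∀ᵐ ω ∂μ, X n ω = f (fun k : ℕ => Z ((n : ℤ) + k) ω)

/-- The `r`-approximating condition with constants `a`:
`‖X_1 - E(X_1 | σ(Z_0,…,Z_l))‖_r ≤ a_l` for `l = 0, 1, 2, …`, and `a_l → 0`. -/
def Approximating (μ : Measure Ω) (r : ℝ≥0∞) (X : ℕ → Ω → ℝ) (Z : ℤ → Ω → ℝ) (a : ℕ → ℝ) : Prop :=
  Integrable (X 1) μ ∧ Tendsto a atTop (𝓝 0) ∧
  ∀ l : ℕ, 0 ≤ a l ∧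
    eLpNorm (X 1 - μ[X 1 | sigmaOf Z (Set.Icc 0 (l : ℤ))]) r μ ≤ ENNReal.ofReal (a l)

/-- `α_L = (2 ∑_{i ≥ L} a_i)^{1/2}` (used for summable `a` only). -/
def approxAlpha (a : ℕ → ℝ) (L : ℕ) : ℝ := Real.sqrt (2 * ∑' i : ℕ, a (L + i))

/-! ### Kernels -/

/-- A kernel is a symmetric measurable function `h : ℝ² → ℝ`. -/
def IsKernel (h : ℝ → ℝ → ℝ) : Prop :=
  Measurable (Function.uncurry h) ∧ ∀ x y, h x y = h y x

/-- The distribution of `X_1`. -/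
def law (μ : Measure Ω) (X : ℕ → Ω → ℝ) : Measure ℝ := μ.map (X 1)

/-- The joint distribution of `(X_1, X_k)`. -/
def pairLaw (μ : Measure Ω) (X : ℕ → Ω → ℝ) (k : ℕ) : Measure (ℝ × ℝ) :=
  μ.map (fun ω => (X 1 ω, X k ω))

/-- `h` is centered: `E h(X, Y) = 0` for independent `X`, `Y` distributed as `X_1`. -/
def Centered (μ : Measure Ω) (X : ℕ → Ω → ℝ) (h : ℝ → ℝ → ℝ) : Prop :=
  Integrable (fun p : ℝ × ℝ => h p.1 p.2) ((law μ X).prod (law μ X)) ∧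
  ∫ p : ℝ × ℝ, h p.1 p.2 ∂((law μ X).prod (law μ X)) = 0

/-- `h` is degenerate: `E h(x, Y) = 0` for every `x ∈ ℝ`, where `Y` is distributed as `X_1`. -/
def Degenerate (μ : Measure Ω) (X : ℕ → Ω → ℝ) (h : ℝ → ℝ → ℝ) : Prop :=
  ∀ x : ℝ, Integrable (fun y => h x y) (law μ X) ∧ ∫ y, h x y ∂(law μ X) = 0

/-- `h` has uniform `m`-moments: the `m`-th absolute moments of `h` under the product law and under
all joint laws of `(X_1, X_k)`, `k ≥ 1`, are bounded by one constant. -/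
def UniformMoments (μ : Measure Ω) (X : ℕ → Ω → ℝ) (h : ℝ → ℝ → ℝ) (m : ℝ) : Prop :=
  ∃ M : ℝ,
    ∫⁻ p : ℝ × ℝ, ENNReal.ofReal (|h p.1 p.2| ^ m) ∂((law μ X).prod (law μ X))
      ≤ ENNReal.ofReal M ∧
    ∀ k : ℕ, 1 ≤ k →
      ∫⁻ p : ℝ × ℝ, ENNReal.ofReal (|h p.1 p.2| ^ m) ∂(pairLaw μ X k) ≤ ENNReal.ofReal M

/-- The set of laws consisting of all joint laws of `(X_1, X_k)`, `k ≥ 1`, and of the product law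
`P_{X_1} × P_{X_1}`. -/
def admissibleLaws (μ : Measure Ω) (X : ℕ → Ω → ℝ) : Set (Measure (ℝ × ℝ)) :=
  {π | π = (law μ X).prod (law μ X) ∨ ∃ k : ℕ, 1 ≤ k ∧ π = pairLaw μ X k}

/-- `h` is `P`-Lipschitz-continuous: there is `L > 0` such that
`E [ |h(X,Y) - h(X',Y)| 1_{|X-X'| ≤ ε} ] ≤ L ε` for every `ε > 0` and all random variables
`X, X', Y` such that the laws of `(X, Y)` and of `(X', Y)` are both admissible. The triple
`(X, X', Y)` is represented by its joint law `ρ` on `ℝ × ℝ × ℝ`. -/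
def PLipschitz (μ : Measure Ω) (X : ℕ → Ω → ℝ) (h : ℝ → ℝ → ℝ) : Prop :=
  ∃ L : ℝ, 0 < L ∧ ∀ ε : ℝ, 0 < ε → ∀ ρ : Measure (ℝ × ℝ × ℝ), IsProbabilityMeasure ρ →
    ρ.map (fun t => (t.1, t.2.2)) ∈ admissibleLaws μ X →
    ρ.map (fun t => (t.2.1, t.2.2)) ∈ admissibleLaws μ X →
    ∫⁻ t, Set.indicator {t : ℝ × ℝ × ℝ | |t.1 - t.2.1| ≤ ε}
      (fun t => ENNReal.ofReal |h t.1 t.2.2 - h t.2.1 t.2.2|) t ∂ρ ≤ ENNReal.ofReal (L * ε)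

/-- The closed Euclidean disc of radius `ε` around `p` in the plane. -/
def disc (p : ℝ × ℝ) (ε : ℝ) : Set (ℝ × ℝ) :=
  {q | Real.sqrt ((q.1 - p.1) ^ 2 + (q.2 - p.2) ^ 2) ≤ ε}

/-- `h` satisfies the variation condition: there is `L` such that for every `ε > 0`
`E [ sup { |h(x,y) - h(x',y')| : ‖(x,y) - (X,Y)‖ ≤ ε, ‖(x',y') - (X,Y)‖ ≤ ε } ] ≤ L ε`
for independent `X`, `Y` distributed as `X_1`. -/
def VariationCondition (μ : Measure Ω) (X : ℕ → Ω → ℝ) (h : ℝ → ℝ → ℝ) : Prop :=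
  ∃ L : ℝ, ∀ ε : ℝ, 0 < ε →
    ∫⁻ p, (⨆ (q ∈ disc p ε) (q' ∈ disc p ε), ENNReal.ofReal |h q.1 q.2 - h q'.1 q'.2|)
      ∂((law μ X).prod (law μ X)) ≤ ENNReal.ofReal (L * ε)

/-- The `U`-statistic `U_n(h) = (n choose 2)⁻¹ ∑_{1 ≤ i < j ≤ n} h(X_i, X_j)`. -/
def uStat (X : ℕ → Ω → ℝ) (h : ℝ → ℝ → ℝ) (n : ℕ) (ω : Ω) : ℝ :=
  ((n.choose 2 : ℕ) : ℝ)⁻¹ * ∑ i ∈ Finset.Icc 1 n, ∑ j ∈ Finset.Ioc i n, h (X i ω) (X j ω)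

/-! ### The three weak dependence conditions -/

/-- `X` is absolutely regular and `∑_{k=0}^n k β(k)^{δ/(2+δ)} = O(n^τ)`. -/
def CondAbsRegular (μ : Measure Ω) (X : ℕ → Ω → ℝ) (δ τ : ℝ) : Prop :=
  AbsRegularNat μ X ∧
  (fun n : ℕ => ∑ k ∈ Finset.range (n + 1), (k : ℝ) * betaCoeffNat μ X k ^ (δ / (2 + δ)))
    =O[atTop] (fun n : ℕ => (n : ℝ) ^ τ)

/-- `X` is strongly mixing, `E |X_1|^γ < ∞` for some `γ > 0`, `h` is `P`-Lipschitz-continuous or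
satisfies the variation condition, and
`∑_{k=0}^n k α(k)^{2γδ/(3γδ+δ+5γ+2)} = O(n^τ)`. -/
def CondStrongMixing (μ : Measure Ω) (X : ℕ → Ω → ℝ) (h : ℝ → ℝ → ℝ) (δ τ : ℝ) : Prop :=
  StronglyMixing μ X ∧ (PLipschitz μ X h ∨ VariationCondition μ X h) ∧
  ∃ γ : ℝ, 0 < γ ∧ Integrable (fun ω => |X 1 ω| ^ γ) μ ∧
    (fun n : ℕ => ∑ k ∈ Finset.range (n + 1),
        (k : ℝ) * alphaCoeff μ X k ^ (2 * γ * δ / (3 * γ * δ + δ + 5 * γ + 2)))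
      =O[atTop] (fun n : ℕ => (n : ℝ) ^ τ)

/-- `X` is a `1`-approximating functional, with constants `a`, of a stationary absolutely regular
process `Z`, `h` is `P`-Lipschitz-continuous or satisfies the variation condition, and
`∑_{k=0}^n k (β(k)^{δ/(2+δ)} + α_k^{δ/(2+δ)}) = O(n^τ)`, with `β` the coefficients of `Z` and
`α_L = (2 ∑_{i ≥ L} a_i)^{1/2} < ∞`. -/
def CondFunctional (μ : Measure Ω) (X : ℕ → Ω → ℝ) (h : ℝ → ℝ → ℝ) (δ τ : ℝ) : Prop :=
  (PLipschitz μ X h ∨ VariationCondition μ X h) ∧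
  ∃ (Z : ℤ → Ω → ℝ) (a : ℕ → ℝ),
    StationaryInt μ Z ∧ AbsRegularInt μ Z ∧ IsFunctionalOf μ X Z ∧
    Approximating μ 1 X Z a ∧ Summable a ∧
    (fun n : ℕ => ∑ k ∈ Finset.range (n + 1),
        (k : ℝ) * (betaCoeffInt μ Z k ^ (δ / (2 + δ)) + approxAlpha a k ^ (δ / (2 + δ))))
      =O[atTop] (fun n : ℕ => (n : ℝ) ^ τ)

end

end UStat

/-!
# Almost sure convergence of degenerate U-statistics of weakly dependent sequences

Write `S_n = ∑_{i < j ≤ n} h(X_i, X_j)`. Everything rests on the second moment bound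
`E max_{n ≤ 2^k} S_n² ≤ C (k + 1)² 2^{k (2 + τ)}`, called `MaxSqBound`. Given it, the maxima over
dyadic blocks, divided by the squares of the normalisation, have summable means, because
`∑ 1 / (k log² k)` converges; almost sure convergence follows (`MaxSqBound.ae_tendsto`).

*From covariances to the maximal inequality.* Suppose that the mean of `h(X_p, X_q) h(X_i, X_j)` is at
most `ψ(m)` as soon as the least or the largest of the four indices is separated by `m` from the others.
Counting quadruples (`sum_pairs_le`) bounds second moments of sums over pairs in `[1, N]` by
`N² ∑_{m < N} (m + 1) ψ(m)`, which is `O(N^{2 + τ})` by the hypothesis on the coefficients, and the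
dyadic chaining of Rademacher and Menshov (`sq_sum_range_le_dyadicSq`) passes to the maximum
at the price of `(k + 1)²` (`maxSqBound_of_cov`).

*Covariances of degenerate kernels.* Let `U` belong to the past and `V` to the future of a gap. If `U`
and `V` were independent, `h(U, V)` would have mean zero even on an event seen with `U` alone or
with `V` alone, by degeneracy. So the mean of `h(U, V)` on such an event is controlled by the total
variation distance of `(U, V)`, together with the event, to independence (`DepLE`,
`MomPair.abs_setIntegral_le`). A conditional expectation is positive or negative on events, so means over
events control means of products `H h(U, V)` with a factor `H` that depends on the past only or on the
future only (`abs_integral_mul_le_of_events`). Truncation at level `K`, where the distance to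
independence is `K^{-(2 + δ)}`, gives a bound of order `K^{-δ}`; this produces the exponent
`δ / (2 + δ)`.

*Absolute regularity* bounds the distance to independence directly (`depLE_betaBetween`).

*Strong mixing* does so only for a variable with finitely many values: with `N` values the distance
is at most of order `√N α`, by Khintchine's inequality (`depLE_of_alpha`). So `U` is discretised
into cells. A coupling (`exists_cell_coupling`) replaces `U` by a variable that is independent of `V`
with the law `F` and stays, with large probability, in the same cell; the regularity of the kernel pays for
the displacement inside the cell (`MomPair.abs_setIntegral_le_of_cells`). Only the first argument is
moved, which is all that the `P`-Lipschitz property allows.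

*Functionals.* If `X_n = f(Z_n, Z_{n+1}, …)`, the past of a gap is not separated from its future.
However, a grid with random shift rarely separates two variables that are close in mean, so the cell of
`X_n` is predicted, up to a small probability, by a finite window of `Z` (`exists_cellApprox`). This
suffices for the covariance of `h(X_i, X_j)` with functions of windows of `Z`. The other factor
therefore has to be replaced: `h(X_p, X_q)` is approximated by a bounded step function of the windows of
`p` and `q`, at a resolution that depends on `q - p` (`exists_step_kernel`,
`CellApprox.integral_abs_sub_le`). The sum of the step functions is handled through covariances, and the
errors are so small in `L²` that the Cauchy–Schwarz inequality suffices (`maxSqBound_of_sq`,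
`maxSqBound_of_cellApprox`).
-/


namespace UStat

/-! ### Truncation inequalities -/

lemma le_add_rpow {K x δ : ℝ} (hK : 0 < K) (hx : 0 ≤ x) (hδ : 0 < δ) :
    x ≤ K + K ^ (-(1 + δ)) * x ^ (2 + δ) := by
  rcases le_or_gt x K with h | h
  · have : 0 ≤ K ^ (-(1 + δ)) * x ^ (2 + δ) := by positivity
    linarith
  · have hx0 : 0 < x := hK.trans h
    have h1 : x ^ (2 + δ) = x ^ (1 + δ) * x := by
      rw [show 2 + δ = (1 + δ) + 1 by ring, Real.rpow_add_one hx0.ne']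
    have h2 : K ^ (1 + δ) ≤ x ^ (1 + δ) := by gcongr
    have h3 : 1 ≤ K ^ (-(1 + δ)) * x ^ (1 + δ) := by
      rw [Real.rpow_neg hK.le, inv_mul_eq_div, one_le_div (by positivity)]
      exact h2
    rw [h1, ← mul_assoc]
    nlinarith

lemma sq_le_rpow_of_lt {K y δ : ℝ} (hK : 0 < K) (hy : K < y) (hδ : 0 < δ) :
    y ^ 2 ≤ K ^ (-δ) * y ^ (2 + δ) := by
  have hy0 : 0 < y := hK.trans hy
  have h1 : y ^ (2 + δ) = y ^ δ * y ^ 2 := by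
    rw [add_comm, Real.rpow_add hy0]; norm_num
  have h2 : K ^ δ ≤ y ^ δ := by gcongr
  have h3 : 1 ≤ K ^ (-δ) * y ^ δ := by
    rw [Real.rpow_neg hK.le, inv_mul_eq_div, one_le_div (by positivity)]
    exact h2
  rw [h1, ← mul_assoc]
  nlinarith [sq_nonneg y]

lemma mul_le_rpow_add_of_lt {K x y δ : ℝ} (hK : 0 < K) (hx : 0 ≤ x) (hy : K < y) (hδ : 0 < δ) :
    x * y ≤ K ^ (-δ) * (x ^ (2 + δ) + y ^ (2 + δ)) := by
  have hy0 : 0 < y := hK.trans hy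
  have hKp : 0 < K ^ (-δ) := by positivity
  rcases le_or_gt x y with h | h
  · have := sq_le_rpow_of_lt hK hy hδ
    have h2 : 0 ≤ K ^ (-δ) * x ^ (2 + δ) := by positivity
    nlinarith
  · have := sq_le_rpow_of_lt hK (hy.trans h) hδ
    have h2 : 0 ≤ K ^ (-δ) * y ^ (2 + δ) := by positivity
    nlinarith

/-! ### Distance to independence in total variation -/

section DepLE

variable {Ω S₁ S₂ T₁ T₂ : Type*} [MeasurableSpace Ω] [MeasurableSpace S₁] [MeasurableSpace S₂]
  [MeasurableSpace T₁] [MeasurableSpace T₂] {μ : Measure Ω}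

/-- `U` and `V` are `p`-close to independence in total variation: the product of their laws
exceeds their joint law by at most `p` on every measurable set. As both are probability laws, the
reverse inequality follows by taking complements. -/
def DepLE (μ : Measure Ω) (U : Ω → S₁) (V : Ω → S₂) (p : ℝ≥0∞) : Prop :=
  ∀ S : Set (S₁ × S₂), MeasurableSet S →
    ((μ.map U).prod (μ.map V)) S ≤ μ.map (fun ω => (U ω, V ω)) S + p

lemma DepLE.mono {U : Ω → S₁} {V : Ω → S₂} {p q : ℝ≥0∞} (h : DepLE μ U V p) (hpq : p ≤ q) :
    DepLE μ U V q := fun S hS => (h S hS).trans (by gcongr)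

lemma DepLE.comp [IsProbabilityMeasure μ] {U : Ω → S₁} {V : Ω → S₂} {p : ℝ≥0∞}
    (h : DepLE μ U V p) (hU : Measurable U) (hV : Measurable V) {f : S₁ → T₁} {g : S₂ → T₂}
    (hf : Measurable f) (hg : Measurable g) :
    DepLE μ (fun ω => f (U ω)) (fun ω => g (V ω)) p := by
  intro S hS
  have := Measure.isProbabilityMeasure_map (μ := μ) hU.aemeasurable
  have := Measure.isProbabilityMeasure_map (μ := μ) hV.aemeasurable
  have h1 : (μ.map (fun ω => f (U ω))).prod (μ.map (fun ω => g (V ω)))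
      = ((μ.map U).prod (μ.map V)).map (Prod.map f g) := by
    rw [← Measure.map_prod_map _ _ hf hg, Measure.map_map hf hU, Measure.map_map hg hV]; rfl
  have h2 : μ.map (fun ω => (f (U ω), g (V ω)))
      = (μ.map (fun ω => (U ω, V ω))).map (Prod.map f g) := by
    rw [Measure.map_map (hf.prodMap hg) (hU.prodMk hV)]; rfl
  rw [h1, h2, Measure.map_apply (hf.prodMap hg) hS, Measure.map_apply (hf.prodMap hg) hS]
  exact h _ (hf.prodMap hg hS)

/-- Changing the first variable on an event of probability `q` costs `2 q`. -/
lemma DepLE.of_measure_ne_le [IsProbabilityMeasure μ] {U U' : Ω → S₁} {V : Ω → S₂} {p q : ℝ≥0∞}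
    (h : DepLE μ U' V p) (hU : Measurable U) (hU' : Measurable U') (hV : Measurable V)
    (hq : μ {ω | U ω ≠ U' ω} ≤ q) : DepLE μ U V (p + 2 * q) := by
  intro S hS
  have := Measure.isProbabilityMeasure_map (μ := μ) hU.aemeasurable
  have := Measure.isProbabilityMeasure_map (μ := μ) hU'.aemeasurable
  have := Measure.isProbabilityMeasure_map (μ := μ) hV.aemeasurable
  have h1 : ((μ.map U).prod (μ.map V)) S ≤ ((μ.map U').prod (μ.map V)) S + q := by
    rw [Measure.prod_apply_symm hS, Measure.prod_apply_symm hS]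
    calc ∫⁻ y, (μ.map U) ((fun x => (x, y)) ⁻¹' S) ∂(μ.map V)
        ≤ ∫⁻ y, ((μ.map U') ((fun x => (x, y)) ⁻¹' S) + q) ∂(μ.map V) := by
          refine lintegral_mono fun y => ?_
          have hm : MeasurableSet ((fun x => (x, y)) ⁻¹' S) := measurable_prodMk_right hS
          rw [Measure.map_apply hU hm, Measure.map_apply hU' hm]
          calc μ (U ⁻¹' ((fun x => (x, y)) ⁻¹' S))
              ≤ μ (U' ⁻¹' ((fun x => (x, y)) ⁻¹' S) ∪ {ω | U ω ≠ U' ω}) := by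
                refine measure_mono fun ω hω => ?_
                by_cases hne : U ω = U' ω
                · left; simpa [← hne] using hω
                · right; exact hne
            _ ≤ _ := (measure_union_le _ _).trans (by gcongr)
      _ = _ := by rw [lintegral_add_right _ measurable_const]; simp
  have h2 : μ.map (fun ω => (U' ω, V ω)) S ≤ μ.map (fun ω => (U ω, V ω)) S + q := by
    rw [Measure.map_apply (hU'.prodMk hV) hS, Measure.map_apply (hU.prodMk hV) hS]
    calc μ ((fun ω => (U' ω, V ω)) ⁻¹' S)
        ≤ μ ((fun ω => (U ω, V ω)) ⁻¹' S ∪ {ω | U ω ≠ U' ω}) := by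
          refine measure_mono fun ω hω => ?_
          by_cases hne : U ω = U' ω
          · left; simpa [hne] using hω
          · right; exact hne
      _ ≤ _ := (measure_union_le _ _).trans (by gcongr)
  calc _ ≤ ((μ.map U').prod (μ.map V)) S + q := h1
    _ ≤ (μ.map (fun ω => (U' ω, V ω)) S + p) + q := by gcongr; exact h S hS
    _ ≤ (μ.map (fun ω => (U ω, V ω)) S + q + p) + q := by gcongr
    _ = _ := by ring

end DepLE

/-- If `ν ≤ π + p` on measurable sets, integrals of functions with values in `[0, c]` change by
at most `c p`: layer cake formula. -/
lemma integral_le_add_of_measure_le {S : Type*} [MeasurableSpace S] {π ν : Measure S}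
    [IsProbabilityMeasure π] [IsProbabilityMeasure ν] {p : ℝ≥0∞} (hp : p ≠ ∞)
    (h : ∀ A, MeasurableSet A → ν A ≤ π A + p) {f : S → ℝ} (hf : Measurable f) {c : ℝ}
    (h0 : ∀ x, 0 ≤ f x) (hc : ∀ x, f x ≤ c) :
    ∫ x, f x ∂ν ≤ ∫ x, f x ∂π + c * p.toReal := by
  have key : ∀ κ : Measure S, IsProbabilityMeasure κ →
      ∫⁻ x, ENNReal.ofReal (f x) ∂κ = ∫⁻ t in Set.Ioc 0 c, κ {a | t < f a} := by
    intro κ _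
    rw [lintegral_eq_lintegral_meas_lt κ (Eventually.of_forall h0) hf.aemeasurable,
      ← Set.Ioc_union_Ioi_eq_Ioi (le_max_left 0 c), lintegral_union measurableSet_Ioi
        (Set.disjoint_left.2 fun x hx hx' => absurd hx.2 (not_le.2 hx'))]
    have h1 : ∫⁻ t in Set.Ioi (max 0 c), κ {a | t < f a} = 0 := by
      rw [setLIntegral_congr_fun (g := fun _ => 0) measurableSet_Ioi]
      · simp
      · intro t ht
        have : {a | t < f a} = ∅ := by
          ext a
          simp only [Set.mem_ofPred_eq, Set.mem_empty_iff_false, iff_false, not_lt]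
          exact (hc a).trans ((le_max_right _ _).trans ht.le)
        simp [this]
    rw [h1, add_zero]
    congr 2
    ext x
    simp only [Set.mem_Ioc]
    constructor
    · rintro ⟨h1, h2⟩
      exact ⟨h1, by rcases le_max_iff.1 h2 with h3 | h3 <;> linarith⟩
    · rintro ⟨h1, h2⟩; exact ⟨h1, h2.trans (le_max_right _ _)⟩
  have hc0 : 0 ≤ c := by
    obtain ⟨x⟩ : Nonempty S := π.nonempty_of_neZero
    exact (h0 x).trans (hc x)
  have hbd : ∀ κ : Measure S, IsProbabilityMeasure κ → Integrable f κ := fun κ _ =>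
    Integrable.of_bound hf.aestronglyMeasurable c
      (Eventually.of_forall fun x => by rw [Real.norm_eq_abs, abs_of_nonneg (h0 x)]; exact hc x)
  have h1 : ∫⁻ x, ENNReal.ofReal (f x) ∂ν ≤ ∫⁻ x, ENNReal.ofReal (f x) ∂π + ENNReal.ofReal c * p := by
    rw [key ν inferInstance, key π inferInstance]
    calc ∫⁻ t in Set.Ioc 0 c, ν {a | t < f a}
        ≤ ∫⁻ t in Set.Ioc 0 c, (π {a | t < f a} + p) :=
          lintegral_mono fun t => h _ (measurableSet_lt measurable_const hf)
      _ = _ := by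
          rw [lintegral_add_right _ measurable_const]
          simp [mul_comm]
  rw [integral_eq_lintegral_of_nonneg_ae (Eventually.of_forall h0) hf.aestronglyMeasurable,
    integral_eq_lintegral_of_nonneg_ae (Eventually.of_forall h0) hf.aestronglyMeasurable]
  have hfin : ∫⁻ x, ENNReal.ofReal (f x) ∂π ≠ ∞ := (hbd π inferInstance).lintegral_lt_top.ne
  have h2 := ENNReal.toReal_mono (by finiteness) h1
  rwa [ENNReal.toReal_add hfin (by finiteness), ENNReal.toReal_mul, ENNReal.toReal_ofReal hc0] at h2

lemma abs_integral_sub_le_of_measure_le {S : Type*} [MeasurableSpace S] {π ν : Measure S}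
    [IsProbabilityMeasure π] [IsProbabilityMeasure ν] {p : ℝ≥0∞} (hp : p ≠ ∞)
    (h : ∀ A, MeasurableSet A → ν A ≤ π A + p) {f : S → ℝ} (hf : Measurable f) {K : ℝ}
    (hK : ∀ x, |f x| ≤ K) :
    |∫ x, f x ∂π - ∫ x, f x ∂ν| ≤ 2 * K * p.toReal := by
  have hbd : ∀ κ : Measure S, IsProbabilityMeasure κ → Integrable f κ := fun κ _ =>
    Integrable.of_bound hf.aestronglyMeasurable K (Eventually.of_forall hK)
  have h1 := integral_le_add_of_measure_le hp h (f := fun x => f x + K) (c := 2 * K)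
    (hf.add_const K) (fun x => by linarith [(abs_le.1 (hK x)).1])
    (fun x => by linarith [(abs_le.1 (hK x)).2])
  have h2 := integral_le_add_of_measure_le hp h (f := fun x => K - f x) (c := 2 * K)
    (hf.const_sub K) (fun x => by linarith [(abs_le.1 (hK x)).2])
    (fun x => by linarith [(abs_le.1 (hK x)).1])
  rw [integral_add (hbd _ inferInstance) (integrable_const _),
    integral_add (hbd _ inferInstance) (integrable_const _)] at h1
  rw [integral_sub (integrable_const _) (hbd _ inferInstance),
    integral_sub (integrable_const _) (hbd _ inferInstance)] at h2
  simp only [integral_const, probReal_univ, smul_eq_mul] at h1 h2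
  rw [abs_le]
  constructor <;> linarith

/-! ### Absolute regularity and the distance to independence -/

section Beta

variable {Ω S₁ S₂ : Type*} [MeasurableSpace S₁] [MeasurableSpace S₂]

/-- The algebra of sets `{(x, y) | y ∈ B (κ x)}`, where `κ` is measurable with finitely many
values; it consists of the finite unions of measurable rectangles. -/
def rectAlgebra (S₁ S₂ : Type*) [MeasurableSpace S₁] [MeasurableSpace S₂] : Set (Set (S₁ × S₂)) :=
  {S | ∃ (ι : Type) (_ : Fintype ι) (κ : S₁ → ι) (B : ι → Set S₂),
    (∀ i, MeasurableSet (κ ⁻¹' {i})) ∧ (∀ i, MeasurableSet (B i)) ∧ S = {x | x.2 ∈ B (κ x.1)}}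

lemma isSetAlgebra_rectAlgebra : IsSetAlgebra (rectAlgebra S₁ S₂) where
  empty_mem := ⟨Unit, inferInstance, fun _ => (), fun _ => ∅, by simp, by simp, by ext; simp⟩
  compl_mem := by
    rintro s ⟨ι, _, κ, B, hκ, hB, rfl⟩
    exact ⟨ι, inferInstance, κ, fun i => (B i)ᶜ, hκ, fun i => (hB i).compl, by ext; simp⟩
  union_mem := by
    rintro s t ⟨ι, _, κ, B, hκ, hB, rfl⟩ ⟨ι', _, κ', B', hκ', hB', rfl⟩
    refine ⟨ι × ι', inferInstance, fun x => (κ x, κ' x), fun i => B i.1 ∪ B' i.2, ?_,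
      fun i => (hB _).union (hB' _), by ext; simp⟩
    rintro ⟨i, i'⟩
    have : (fun x => (κ x, κ' x)) ⁻¹' {(i, i')} = κ ⁻¹' {i} ∩ κ' ⁻¹' {i'} := by
      ext; simp
    rw [this]
    exact (hκ i).inter (hκ' i')

lemma rect_eq_iUnion {R₁ R₂ ι : Type*} (κ : R₁ → ι) (B : ι → Set R₂) :
    {x : R₁ × R₂ | x.2 ∈ B (κ x.1)} = ⋃ i, (κ ⁻¹' {i}) ×ˢ B i := by
  ext x; simp

lemma generateFrom_rectAlgebra :
    (inferInstance : MeasurableSpace (S₁ × S₂)) = MeasurableSpace.generateFrom (rectAlgebra S₁ S₂) := by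
  apply le_antisymm
  · change Prod.instMeasurableSpace ≤ _
    rw [← generateFrom_prod]
    apply MeasurableSpace.generateFrom_mono
    rintro _ ⟨A, hA, B, hB, rfl⟩
    refine ⟨Prop, inferInstance, fun x => x ∈ A, fun p => {y | p ∧ y ∈ B}, ?_, ?_, ?_⟩
    · intro p
      by_cases hp : p
      · convert! (show MeasurableSet A from hA) using 1
        ext; simp [hp]
      · convert! (show MeasurableSet A from hA).compl using 1
        ext; simp [hp]
    · intro p
      by_cases hp : p
      · simpa [hp] using hB
      · simp [hp]
    · ext; simp
  · apply MeasurableSpace.generateFrom_le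
    rintro _ ⟨ι, _, κ, B, hκ, hB, rfl⟩
    rw [rect_eq_iUnion]
    exact MeasurableSet.iUnion fun i => (hκ i).prod (hB i)

/-- On a rectangle, the product law exceeds the joint law by at most the integral over `A` of any common
bound `g` for the conditional deviations. The integral extends over `A` only, so that summing over a
partition into sets `A` costs `∫ g` in total. -/
lemma measure_mul_le_of_condExp {𝓕 𝓖 : MeasurableSpace Ω} [m₀ : MeasurableSpace Ω]
    {μ : Measure Ω} [IsProbabilityMeasure μ] (hF : 𝓕 ≤ m₀) (hG : 𝓖 ≤ m₀) {g : Ω → ℝ≥0∞}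
    (hgb : ∀ A : Set Ω, MeasurableSet[𝓖] A →
      ∀ᵐ ω ∂μ, ENNReal.ofReal |(μ[A.indicator (fun _ => (1 : ℝ)) | 𝓕]) ω - μ.real A| ≤ g ω)
    {A B : Set Ω} (hA : MeasurableSet[𝓕] A) (hB : MeasurableSet[𝓖] B) :
    μ A * μ B ≤ μ (A ∩ B) + ∫⁻ ω in A, g ω ∂μ := by
  have hint : Integrable (B.indicator (fun _ => (1 : ℝ))) μ :=
    (integrable_const _).indicator (hG _ hB)
  have h1 : ∫ ω in A, (μ[B.indicator (fun _ => (1 : ℝ)) | 𝓕]) ω ∂μ = μ.real (A ∩ B) := by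
    rw [setIntegral_condExp hF hint hA, integral_indicator_const _ (hG _ hB)]
    simp [measureReal_restrict_apply (hG _ hB), Set.inter_comm]
  have h2 : μ.real A * μ.real B - μ.real (A ∩ B)
      ≤ ∫ ω in A, |(μ[B.indicator (fun _ => (1 : ℝ)) | 𝓕]) ω - μ.real B| ∂μ := by
    rw [← h1]
    have : μ.real A * μ.real B = ∫ _ in A, μ.real B ∂μ := by simp
    rw [this, ← integral_sub (integrable_const _) integrable_condExp.integrableOn]
    refine integral_mono ((integrable_const _).sub integrable_condExp.integrableOn)
      ((integrable_condExp.integrableOn.sub (integrable_const _)).abs) fun ω => ?_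
    simp only
    rw [abs_sub_comm]; exact le_abs_self _
  have h3 : ENNReal.ofReal (∫ ω in A, |(μ[B.indicator (fun _ => (1 : ℝ)) | 𝓕]) ω - μ.real B| ∂μ)
      ≤ ∫⁻ ω in A, g ω ∂μ := by
    have hi : Integrable (fun ω => |(μ[B.indicator (fun _ => (1 : ℝ)) | 𝓕]) ω - μ.real B|)
        (μ.restrict A) := (integrable_condExp.integrableOn.sub (integrable_const _)).abs
    rw [ofReal_integral_eq_lintegral_ofReal hi (Eventually.of_forall fun ω => abs_nonneg _)]
    exact lintegral_mono_ae (ae_restrict_of_ae (hgb B hB))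
  have h4 : μ A * μ B = ENNReal.ofReal (μ.real A * μ.real B) := by
    rw [ENNReal.ofReal_mul measureReal_nonneg, ofReal_measureReal, ofReal_measureReal]
  rw [h4]
  calc ENNReal.ofReal (μ.real A * μ.real B)
      ≤ ENNReal.ofReal (μ.real (A ∩ B) + (μ.real A * μ.real B - μ.real (A ∩ B))) := by
        gcongr; linarith
    _ ≤ ENNReal.ofReal (μ.real (A ∩ B)) + ENNReal.ofReal (μ.real A * μ.real B - μ.real (A ∩ B)) :=
        ENNReal.ofReal_add_le
    _ ≤ _ := by
        rw [ofReal_measureReal]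
        gcongr
        exact (ENNReal.ofReal_le_ofReal h2).trans h3

/-- The bound on rectangles, summed over the finitely many values of `κ`, holds on the algebra
`rectAlgebra`; every measurable set of the product is approximated by members of that algebra. -/
lemma depLE_of_condExp_le {𝓕 𝓖 : MeasurableSpace Ω} [m₀ : MeasurableSpace Ω]
    {μ : Measure Ω} [IsProbabilityMeasure μ] (hF : 𝓕 ≤ m₀) (hG : 𝓖 ≤ m₀) {g : Ω → ℝ≥0∞}
    (hgb : ∀ A : Set Ω, MeasurableSet[𝓖] A →
      ∀ᵐ ω ∂μ, ENNReal.ofReal |(μ[A.indicator (fun _ => (1 : ℝ)) | 𝓕]) ω - μ.real A| ≤ g ω)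
    {U : Ω → S₁} {V : Ω → S₂} (hU : Measurable[𝓕] U) (hV : Measurable[𝓖] V) :
    DepLE μ U V (∫⁻ ω, g ω ∂μ) := by
  have hU0 : Measurable U := hU.mono hF le_rfl
  have hV0 : Measurable V := hV.mono hG le_rfl
  have := Measure.isProbabilityMeasure_map (μ := μ) hU0.aemeasurable
  have := Measure.isProbabilityMeasure_map (μ := μ) hV0.aemeasurable
  have := Measure.isProbabilityMeasure_map (μ := μ) (hU0.prodMk hV0).aemeasurable
  set ν := (μ.map U).prod (μ.map V)
  set π := μ.map (fun ω => (U ω, V ω))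
  have hrect : ∀ S ∈ rectAlgebra S₁ S₂, ν S ≤ π S + ∫⁻ ω, g ω ∂μ := by
    rintro _ ⟨ι, _, κ, B, hκ, hB, rfl⟩
    have hdisj : Pairwise (Function.onFun Disjoint fun i => (κ ⁻¹' {i}) ×ˢ B i) := by
      intro i j hij
      refine Set.disjoint_left.2 fun x hx hx' => hij ?_
      rw [← show κ x.1 = i from hx.1, ← show κ x.1 = j from hx'.1]
    have hms : ∀ i, MeasurableSet ((κ ⁻¹' {i}) ×ˢ B i) := fun i => (hκ i).prod (hB i)
    rw [rect_eq_iUnion, measure_iUnion hdisj hms, measure_iUnion hdisj hms, tsum_fintype,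
      tsum_fintype]
    have hdisj' : Pairwise (Function.onFun Disjoint fun i => U ⁻¹' (κ ⁻¹' {i})) := by
      intro i j hij
      refine Set.disjoint_left.2 fun x hx hx' => hij ?_
      rw [← show κ (U x) = i from hx, ← show κ (U x) = j from hx']
    calc ∑ i, ν ((κ ⁻¹' {i}) ×ˢ B i)
        ≤ ∑ i, (π ((κ ⁻¹' {i}) ×ˢ B i) + ∫⁻ ω in U ⁻¹' (κ ⁻¹' {i}), g ω ∂μ) := by
          refine Finset.sum_le_sum fun i _ => ?_
          rw [Measure.prod_prod, Measure.map_apply hU0 (hκ i), Measure.map_apply hV0 (hB i),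
            Measure.map_apply (hU0.prodMk hV0) (hms i)]
          exact measure_mul_le_of_condExp hF hG hgb (hU (hκ i)) (hV (hB i))
      _ = ∑ i, π ((κ ⁻¹' {i}) ×ˢ B i) + ∫⁻ ω in ⋃ i, U ⁻¹' (κ ⁻¹' {i}), g ω ∂μ := by
          rw [Finset.sum_add_distrib, lintegral_iUnion (fun i => hU0 (hκ i)) hdisj', tsum_fintype]
      _ ≤ _ := add_le_add_right (setLIntegral_le_lintegral _ _) _
  intro S hS
  have hdense := Measure.MeasureDense.of_generateFrom_isSetAlgebra_finite (π + ν)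
    (isSetAlgebra_rectAlgebra (S₁ := S₁) (S₂ := S₂)) generateFrom_rectAlgebra
  refine ENNReal.le_of_forall_pos_le_add fun ε hε _ => ?_
  obtain ⟨t, ht, hlt⟩ := hdense.approx S hS (by finiteness) (ε / 2) (by positivity)
  rw [Measure.add_apply] at hlt
  have hε2 : ENNReal.ofReal ((ε : ℝ) / 2) = (ε : ℝ≥0∞) / 2 := by
    rw [ENNReal.ofReal_div_of_pos two_pos]; simp
  rw [hε2] at hlt
  have h1 : ν S ≤ ν t + ε / 2 := by
    calc ν S ≤ ν (t ∪ symmDiff S t) := measure_mono fun x hx => by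
            by_cases hxt : x ∈ t
            · exact Or.inl hxt
            · exact Or.inr (Or.inl ⟨hx, hxt⟩)
      _ ≤ ν t + ν (symmDiff S t) := measure_union_le _ _
      _ ≤ _ := by gcongr; exact le_add_self.trans hlt.le
  have h2 : π t ≤ π S + ε / 2 := by
    calc π t ≤ π (S ∪ symmDiff S t) := measure_mono fun x hx => by
            by_cases hxt : x ∈ S
            · exact Or.inl hxt
            · exact Or.inr (Or.inr ⟨hx, hxt⟩)
      _ ≤ π S + π (symmDiff S t) := measure_union_le _ _
      _ ≤ _ := by gcongr; exact le_self_add.trans hlt.le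
  calc ν S ≤ ν t + ε / 2 := h1
    _ ≤ π t + ∫⁻ ω, g ω ∂μ + ε / 2 := by gcongr; exact hrect t ht
    _ ≤ π S + ε / 2 + ∫⁻ ω, g ω ∂μ + ε / 2 := by gcongr
    _ = π S + ∫⁻ ω, g ω ∂μ + (ε / 2 + ε / 2) := by ring
    _ = _ := by rw [ENNReal.add_halves]

/-- Variables measurable with respect to two σ-fields are as close to independence as the
absolute regularity coefficient between the σ-fields says. -/
lemma depLE_betaBetween {𝓕 𝓖 : MeasurableSpace Ω} [m₀ : MeasurableSpace Ω]
    {μ : Measure Ω} [IsProbabilityMeasure μ] (hF : 𝓕 ≤ m₀) (hG : 𝓖 ≤ m₀)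
    {U : Ω → S₁} {V : Ω → S₂} (hU : Measurable[𝓕] U) (hV : Measurable[𝓖] V) :
    DepLE μ U V (betaBetween 𝓕 𝓖 μ) := by
  intro S hS
  rw [← tsub_le_iff_left]
  refine le_iInf fun g => le_iInf fun _ => le_iInf fun hgb => ?_
  rw [tsub_le_iff_left]
  exact depLE_of_condExp_le hF hG hgb hU hV S hS

lemma betaBetween_le_two {𝓕 𝓖 : MeasurableSpace Ω} [m₀ : MeasurableSpace Ω]
    {μ : Measure Ω} [IsProbabilityMeasure μ] :
    betaBetween 𝓕 𝓖 μ ≤ 2 := by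
  have h0 : ∫⁻ _ : Ω, 2 ∂μ = 2 := by simp
  rw [← h0]
  refine iInf_le_of_le (fun _ => 2) (iInf_le_of_le measurable_const (iInf_le_of_le ?_ le_rfl))
  intro A hA
  have h1 : ∀ᵐ ω ∂μ, |(μ[A.indicator (fun _ => (1 : ℝ)) | 𝓕]) ω| ≤ (1 : ℝ) :=
    ae_bdd_abs_condExp_of_ae_bdd_abs (Eventually.of_forall fun ω => by
      by_cases h : ω ∈ A <;> simp [h])
  filter_upwards [h1] with ω hω
  have h2 : |(μ[A.indicator (fun _ => (1 : ℝ)) | 𝓕]) ω - μ.real A| ≤ 2 := by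
    have h3 : μ.real A ≤ 1 := measureReal_le_one
    have h4 : 0 ≤ μ.real A := measureReal_nonneg
    have h5 := abs_le.1 hω
    rw [abs_le]
    constructor <;> linarith
  calc _ ≤ ENNReal.ofReal 2 := ENNReal.ofReal_le_ofReal h2
    _ = 2 := by simp

lemma betaBetween_mono_right {𝓕 𝓖 𝓖' : MeasurableSpace Ω} [m₀ : MeasurableSpace Ω]
    {μ : Measure Ω} (h : 𝓖 ≤ 𝓖') : betaBetween 𝓕 𝓖 μ ≤ betaBetween 𝓕 𝓖' μ := by
  refine le_iInf fun g => le_iInf fun hg => le_iInf fun hgb => ?_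
  exact iInf_le_of_le g (iInf_le_of_le hg (iInf_le_of_le (fun A hA => hgb A (h _ hA)) le_rfl))

end Beta

/-! ### Strong mixing and the distance to independence -/

section Khintchine

variable {ι : Type*} [DecidableEq ι]

/-- The signed sum with sign `+` on `T` and `-` on the rest of `I`. -/
def signSum (x : ι → ℝ) (I T : Finset ι) : ℝ := 2 * ∑ i ∈ T, x i - ∑ i ∈ I, x i

lemma sum_powerset_signSum_insert (x : ι → ℝ) {a : ι} {I : Finset ι} (ha : a ∉ I) (φ : ℝ → ℝ) :
    ∑ T ∈ (insert a I).powerset, φ (signSum x (insert a I) T)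
      = ∑ T ∈ I.powerset, (φ (signSum x I T - x a) + φ (signSum x I T + x a)) := by
  rw [Finset.sum_powerset_insert ha, ← Finset.sum_add_distrib]
  refine Finset.sum_congr rfl fun T hT => ?_
  have haT : a ∉ T := fun h => ha (Finset.mem_powerset.1 hT h)
  simp only [signSum, Finset.sum_insert ha, Finset.sum_insert haT]
  ring_nf

lemma sum_powerset_signSum_sq (x : ι → ℝ) (I : Finset ι) :
    ∑ T ∈ I.powerset, signSum x I T ^ 2 = 2 ^ I.card * ∑ i ∈ I, x i ^ 2 := by
  induction I using Finset.induction_on with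
  | empty => simp [signSum]
  | insert a I ha ih =>
    rw [sum_powerset_signSum_insert x ha (fun t => t ^ 2), Finset.sum_insert ha,
      Finset.card_insert_of_notMem ha]
    have : ∀ T, (signSum x I T - x a) ^ 2 + (signSum x I T + x a) ^ 2
        = 2 * signSum x I T ^ 2 + 2 * x a ^ 2 := fun T => by ring
    simp only [this, Finset.sum_add_distrib, ← Finset.mul_sum, ih, Finset.sum_const,
      Finset.card_powerset, nsmul_eq_mul]
    push_cast
    ring

lemma sum_powerset_signSum_pow_four (x : ι → ℝ) (I : Finset ι) :
    ∑ T ∈ I.powerset, signSum x I T ^ 4 ≤ 3 * 2 ^ I.card * (∑ i ∈ I, x i ^ 2) ^ 2 := by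
  induction I using Finset.induction_on with
  | empty => simp [signSum]
  | insert a I ha ih =>
    rw [sum_powerset_signSum_insert x ha (fun t => t ^ 4), Finset.sum_insert ha,
      Finset.card_insert_of_notMem ha]
    have : ∀ T, (signSum x I T - x a) ^ 4 + (signSum x I T + x a) ^ 4
        = 2 * signSum x I T ^ 4 + 12 * x a ^ 2 * signSum x I T ^ 2 + 2 * x a ^ 4 :=
      fun T => by ring
    simp only [this, Finset.sum_add_distrib, ← Finset.mul_sum, sum_powerset_signSum_sq,
      Finset.sum_const, Finset.card_powerset, nsmul_eq_mul]
    push_cast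
    have h2 : (0 : ℝ) < 2 ^ I.card := by positivity
    have h4 : 0 ≤ 2 ^ I.card * x a ^ 4 := by positivity
    have h5 : 3 * 2 ^ (I.card + 1) * (x a ^ 2 + ∑ i ∈ I, x i ^ 2) ^ 2
        = 2 * (3 * 2 ^ I.card * (∑ i ∈ I, x i ^ 2) ^ 2)
          + 12 * x a ^ 2 * (2 ^ I.card * ∑ i ∈ I, x i ^ 2) + 6 * (2 ^ I.card * x a ^ 4) := by ring
    rw [h5]
    linarith

/-- Khintchine's inequality in `L¹`: the average modulus of the signed sums of `x` dominates the
Euclidean norm of `x`, and hence its `ℓ¹` norm up to the square root of the number of entries. -/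
lemma sum_abs_le_sum_abs_signSum (x : ι → ℝ) (I : Finset ι) :
    2 ^ I.card * ∑ i ∈ I, |x i|
      ≤ 3 * Real.sqrt I.card * ∑ T ∈ I.powerset, |signSum x I T| := by
  set s := ∑ i ∈ I, x i ^ 2 with hs
  have hs0 : 0 ≤ s := Finset.sum_nonneg fun i _ => sq_nonneg _
  have h1 : ∑ i ∈ I, |x i| ≤ Real.sqrt I.card * Real.sqrt s := by
    rw [← Real.sqrt_mul (Nat.cast_nonneg _)]
    apply Real.le_sqrt_of_sq_le
    have := sq_sum_le_card_mul_sum_sq (s := I) (f := fun i => |x i|)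
    simpa [hs] using this
  have h2 : 2 ^ I.card * Real.sqrt s ≤ 3 * ∑ T ∈ I.powerset, |signSum x I T| := by
    rcases hs0.eq_or_lt with h | h
    · rw [← h]; simp; positivity
    set l := Real.sqrt s with hl
    have hl0 : 0 < l := Real.sqrt_pos.2 h
    have hls : l ^ 2 = s := Real.sq_sqrt hs0
    -- a polynomial minorant of `|t|` whose average is controlled by second and fourth moments
    have hpt : ∀ t : ℝ, (6 * l ^ 2 * t ^ 2 - t ^ 4) ≤ 8 * l ^ 3 * |t| := by
      intro t
      have ht : t ^ 2 = |t| ^ 2 := (sq_abs t).symm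
      have ht4 : t ^ 4 = |t| ^ 4 := by rw [show t ^ 4 = (t ^ 2) ^ 2 by ring, ht]; ring
      rw [ht, ht4]
      have hu : 0 ≤ |t| := abs_nonneg t
      generalize |t| = u at *
      have h5 : 8 * l ^ 3 - 6 * l ^ 2 * u + u ^ 3 ≥ 0 := by
        nlinarith [sq_nonneg (u - 3 / 2 * l), mul_nonneg hu (sq_nonneg (u - 3 / 2 * l)),
          mul_nonneg hl0.le (sq_nonneg (u - 3 / 2 * l)), pow_pos hl0 3,
          mul_nonneg hl0.le (sq_nonneg u), mul_nonneg hu (sq_nonneg l)]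
      nlinarith
    have h3 : ∑ T ∈ I.powerset, (6 * l ^ 2 * signSum x I T ^ 2 - signSum x I T ^ 4)
        ≤ 8 * l ^ 3 * ∑ T ∈ I.powerset, |signSum x I T| := by
      rw [Finset.mul_sum]; exact Finset.sum_le_sum fun T _ => hpt _
    rw [Finset.sum_sub_distrib, ← Finset.mul_sum, sum_powerset_signSum_sq] at h3
    have h4 := sum_powerset_signSum_pow_four x I
    rw [← hs, ← hls] at h4 h3
    have h5 : 3 * 2 ^ I.card * l ^ 4 ≤ 8 * l ^ 3 * ∑ T ∈ I.powerset, |signSum x I T| := by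
      nlinarith
    have h6 : 3 * 2 ^ I.card * l ≤ 8 * ∑ T ∈ I.powerset, |signSum x I T| := by
      have hl3 : 0 < l ^ 3 := by positivity
      refine le_of_mul_le_mul_left ?_ hl3
      nlinarith
    nlinarith [show 0 < 2 ^ I.card * l by positivity]
  calc 2 ^ I.card * ∑ i ∈ I, |x i| ≤ 2 ^ I.card * (Real.sqrt I.card * Real.sqrt s) := by gcongr
    _ = Real.sqrt I.card * (2 ^ I.card * Real.sqrt s) := by ring
    _ ≤ Real.sqrt I.card * (3 * ∑ T ∈ I.powerset, |signSum x I T|) := by gcongr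
    _ = _ := by ring

end Khintchine

/-- If covariances of events of `𝓕` and `𝓖` are at most `a`, an `𝓕`-measurable `κ` with `N` values is
of order `√N a` close to being independent of `𝓖`: the conditional expectations of the centred
indicators of `{κ = i}` given `𝓖`, summed over `i` in modulus, are controlled by Khintchine's
inequality through their signed sums, which belong to single events of `𝓕`. -/
lemma depLE_of_alpha {Ω S ι : Type*} {𝓕 𝓖 : MeasurableSpace Ω} [m₀ : MeasurableSpace Ω]
    [MeasurableSpace S] [DecidableEq ι] [Countable ι] [MeasurableSpace ι]
    [MeasurableSingletonClass ι] {μ : Measure Ω} [IsProbabilityMeasure μ] (hF : 𝓕 ≤ m₀)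
    (hG : 𝓖 ≤ m₀) {a : ℝ}
    (ha : ∀ A B, MeasurableSet[𝓕] A → MeasurableSet[𝓖] B →
      |μ.real (A ∩ B) - μ.real A * μ.real B| ≤ a)
    {κ : Ω → ι} {I : Finset ι} (hκI : ∀ ω, κ ω ∈ I) (hκ : Measurable[𝓕] κ)
    {V : Ω → S} (hV : Measurable[𝓖] V) :
    DepLE μ κ V (ENNReal.ofReal (18 * Real.sqrt I.card * a)) := by
  have hκ0 : Measurable κ := hκ.mono hF le_rfl
  have hV0 : Measurable V := hV.mono hG le_rfl
  have := Measure.isProbabilityMeasure_map (μ := μ) hκ0.aemeasurable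
  have := Measure.isProbabilityMeasure_map (μ := μ) hV0.aemeasurable
  have := Measure.isProbabilityMeasure_map (μ := μ) (hκ0.prodMk hV0).aemeasurable
  have hAm : ∀ i, MeasurableSet[𝓕] (κ ⁻¹' {i}) := fun i => hκ (measurableSet_singleton i)
  have hAm0 : ∀ i, MeasurableSet (κ ⁻¹' {i}) := fun i => hF _ (hAm i)
  have hint : ∀ i, Integrable ((κ ⁻¹' {i}).indicator (fun _ => (1 : ℝ))) μ := fun i =>
    (integrable_const _).indicator (hAm0 i)
  set ξ : ι → Ω → ℝ := fun i ω =>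
    (μ[(κ ⁻¹' {i}).indicator (fun _ => (1 : ℝ)) | 𝓖]) ω - μ.real (κ ⁻¹' {i}) with hξ
  have hξi : ∀ i, Integrable (ξ i) μ := fun i => integrable_condExp.sub (integrable_const _)
  have hξm : ∀ i, Measurable[𝓖] (ξ i) := fun i =>
    stronglyMeasurable_condExp.measurable.sub measurable_const
  have hξB : ∀ i B, MeasurableSet[𝓖] B →
      ∫ ω in B, ξ i ω ∂μ = μ.real (κ ⁻¹' {i} ∩ B) - μ.real (κ ⁻¹' {i}) * μ.real B := by
    intro i B hB
    simp only [hξ]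
    rw [integral_sub integrable_condExp.integrableOn (integrable_const _),
      setIntegral_condExp hG (hint i) hB, integral_indicator_const _ (hAm0 i)]
    simp [measureReal_restrict_apply (hAm0 i), mul_comm]
  have hsumB : ∀ (T : Finset ι) B, MeasurableSet[𝓖] B →
      |∫ ω in B, ∑ i ∈ T, ξ i ω ∂μ| ≤ a := by
    intro T B hB
    rw [integral_finsetSum _ fun i _ => (hξi i).integrableOn]
    simp only [hξB _ B hB, Finset.sum_sub_distrib, ← Finset.sum_mul]
    have h1 : ∑ i ∈ T, μ.real (κ ⁻¹' {i} ∩ B) = μ.real (κ ⁻¹' (T : Set ι) ∩ B) := by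
      have : κ ⁻¹' (T : Set ι) ∩ B = ⋃ i ∈ T, (κ ⁻¹' {i} ∩ B) := by
        ext; simp
      rw [this, measureReal_biUnion_finset]
      · intro i _ j _ hij
        refine Set.disjoint_left.2 fun x hx hx' => hij ?_
        rw [← show κ x = i from hx.1, ← show κ x = j from hx'.1]
      · exact fun i _ => (hAm0 i).inter (hG _ hB)
    have h2 : ∑ i ∈ T, μ.real (κ ⁻¹' {i}) = μ.real (κ ⁻¹' (T : Set ι)) := by
      have : κ ⁻¹' (T : Set ι) = ⋃ i ∈ T, κ ⁻¹' {i} := by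
        ext; simp
      rw [this, measureReal_biUnion_finset]
      · intro i _ j _ hij
        refine Set.disjoint_left.2 fun x hx hx' => hij ?_
        rw [← show κ x = i from hx, ← show κ x = j from hx']
      · exact fun i _ => hAm0 i
    rw [h1, h2]
    exact ha _ _ (hκ (Set.to_countable _).measurableSet) hB
  have hsign : ∀ T : Finset ι, ∫ ω, |signSum (fun i => ξ i ω) I T| ∂μ ≤ 6 * a := by
    intro T
    have hiT : ∀ T : Finset ι, Integrable (fun ω => ∑ i ∈ T, ξ i ω) μ := fun T =>
      integrable_finsetSum _ fun i _ => hξi i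
    have hm : Measurable[𝓖] fun ω => signSum (fun i => ξ i ω) I T := by
      unfold signSum
      exact (measurable_const.mul (Finset.measurable_fun_sum _ fun i _ => hξm i)).sub
        (Finset.measurable_fun_sum _ fun i _ => hξm i)
    have hii : Integrable (fun ω => signSum (fun i => ξ i ω) I T) μ :=
      ((hiT T).const_mul 2).sub (hiT I)
    set B : Set Ω := {ω | 0 ≤ signSum (fun i => ξ i ω) I T} with hB
    have hBm : MeasurableSet[𝓖] B := measurableSet_le measurable_const hm
    have hset : ∀ C, MeasurableSet[𝓖] C →
        |∫ ω in C, signSum (fun i => ξ i ω) I T ∂μ| ≤ 3 * a := by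
      intro C hC
      unfold signSum
      rw [integral_sub ((hiT T).const_mul 2).integrableOn (hiT I).integrableOn,
        integral_const_mul]
      have h1 := abs_le.1 (hsumB T C hC)
      have h2 := abs_le.1 (hsumB I C hC)
      rw [abs_le]; constructor <;> linarith
    rw [← integral_add_compl (hG _ hBm) hii.abs]
    have e1 : ∫ ω in B, |signSum (fun i => ξ i ω) I T| ∂μ
        = ∫ ω in B, signSum (fun i => ξ i ω) I T ∂μ :=
      setIntegral_congr_fun (hG _ hBm) fun ω hω => abs_of_nonneg hω
    have e2 : ∫ ω in Bᶜ, |signSum (fun i => ξ i ω) I T| ∂μ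
        = - ∫ ω in Bᶜ, signSum (fun i => ξ i ω) I T ∂μ := by
      rw [← integral_neg]
      exact setIntegral_congr_fun (hG _ hBm).compl fun ω hω => abs_of_neg (not_le.1 hω)
    rw [e1, e2]
    have h1 := abs_le.1 (hset B hBm)
    have h2 := abs_le.1 (hset Bᶜ hBm.compl)
    linarith
  have hsum : ∑ i ∈ I, ∫ ω, |ξ i ω| ∂μ ≤ 18 * Real.sqrt I.card * a := by
    have h1 : ∫ ω, 2 ^ I.card * ∑ i ∈ I, |ξ i ω| ∂μ
        ≤ ∫ ω, 3 * Real.sqrt I.card * ∑ T ∈ I.powerset, |signSum (fun i => ξ i ω) I T| ∂μ := by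
      refine integral_mono ((integrable_finsetSum _ fun i _ => (hξi i).abs).const_mul _)
        ((integrable_finsetSum _ fun T _ => Integrable.abs ?_).const_mul _)
        fun ω => sum_abs_le_sum_abs_signSum _ I
      exact ((integrable_finsetSum _ fun i _ => hξi i).const_mul 2).sub
        (integrable_finsetSum _ fun i _ => hξi i)
    rw [integral_const_mul, integral_const_mul, integral_finsetSum _ fun i _ => (hξi i).abs,
      integral_finsetSum] at h1
    · have h2 : ∑ T ∈ I.powerset, ∫ ω, |signSum (fun i => ξ i ω) I T| ∂μ
          ≤ 2 ^ I.card * (6 * a) := by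
        refine (Finset.sum_le_sum fun T _ => hsign T).trans ?_
        simp
      have h3 : (0 : ℝ) < 2 ^ I.card := by positivity
      refine le_of_mul_le_mul_left (h1.trans ?_) h3
      calc _ ≤ 3 * Real.sqrt I.card * (2 ^ I.card * (6 * a)) := by gcongr
        _ = _ := by ring
    · intro T _
      refine Integrable.abs ?_
      exact ((integrable_finsetSum _ fun i _ => hξi i).const_mul 2).sub
        (integrable_finsetSum _ fun i _ => hξi i)
  intro C hC
  set D : ι → Set S := fun i => Prod.mk i ⁻¹' C with hD
  have hDm : ∀ i, MeasurableSet (D i) := fun i => measurable_prodMk_left hC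
  have hprod : ((μ.map κ).prod (μ.map V)) C = ∑ i ∈ I, μ (κ ⁻¹' {i}) * μ (V ⁻¹' D i) := by
    rw [Measure.prod_apply hC, lintegral_countable', tsum_eq_sum (s := I)]
    · refine Finset.sum_congr rfl fun i _ => ?_
      rw [Measure.map_apply hκ0 (measurableSet_singleton i), Measure.map_apply hV0 (hDm i),
        mul_comm]
    · intro i hi
      rw [Measure.map_apply hκ0 (measurableSet_singleton i)]
      have : κ ⁻¹' {i} = ∅ := by
        ext ω
        simp only [Set.mem_preimage, Set.mem_singleton_iff, Set.mem_empty_iff_false, iff_false]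
        exact fun h => hi (h ▸ hκI ω)
      simp [this]
  have hjoint : μ.map (fun ω => (κ ω, V ω)) C = ∑ i ∈ I, μ (κ ⁻¹' {i} ∩ V ⁻¹' D i) := by
    rw [Measure.map_apply (hκ0.prodMk hV0) hC]
    have : (fun ω => (κ ω, V ω)) ⁻¹' C = ⋃ i ∈ I, (κ ⁻¹' {i} ∩ V ⁻¹' D i) := by
      ext ω
      simp only [Set.mem_preimage, Set.mem_iUnion, Set.mem_inter_iff, Set.mem_singleton_iff, hD,
        exists_prop]
      constructor
      · exact fun h => ⟨κ ω, hκI ω, rfl, h⟩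
      · rintro ⟨i, _, rfl, h⟩; exact h
    rw [this, measure_biUnion_finset]
    · intro i _ j _ hij
      refine Set.disjoint_left.2 fun x hx hx' => hij ?_
      rw [← show κ x = i from hx.1, ← show κ x = j from hx'.1]
    · exact fun i _ => (hAm0 i).inter (hV0 (hDm i))
  rw [hprod, hjoint]
  calc ∑ i ∈ I, μ (κ ⁻¹' {i}) * μ (V ⁻¹' D i)
      ≤ ∑ i ∈ I, (μ (κ ⁻¹' {i} ∩ V ⁻¹' D i) + ENNReal.ofReal (∫ ω, |ξ i ω| ∂μ)) := by
        refine Finset.sum_le_sum fun i _ => ?_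
        have h1 : -∫ ω in V ⁻¹' D i, ξ i ω ∂μ ≤ ∫ ω, |ξ i ω| ∂μ := by
          rw [← integral_neg]
          calc ∫ ω in V ⁻¹' D i, -ξ i ω ∂μ ≤ ∫ ω in V ⁻¹' D i, |ξ i ω| ∂μ :=
                integral_mono (hξi i).neg.integrableOn (hξi i).abs.integrableOn
                  fun ω => neg_le_abs _
            _ ≤ _ := setIntegral_le_integral (hξi i).abs (Eventually.of_forall fun _ => abs_nonneg _)
        rw [hξB i _ (hV (hDm i))] at h1
        rw [← ofReal_measureReal (μ := μ) (s := κ ⁻¹' {i}),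
          ← ofReal_measureReal (μ := μ) (s := V ⁻¹' D i),
          ← ofReal_measureReal (μ := μ) (s := κ ⁻¹' {i} ∩ V ⁻¹' D i),
          ← ENNReal.ofReal_mul measureReal_nonneg,
          ← ENNReal.ofReal_add measureReal_nonneg (integral_nonneg fun _ => abs_nonneg _)]
        apply ENNReal.ofReal_le_ofReal
        linarith
    _ = ∑ i ∈ I, μ (κ ⁻¹' {i} ∩ V ⁻¹' D i) + ENNReal.ofReal (∑ i ∈ I, ∫ ω, |ξ i ω| ∂μ) := by
        rw [Finset.sum_add_distrib, ENNReal.ofReal_sum_of_nonneg]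
        exact fun i _ => integral_nonneg fun _ => abs_nonneg _
    _ ≤ _ := by gcongr

/-! ### Couplings that preserve cells -/

section CouplingDensity

variable {ι : Type*}

/-- The mass by which `b` exceeds `a`; for probability vectors, their total variation distance. -/
noncomputable def excess (a b : ι → ℝ≥0∞) : ℝ≥0∞ := ∑' j, (b j - min (a j) (b j))

variable {a b : ι → ℝ≥0∞}

lemma excess_comm (ha : ∑' i, a i = 1) (hb : ∑' i, b i = 1) : excess a b = excess b a := by
  have h1 : ∑' i, min (a i) (b i) + excess a b = 1 := by
    rw [excess, ← ENNReal.tsum_add, ← hb]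
    exact tsum_congr fun i => add_tsub_cancel_of_le (min_le_right _ _)
  have h2 : ∑' i, min (a i) (b i) + excess b a = 1 := by
    rw [excess, ← ENNReal.tsum_add, ← ha]
    exact tsum_congr fun i => by
      rw [min_comm (b i)]; exact add_tsub_cancel_of_le (min_le_left _ _)
  have h3 : ∑' i, min (a i) (b i) ≠ ∞ := by
    refine ne_top_of_le_ne_top ENNReal.one_ne_top (h1 ▸ le_self_add)
  exact (ENNReal.add_right_inj h3).1 (h1.trans h2.symm)

lemma mul_one_sub_min_div {x y : ℝ≥0∞} (hy : y ≠ ∞) : y * (1 - min x y / y) = y - min x y := by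
  rcases eq_or_ne y 0 with rfl | h0
  · simp
  rw [ENNReal.mul_sub (fun _ _ => hy), mul_one, ENNReal.mul_div_cancel h0 hy]

lemma ne_top_of_tsum_eq_one (hb : ∑' i, b i = 1) (i : ι) : b i ≠ ∞ :=
  ne_top_of_le_ne_top ENNReal.one_ne_top (hb ▸ ENNReal.le_tsum i)

variable [DecidableEq ι]

/-- The density, with respect to the product of the probability vectors `a` and `b`, of their
maximal coupling: the common part `min a b` stays on the diagonal, and the two remainders are
coupled independently. -/
noncomputable def coupDens (a b : ι → ℝ≥0∞) (i i' : ι) : ℝ≥0∞ :=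
  (if i = i' then min (a i) (b i) / (a i * b i) else 0) +
    (1 - min (a i) (b i) / a i) * (1 - min (a i') (b i') / b i') / excess a b

lemma coupDens_comm (ha : ∑' i, a i = 1) (hb : ∑' i, b i = 1) (i i' : ι) :
    coupDens a b i i' = coupDens b a i' i := by
  unfold coupDens
  rw [excess_comm ha hb]
  congr 1
  · by_cases h : i = i'
    · subst h; simp [min_comm, mul_comm]
    · simp [h, Ne.symm h]
  · rw [mul_comm (1 - _), min_comm (a i), min_comm (a i')]

lemma tsum_mul_coupDens (ha : ∑' i, a i = 1) (hb : ∑' i, b i = 1) {i : ι} (hi : a i ≠ 0) :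
    ∑' i', b i' * coupDens a b i i' = 1 := by
  have hat := ne_top_of_tsum_eq_one ha
  have hbt := ne_top_of_tsum_eq_one hb
  have h1 : ∑' i', b i' * (if i = i' then min (a i) (b i) / (a i * b i) else 0)
      = min (a i) (b i) / a i := by
    rw [tsum_eq_single i (fun j hj => by simp [hj.symm])]
    rcases eq_or_ne (b i) 0 with h0 | h0
    · simp [h0]
    · simp only [if_true]
      rw [ENNReal.div_eq_inv_mul, ENNReal.mul_inv (Or.inl hi) (Or.inl (hat i)),
        ENNReal.div_eq_inv_mul]
      calc _ = (b i * (b i)⁻¹) * ((a i)⁻¹ * min (a i) (b i)) := by ring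
        _ = _ := by rw [ENNReal.mul_inv_cancel h0 (hbt i), one_mul]
  have h2 : ∑' i', b i' * ((1 - min (a i) (b i) / a i) * (1 - min (a i') (b i') / b i')
      / excess a b) = (1 - min (a i) (b i) / a i) / excess a b * excess a b := by
    refine Eq.trans (tsum_congr fun j => ?_) (ENNReal.tsum_mul_left
      (a := (1 - min (a i) (b i) / a i) / excess a b) (f := fun j => b j - min (a j) (b j)))
    rw [← mul_one_sub_min_div (hbt j)]
    simp only [div_eq_mul_inv]
    ring
  simp only [coupDens, mul_add]
  rw [ENNReal.tsum_add, h1, h2]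
  have hle : min (a i) (b i) / a i ≤ 1 := ENNReal.div_le_of_le_mul (by simp)
  rcases eq_or_ne (excess a b) 0 with h0 | h0
  · have h3 : a i - min (b i) (a i) = 0 := by
      rw [excess_comm ha hb, excess, ENNReal.tsum_eq_zero] at h0
      exact h0 i
    have h4 : min (a i) (b i) = a i := by
      rw [min_comm] at h3
      exact le_antisymm (min_le_left _ _) (tsub_eq_zero_iff_le.1 h3)
    rw [h4, ENNReal.div_self hi (hat i)]
    simp
  · have ht : excess a b ≠ ∞ := by
      refine ne_top_of_le_ne_top ENNReal.one_ne_top ?_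
      rw [← hb]
      exact ENNReal.tsum_le_tsum fun j => tsub_le_self
    rw [ENNReal.div_mul_cancel h0 ht, add_tsub_cancel_of_le hle]

lemma tsum_mul_coupDens' (ha : ∑' i, a i = 1) (hb : ∑' i, b i = 1) {i' : ι} (hi : b i' ≠ 0) :
    ∑' i, a i * coupDens a b i i' = 1 := by
  simp only [coupDens_comm ha hb _ i']
  exact tsum_mul_coupDens hb ha hi

lemma tsum_tsum_coupDens_le (ha : ∑' i, a i = 1) (hb : ∑' i, b i = 1) :
    ∑' i, a i * ∑' i', b i' * (if i = i' then 0 else coupDens a b i i') ≤ excess a b := by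
  have hat := ne_top_of_tsum_eq_one ha
  have hbt := ne_top_of_tsum_eq_one hb
  calc ∑' i, a i * ∑' i', b i' * (if i = i' then 0 else coupDens a b i i')
      ≤ ∑' i, a i * ∑' i', b i' * ((1 - min (a i) (b i) / a i) *
          (1 - min (a i') (b i') / b i') / excess a b) := by
        gcongr with i i'
        by_cases h : i = i' <;> simp [h, coupDens]
    _ = ∑' i, (a i - min (b i) (a i)) * ((excess a b)⁻¹ * excess a b) := by
        refine tsum_congr fun i => ?_
        rw [← mul_one_sub_min_div (hat i), min_comm (b i)]
        conv_rhs => rw [mul_assoc]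
        congr 1
        conv_rhs => rw [← mul_assoc]; arg 2; rw [excess]
        rw [← ENNReal.tsum_mul_left]
        refine tsum_congr fun j => ?_
        rw [← mul_one_sub_min_div (hbt j), div_eq_mul_inv]
        ring
    _ ≤ ∑' i, (a i - min (b i) (a i)) * 1 := by
        gcongr
        exact ENNReal.inv_mul_le_one _
    _ = excess b a := by simp [excess]
    _ ≤ _ := (excess_comm ha hb).ge

end CouplingDensity

section Coupling

variable {S₁ S₂ ι : Type*} [MeasurableSpace S₁] [MeasurableSpace S₂] [MeasurableSpace ι]
  [Countable ι] [MeasurableSingletonClass ι]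

lemma lintegral_comp_countable {P : Measure S₁} {c : S₁ → ι} (hc : Measurable c)
    (ψ : ι → ℝ≥0∞) : ∫⁻ x, ψ (c x) ∂P = ∑' i, P (c ⁻¹' {i}) * ψ i := by
  rw [← lintegral_map (measurable_of_countable ψ) hc, lintegral_countable']
  exact tsum_congr fun i => by rw [Measure.map_apply hc (measurableSet_singleton i), mul_comm]

/-- The conditional probabilities `a i w = P(c = i | w)` of the cells of the first coordinate given
the second. -/
lemma exists_cell_density (π : Measure (S₁ × S₂)) [IsProbabilityMeasure π] {c : S₁ → ι}
    (hc : Measurable c) :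
    ∃ a : S₂ → ι → ℝ≥0∞, (∀ i, Measurable fun w => a w i) ∧
      (∀ᵐ w ∂π.snd, ∑' i, a w i = 1) ∧
      ∀ ψ : ι → S₂ → ℝ≥0∞, (∀ i, Measurable (ψ i)) →
        ∫⁻ z, ψ (c z.1) z.2 ∂π = ∫⁻ w, ∑' i, a w i * ψ i w ∂π.snd := by
  have hcm : ∀ i, MeasurableSet ((fun z : S₁ × S₂ => c z.1) ⁻¹' {i}) := fun i =>
    (hc.comp measurable_fst) (measurableSet_singleton i)
  set ν : ι → Measure S₂ := fun i => (π.restrict ((fun z : S₁ × S₂ => c z.1) ⁻¹' {i})).snd with hν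
  have hle : ∀ i, ν i ≤ π.snd := fun i => Measure.map_mono Measure.restrict_le_self measurable_snd
  have hνd : ∀ i, π.snd.withDensity ((ν i).rnDeriv π.snd) = ν i := fun i =>
    Measure.withDensity_rnDeriv_eq _ _ (hle i).absolutelyContinuous
  have hdis : ∀ ψ : ι → S₂ → ℝ≥0∞, (∀ i, Measurable (ψ i)) →
      ∫⁻ z, ψ (c z.1) z.2 ∂π = ∫⁻ w, ∑' i, (ν i).rnDeriv π.snd w * ψ i w ∂π.snd := by
    intro ψ hψ
    have hmul : ∀ i, Measurable fun w => (ν i).rnDeriv π.snd w * ψ i w := fun i =>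
      (Measure.measurable_rnDeriv _ _).mul (hψ i)
    rw [lintegral_tsum fun i => (hmul i).aemeasurable]
    have hdisj : Pairwise (Function.onFun Disjoint
        fun i => (fun z : S₁ × S₂ => c z.1) ⁻¹' {i}) := by
      intro i j hij
      refine Set.disjoint_left.2 fun x hx hx' => hij ?_
      rw [← show c x.1 = i from hx, ← show c x.1 = j from hx']
    have hun : ⋃ i, (fun z : S₁ × S₂ => c z.1) ⁻¹' {i} = Set.univ := by ext; simp
    rw [← setLIntegral_univ, ← hun, lintegral_iUnion hcm hdisj]
    refine tsum_congr fun i => ?_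
    have h0 := lintegral_withDensity_eq_lintegral_mul π.snd
      (Measure.measurable_rnDeriv (ν i) π.snd) (hψ i)
    simp only [Pi.mul_apply] at h0
    rw [← h0, hνd i]
    simp only [hν]
    rw [Measure.snd, lintegral_map (hψ i) measurable_snd]
    refine setLIntegral_congr_fun (hcm i) fun z hz => ?_
    simp only [Set.mem_preimage, Set.mem_singleton_iff] at hz
    simp [hz]
  refine ⟨fun w i => (ν i).rnDeriv π.snd w, fun i => Measure.measurable_rnDeriv _ _, ?_, hdis⟩
  refine ae_eq_of_forall_setLIntegral_eq_of_sigmaFinite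
    (Measurable.tsum fun i => Measure.measurable_rnDeriv _ _) measurable_const
    fun s hs _ => ?_
  have h1 := hdis (fun _ => s.indicator 1) fun i => measurable_one.indicator hs
  have h2 : ∫⁻ z : S₁ × S₂, s.indicator 1 z.2 ∂π = π.snd s := by
    rw [← lintegral_indicator_one hs, Measure.snd,
      lintegral_map (measurable_one.indicator hs) measurable_snd]
  simp only [ENNReal.tsum_mul_right] at h1
  rw [h2] at h1
  rw [setLIntegral_const, one_mul, h1, ← lintegral_indicator hs]
  refine lintegral_congr fun w => ?_
  by_cases h : w ∈ s <;> simp [h]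

variable [DecidableEq ι]

/-- If the cell `c x` and `w` are `p`-close to independence under the joint law `π` of `(x, w)`,
then `x` can be replaced by an `x'` that is independent of `w`, has the same law, and lies in the
same cell as `x` outside an event of probability `p`. -/
theorem exists_cell_coupling (π : Measure (S₁ × S₂)) [IsProbabilityMeasure π] {c : S₁ → ι}
    (hc : Measurable c) {p : ℝ≥0∞}
    (hp : ∀ S : Set (ι × S₂), MeasurableSet S →
      ((π.fst.map c).prod π.snd) S ≤ π.map (fun z => (c z.1, z.2)) S + p) :
    ∃ ρ : Measure (S₁ × S₁ × S₂), ρ.map (fun t => (t.1, t.2.2)) = π ∧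
      ρ.map (fun t => (t.2.1, t.2.2)) = π.fst.prod π.snd ∧
      ρ {t | c t.1 ≠ c t.2.1} ≤ p := by
  obtain ⟨a, ham, ha1, hdis⟩ := exists_cell_density π hc
  set P := π.fst
  set Q := π.snd
  set b : ι → ℝ≥0∞ := fun i => P (c ⁻¹' {i}) with hb
  have hb1 : ∑' i, b i = 1 := by
    have := lintegral_comp_countable (P := P) hc (fun _ => 1)
    simpa using this.symm
  have hmin : ∀ i, Measurable fun w => min (a w i) (b i) := fun i => (ham i).min measurable_const
  have hexm : Measurable fun w => excess (a w) b :=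
    Measurable.tsum fun j => measurable_const.sub (hmin j)
  have hdm : ∀ i i', Measurable fun w => coupDens (a w) b i i' := by
    intro i i'
    unfold coupDens
    refine Measurable.add ?_ ?_
    · by_cases h : i = i'
      · simp only [h, if_true]
        exact (hmin i').div ((ham i').mul measurable_const)
      · simp only [h, if_false]; exact measurable_const
    · exact (((measurable_const.sub ((hmin i).div (ham i)))).mul
        (measurable_const.sub ((hmin i').div measurable_const))).div hexm
  -- the base measure is the law of `((x, w), x')` with `x'` independent of `(x, w)`
  set G : (S₁ × S₂) × S₁ → ℝ≥0∞ := fun t => coupDens (a t.1.2) b (c t.1.1) (c t.2) with hG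
  have hGm : Measurable G := by
    have h1 : Measurable fun q : (ι × ι) × S₂ => coupDens (a q.2) b q.1.1 q.1.2 :=
      measurable_from_prod_countable_right fun i => hdm i.1 i.2
    exact h1.comp ((((hc.comp measurable_fst.fst).prodMk (hc.comp measurable_snd))).prodMk
      measurable_fst.snd)
  set e : (S₁ × S₂) × S₁ → S₁ × S₁ × S₂ := fun t => (t.1.1, t.2, t.1.2) with he
  have hem : Measurable e :=
    measurable_fst.fst.prodMk (measurable_snd.prodMk measurable_fst.snd)
  have hpos : ∀ᵐ z ∂π, a z.2 (c z.1) ≠ 0 := by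
    have hm1 : ∀ i, Measurable ((fun i w => if a w i = 0 then (1 : ℝ≥0∞) else 0) i) := fun i =>
      Measurable.ite (ham i (measurableSet_singleton 0)) measurable_const measurable_const
    have h1 := hdis (fun i w => if a w i = 0 then 1 else 0) hm1
    have h2 : ∀ w i, a w i * (if a w i = 0 then (1 : ℝ≥0∞) else 0) = 0 := fun w i => by
      by_cases h : a w i = 0 <;> simp [h]
    simp only [h2, tsum_zero, lintegral_zero] at h1
    have hm2 : Measurable fun z : S₁ × S₂ => if a z.2 (c z.1) = 0 then (1 : ℝ≥0∞) else 0 := by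
      have h3 : Measurable fun q : ι × S₂ => if a q.2 q.1 = 0 then (1 : ℝ≥0∞) else 0 :=
        measurable_from_prod_countable_right fun i => hm1 i
      exact h3.comp ((hc.comp measurable_fst).prodMk measurable_snd)
    rw [lintegral_eq_zero_iff hm2] at h1
    filter_upwards [h1] with z hz h0
    simp [h0] at hz
  have ha1' : ∀ᵐ z ∂π, ∑' i, a z.2 i = 1 :=
    ae_of_ae_map measurable_snd.aemeasurable ha1
  have hbpos : ∀ᵐ x ∂P, b (c x) ≠ 0 := by
    have h1 := lintegral_comp_countable (P := P) hc (fun i => if b i = 0 then 1 else 0)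
    have h2 : ∀ i, P (c ⁻¹' {i}) * (if b i = 0 then (1 : ℝ≥0∞) else 0) = 0 := fun i => by
      by_cases h : b i = 0
      · simp only [hb] at h; simp [h]
      · simp [h]
    simp only [h2, tsum_zero] at h1
    have h3 : Measurable fun x => if b (c x) = 0 then (1 : ℝ≥0∞) else 0 :=
      (measurable_of_countable fun i => if b i = 0 then (1 : ℝ≥0∞) else 0).comp hc
    rw [lintegral_eq_zero_iff h3] at h1
    filter_upwards [h1] with z hz h0
    simp [h0] at hz
  refine ⟨((π.prod P).withDensity G).map e, ?_, ?_, ?_⟩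
  · have hm : Measurable fun t : S₁ × S₁ × S₂ => (t.1, t.2.2) := by fun_prop
    rw [Measure.map_map hm hem]
    ext A hA
    have hA' : MeasurableSet (((fun t : S₁ × S₁ × S₂ => (t.1, t.2.2)) ∘ e) ⁻¹' A) :=
      (hm.comp hem) hA
    rw [Measure.map_apply (hm.comp hem) hA, withDensity_apply _ hA', ← lintegral_indicator hA',
      lintegral_prod _ (hGm.indicator hA').aemeasurable]
    have h1 : ∀ᵐ z ∂π, ∫⁻ x', (((fun t : S₁ × S₁ × S₂ => (t.1, t.2.2)) ∘ e) ⁻¹' A).indicator G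
        (z, x') ∂P = A.indicator 1 z := by
      filter_upwards [hpos, ha1'] with z hz1 hz2
      by_cases hzA : z ∈ A
      · have : ∀ x', (((fun t : S₁ × S₁ × S₂ => (t.1, t.2.2)) ∘ e) ⁻¹' A).indicator G (z, x')
            = coupDens (a z.2) b (c z.1) (c x') := fun x' => by
          rw [Set.indicator_of_mem]; simpa [he] using hzA
        simp only [this]
        rw [lintegral_comp_countable hc, tsum_mul_coupDens hz2 hb1 hz1]
        simp [hzA]
      · have : ∀ x', (((fun t : S₁ × S₁ × S₂ => (t.1, t.2.2)) ∘ e) ⁻¹' A).indicator G (z, x')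
            = 0 := fun x' => by
          rw [Set.indicator_of_notMem]; simpa [he] using hzA
        simp [this, hzA]
    rw [lintegral_congr_ae h1, lintegral_indicator_one hA]
  · have hm : Measurable fun t : S₁ × S₁ × S₂ => (t.2.1, t.2.2) := by fun_prop
    rw [Measure.map_map hm hem]
    ext A hA
    have hA' : MeasurableSet (((fun t : S₁ × S₁ × S₂ => (t.2.1, t.2.2)) ∘ e) ⁻¹' A) :=
      (hm.comp hem) hA
    rw [Measure.map_apply (hm.comp hem) hA, withDensity_apply _ hA', ← lintegral_indicator hA',
      lintegral_prod_symm _ (hGm.indicator hA').aemeasurable, ← lintegral_indicator_one hA,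
      lintegral_prod _ (measurable_one.indicator hA).aemeasurable]
    refine lintegral_congr_ae ?_
    filter_upwards [hbpos] with x' hx'
    have hsec : MeasurableSet (Prod.mk x' ⁻¹' A) := measurable_prodMk_left hA
    have h1 : ∀ z : S₁ × S₂, (((fun t : S₁ × S₁ × S₂ => (t.2.1, t.2.2)) ∘ e) ⁻¹' A).indicator G
        (z, x') = (fun i w => (Prod.mk x' ⁻¹' A).indicator
          (fun w => coupDens (a w) b i (c x')) w) (c z.1) z.2 := by
      intro z
      by_cases h : (x', z.2) ∈ A
      · rw [Set.indicator_of_mem (by simpa [he] using h)]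
        simp [h, hG]
      · rw [Set.indicator_of_notMem (by simpa [he] using h)]
        simp [h]
    simp only [h1]
    rw [hdis (fun i w => (Prod.mk x' ⁻¹' A).indicator (fun w => coupDens (a w) b i (c x')) w)
      fun i => (hdm i _).indicator hsec]
    refine lintegral_congr_ae ?_
    filter_upwards [ha1] with w hw
    by_cases h : (x', w) ∈ A
    · simp only [Set.indicator_of_mem h, Pi.one_apply,
        Set.indicator_of_mem (show w ∈ Prod.mk x' ⁻¹' A from h)]
      exact tsum_mul_coupDens' hw hb1 hx'
    · simp [h]
  · have hset : MeasurableSet {t : S₁ × S₁ × S₂ | c t.1 ≠ c t.2.1} :=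
      (measurableSet_eq_fun (hc.comp measurable_fst) (hc.comp measurable_snd.fst)).compl
    have hset' : MeasurableSet {t : (S₁ × S₂) × S₁ | c t.1.1 ≠ c t.2} :=
      (measurableSet_eq_fun (hc.comp measurable_fst.fst) (hc.comp measurable_snd)).compl
    rw [Measure.map_apply hem hset]
    change ((π.prod P).withDensity G) {t | c t.1.1 ≠ c t.2} ≤ p
    rw [withDensity_apply _ hset', ← lintegral_indicator hset',
      lintegral_prod _ (hGm.indicator hset').aemeasurable]
    have h1 : ∀ z : S₁ × S₂, ∫⁻ x', ({t | c t.1.1 ≠ c t.2} : Set ((S₁ × S₂) × S₁)).indicator G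
        (z, x') ∂P = (fun i w => ∑' i', b i' * if i = i' then 0 else coupDens (a w) b i i')
          (c z.1) z.2 := by
      intro z
      simp only
      rw [← lintegral_comp_countable (P := P) hc
        (fun i' => if c z.1 = i' then 0 else coupDens (a z.2) b (c z.1) i')]
      refine lintegral_congr fun x' => ?_
      by_cases h : c z.1 = c x' <;> simp [h, hG]
    simp only [h1]
    rw [hdis (fun i w => ∑' i', b i' * if i = i' then 0 else coupDens (a w) b i i')
      fun i => Measurable.tsum fun i' => measurable_const.mul (by
        by_cases h : i = i'
        · simp only [h, if_true]; exact measurable_const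
        · simp only [h, if_false]; exact hdm i i')]
    have h2 : ∫⁻ w, ∑' i, a w i * ∑' i', b i' * (if i = i' then 0 else coupDens (a w) b i i') ∂Q
        ≤ ∫⁻ w, excess (a w) b ∂Q := by
      refine lintegral_mono_ae ?_
      filter_upwards [ha1] with w hw
      exact tsum_tsum_coupDens_le hw hb1
    refine h2.trans ?_
    -- the expected excess is the gap between the two laws on the set `{(i, w) | a w i < b i}`
    set S : Set (ι × S₂) := {q | a q.2 q.1 < b q.1} with hS
    have hSm : MeasurableSet S := by
      have h3 : Measurable fun q : ι × S₂ => a q.2 q.1 :=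
        measurable_from_prod_countable_right fun i => ham i
      exact measurableSet_lt h3 ((measurable_of_countable b).comp measurable_fst)
    have hite : ∀ i, Measurable fun w => if a w i < b i then (1 : ℝ≥0∞) else 0 := fun i =>
      Measurable.ite (measurableSet_lt (ham i) measurable_const) measurable_const measurable_const
    have h4 : ((P.map c).prod Q) S = ∫⁻ w, ∑' i, b i * (if a w i < b i then 1 else 0) ∂Q := by
      rw [Measure.prod_apply_symm hSm]
      refine lintegral_congr fun w => ?_
      rw [← lintegral_comp_countable (P := P) hc (fun i => if a w i < b i then 1 else 0),
        Measure.map_apply hc (measurable_prodMk_right hSm),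
        ← lintegral_indicator_one (hc (measurable_prodMk_right hSm))]
      refine lintegral_congr fun x => ?_
      by_cases h : a w (c x) < b (c x) <;> simp [Set.indicator, h, hS]
    have h5 : π.map (fun z => (c z.1, z.2)) S
        = ∫⁻ w, ∑' i, a w i * (if a w i < b i then 1 else 0) ∂Q := by
      have hcm : Measurable fun z : S₁ × S₂ => (c z.1, z.2) :=
        (hc.comp measurable_fst).prodMk measurable_snd
      rw [← hdis (fun i w => if a w i < b i then 1 else 0) hite, Measure.map_apply hcm hSm,
        ← lintegral_indicator_one (hcm hSm)]
      refine lintegral_congr fun z => ?_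
      by_cases h : a z.2 (c z.1) < b (c z.1) <;> simp [Set.indicator, h, hS]
    have h6 : ((P.map c).prod Q) S = π.map (fun z => (c z.1, z.2)) S
        + ∫⁻ w, excess (a w) b ∂Q := by
      rw [h4, h5, ← lintegral_add_right _ hexm]
      refine lintegral_congr fun w => ?_
      rw [excess, ← ENNReal.tsum_add]
      refine tsum_congr fun i => ?_
      by_cases h : a w i < b i
      · simp only [h, if_true, mul_one, min_eq_left h.le]
        rw [add_tsub_cancel_of_le h.le]
      · simp [h, min_eq_right (not_lt.1 h)]
    have h7 := hp S hSm
    rw [h6] at h7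
    have : IsProbabilityMeasure (π.map (fun z : S₁ × S₂ => (c z.1, z.2))) :=
      Measure.isProbabilityMeasure_map
        ((hc.comp measurable_fst).prodMk measurable_snd).aemeasurable
    exact (ENNReal.add_le_add_iff_left (measure_ne_top _ _)).1 h7

end Coupling

/-! ### Degenerate kernels at nearly independent arguments -/

/-- `h` is a symmetric degenerate kernel for the law `F`, with `(2 + δ)`-th moment at most `M` at a
pair of independent arguments. -/
structure DegKernel (F : Measure ℝ) (h : ℝ → ℝ → ℝ) (δ M : ℝ) : Prop where
  meas : Measurable (Function.uncurry h)
  symm : ∀ x y, h x y = h y x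
  deg : ∀ x, ∫ y, h x y ∂F = 0
  δ_pos : 0 < δ
  M_nonneg : 0 ≤ M
  mom : ∫⁻ p : ℝ × ℝ, ENNReal.ofReal (|h p.1 p.2| ^ (2 + δ)) ∂(F.prod F) ≤ ENNReal.ofReal M

/-- `U` and `V` have law `F`, and `h U V` has `(2 + δ)`-th moment at most `M`. -/
structure MomPair {Ω : Type*} [MeasurableSpace Ω] (μ : Measure Ω) (F : Measure ℝ)
    (h : ℝ → ℝ → ℝ) (δ M : ℝ) (U V : Ω → ℝ) : Prop where
  measU : Measurable U
  measV : Measurable V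
  lawU : μ.map U = F
  lawV : μ.map V = F
  mom : ∫⁻ ω, ENNReal.ofReal (|h (U ω) (V ω)| ^ (2 + δ)) ∂μ ≤ ENNReal.ofReal M

/-- A Lipschitz property in mean: moving the first argument by at most `ε`, from a pair with law
`π` to a pair of independent variables, changes `h` by at most `L ε` in `L¹`. It is implied both by
`P`-Lipschitz-continuity and by the variation condition. -/
def LipOn (h : ℝ → ℝ → ℝ) (F : Measure ℝ) (π : Measure (ℝ × ℝ)) (L : ℝ) : Prop :=
  ∀ ε : ℝ, 0 < ε → ∀ ρ : Measure (ℝ × ℝ × ℝ), IsProbabilityMeasure ρ →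
    ρ.map (fun t => (t.1, t.2.2)) = π → ρ.map (fun t => (t.2.1, t.2.2)) = F.prod F →
    ∫⁻ t, Set.indicator {t : ℝ × ℝ × ℝ | |t.1 - t.2.1| ≤ ε}
      (fun t => ENNReal.ofReal |h t.1 t.2.2 - h t.2.1 t.2.2|) t ∂ρ ≤ ENNReal.ofReal (L * ε)

/-- Truncation at level `K`. -/
noncomputable def clamp (K x : ℝ) : ℝ := max (-K) (min K x)

lemma measurable_clamp (K : ℝ) : Measurable (clamp K) := by unfold clamp; fun_prop

lemma abs_clamp_le {K : ℝ} (hK : 0 ≤ K) (x : ℝ) : |clamp K x| ≤ K := by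
  unfold clamp
  rw [abs_le]
  exact ⟨le_max_left _ _, max_le (by linarith) (min_le_left _ _)⟩

lemma abs_clamp_sub_clamp_le (K x y : ℝ) : |clamp K x - clamp K y| ≤ |x - y| := by
  unfold clamp
  calc |max (-K) (min K x) - max (-K) (min K y)| ≤ |min K x - min K y| := by
        rw [max_comm, max_comm (-K)]; exact abs_max_sub_max_le_abs _ _ _
    _ ≤ |x - y| := by
        rw [min_comm, min_comm K]
        have := abs_min_sub_min_le_max x K y K
        simpa using this

lemma clamp_of_abs_le {K x : ℝ} (h : |x| ≤ K) : clamp K x = x := by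
  unfold clamp
  rw [min_eq_right (abs_le.1 h).2, max_eq_right (abs_le.1 h).1]

lemma abs_sub_clamp_le {K δ : ℝ} (hK : 0 < K) (hδ : 0 < δ) (x : ℝ) :
    |x - clamp K x| ≤ K ^ (-(1 + δ)) * |x| ^ (2 + δ) := by
  have h1 := le_add_rpow hK (abs_nonneg x) hδ
  have h0 : 0 ≤ K ^ (-(1 + δ)) * |x| ^ (2 + δ) := by positivity
  rcases le_or_gt |x| K with h | h
  · rw [clamp_of_abs_le h]; simpa using h0
  · have h2 : |x - clamp K x| = |x| - K := by
      unfold clamp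
      rcases le_or_gt 0 x with hx | hx
      · rw [abs_of_nonneg hx] at h
        rw [min_eq_left h.le, max_eq_right (by linarith), abs_of_nonneg (by linarith),
          abs_of_nonneg hx]
      · rw [abs_of_neg hx] at h
        rw [min_eq_right (by linarith), max_eq_left (by linarith), abs_of_neg hx,
          abs_of_neg (by linarith)]
        ring
    linarith

section Moments

variable {S : Type*} [MeasurableSpace S] {κ : Measure S} {f : S → ℝ} {δ M : ℝ}

lemma integrable_of_mom [IsProbabilityMeasure κ] (hf : Measurable f) (hδ : 0 < δ)
    (hM : ∫⁻ x, ENNReal.ofReal (|f x| ^ (2 + δ)) ∂κ ≤ ENNReal.ofReal M) : Integrable f κ := by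
  refine ⟨hf.aestronglyMeasurable, ?_⟩
  rw [hasFiniteIntegral_iff_norm]
  calc ∫⁻ x, ENNReal.ofReal ‖f x‖ ∂κ ≤ ∫⁻ x, (1 + ENNReal.ofReal (|f x| ^ (2 + δ))) ∂κ := by
        refine lintegral_mono fun x => ?_
        have := le_add_rpow one_pos (abs_nonneg (f x)) hδ
        simp only [Real.one_rpow, one_mul] at this
        rw [Real.norm_eq_abs, ← ENNReal.ofReal_one, ← ENNReal.ofReal_add zero_le_one (by positivity)]
        exact ENNReal.ofReal_le_ofReal this
    _ = 1 + ∫⁻ x, ENNReal.ofReal (|f x| ^ (2 + δ)) ∂κ := by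
        rw [lintegral_add_left measurable_const]; simp
    _ < ∞ := by
        refine ENNReal.add_lt_top.2 ⟨ENNReal.one_lt_top, hM.trans_lt ENNReal.ofReal_lt_top⟩

lemma integrable_rpow_of_mom (hf : Measurable f)
    (hM : ∫⁻ x, ENNReal.ofReal (|f x| ^ (2 + δ)) ∂κ ≤ ENNReal.ofReal M) :
    Integrable (fun x => |f x| ^ (2 + δ)) κ := by
  refine ⟨(by fun_prop : Measurable fun x => |f x| ^ (2 + δ)).aestronglyMeasurable, ?_⟩
  rw [hasFiniteIntegral_iff_norm]
  refine lt_of_le_of_lt (le_of_eq ?_) (hM.trans_lt ENNReal.ofReal_lt_top)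
  refine lintegral_congr fun x => ?_
  rw [Real.norm_of_nonneg (by positivity)]

lemma integral_rpow_le_of_mom (hf : Measurable f) (hM0 : 0 ≤ M)
    (hM : ∫⁻ x, ENNReal.ofReal (|f x| ^ (2 + δ)) ∂κ ≤ ENNReal.ofReal M) :
    ∫ x, |f x| ^ (2 + δ) ∂κ ≤ M := by
  rw [integral_eq_lintegral_of_nonneg_ae (Eventually.of_forall fun x => by positivity)
    (by fun_prop : Measurable fun x => |f x| ^ (2 + δ)).aestronglyMeasurable]
  exact ENNReal.toReal_le_of_le_ofReal hM0 hM

lemma setLIntegral_abs_le_of_mom (hf : Measurable f) (hδ : 0 < δ)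
    (hM : ∫⁻ x, ENNReal.ofReal (|f x| ^ (2 + δ)) ∂κ ≤ ENNReal.ofReal M) {K : ℝ} (hK : 0 < K)
    (E : Set S) :
    ∫⁻ x in E, ENNReal.ofReal |f x| ∂κ
      ≤ ENNReal.ofReal K * κ E + ENNReal.ofReal (K ^ (-(1 + δ)) * M) := by
  calc ∫⁻ x in E, ENNReal.ofReal |f x| ∂κ
      ≤ ∫⁻ x in E, (ENNReal.ofReal K
          + ENNReal.ofReal (K ^ (-(1 + δ))) * ENNReal.ofReal (|f x| ^ (2 + δ))) ∂κ := by
        refine lintegral_mono fun x => ?_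
        rw [← ENNReal.ofReal_mul (by positivity), ← ENNReal.ofReal_add hK.le (by positivity)]
        exact ENNReal.ofReal_le_ofReal (le_add_rpow hK (abs_nonneg _) hδ)
    _ = ENNReal.ofReal K * κ E
        + ENNReal.ofReal (K ^ (-(1 + δ))) * ∫⁻ x in E, ENNReal.ofReal (|f x| ^ (2 + δ)) ∂κ := by
        rw [lintegral_add_left measurable_const, lintegral_const_mul _ (by fun_prop)]
        simp
    _ ≤ _ := by
        rw [ENNReal.ofReal_mul (by positivity)]
        gcongr
        exact (setLIntegral_le_lintegral _ _).trans hM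

end Moments

section EventBounds

variable {Ω : Type*} [MeasurableSpace Ω] {μ : Measure Ω} [IsProbabilityMeasure μ]
  {F : Measure ℝ} {h : ℝ → ℝ → ℝ} {δ M : ℝ} {U V : Ω → ℝ}

/-- The kernel restricted to an event that is the intersection of an event seen with the first
argument and an event seen with the second one. -/
noncomputable def flagKernel (h : ℝ → ℝ → ℝ) (z : (ℝ × Bool) × (ℝ × Bool)) : ℝ :=
  if z.1.2 = true ∧ z.2.2 = true then h z.1.1 z.2.1 else 0

lemma measurable_flagKernel (hh : Measurable (Function.uncurry h)) :
    Measurable (flagKernel h) := by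
  have h1 : Measurable fun z : (ℝ × Bool) × (ℝ × Bool) => h z.1.1 z.2.1 :=
    hh.comp (measurable_fst.fst.prodMk measurable_snd.fst)
  refine Measurable.ite ?_ h1 measurable_const
  exact (measurable_fst.snd (measurableSet_singleton true)).inter
    (measurable_snd.snd (measurableSet_singleton true))

lemma abs_flagKernel_le (z : (ℝ × Bool) × (ℝ × Bool)) : |flagKernel h z| ≤ |h z.1.1 z.2.1| := by
  unfold flagKernel
  split_ifs <;> simp

lemma DegKernel.comp_prod (hh : DegKernel F h δ M) (hU : Measurable U) (hV : Measurable V)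
    (hUF : μ.map U = F) (hVF : μ.map V = F) :
    ∫⁻ q : Ω × Ω, ENNReal.ofReal (|h (U q.1) (V q.2)| ^ (2 + δ)) ∂(μ.prod μ)
      ≤ ENNReal.ofReal M := by
  refine le_trans (le_of_eq ?_) hh.mom
  have hm : Measurable fun p : ℝ × ℝ => ENNReal.ofReal (|h p.1 p.2| ^ (2 + δ)) := by
    have := hh.meas
    have h2 : Measurable fun p : ℝ × ℝ => h p.1 p.2 := hh.meas
    fun_prop
  have hp : F.prod F = (μ.prod μ).map (Prod.map U V) := by
    rw [← Measure.map_prod_map _ _ hU hV, hUF, hVF]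
  rw [hp, lintegral_map hm (hU.prodMap hV)]
  rfl

/-- Under independence, a degenerate kernel has mean zero even on an event seen with one of its
arguments only. -/
lemma DegKernel.integral_flagKernel (hh : DegKernel F h δ M) (hU : Measurable U)
    (hV : Measurable V) (hUF : μ.map U = F) (hVF : μ.map V = F) {A B : Ω → Bool}
    (hA : Measurable A) (hB : Measurable B) (hAB : (∀ ω, A ω = true) ∨ ∀ ω, B ω = true) :
    ∫ z, flagKernel h z ∂((μ.map fun ω => (U ω, A ω)).prod (μ.map fun ω => (V ω, B ω))) = 0 := by
  have hUA : Measurable fun ω => (U ω, A ω) := hU.prodMk hA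
  have hVB : Measurable fun ω => (V ω, B ω) := hV.prodMk hB
  have hfm := measurable_flagKernel hh.meas
  rw [Measure.map_prod_map _ _ hUA hVB, integral_map (hUA.prodMap hVB).aemeasurable
    hfm.aestronglyMeasurable]
  have hm2 : Measurable fun q : Ω × Ω => h (U q.1) (V q.2) :=
    hh.meas.comp ((hU.comp measurable_fst).prodMk (hV.comp measurable_snd))
  have hi0 : Integrable (fun q : Ω × Ω => h (U q.1) (V q.2)) (μ.prod μ) :=
    integrable_of_mom hm2 hh.δ_pos (hh.comp_prod hU hV hUF hVF)
  have hi : Integrable (fun q : Ω × Ω =>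
      flagKernel h (Prod.map (fun ω => (U ω, A ω)) (fun ω => (V ω, B ω)) q)) (μ.prod μ) := by
    refine hi0.mono (hfm.comp (hUA.prodMap hVB)).aestronglyMeasurable
      (Eventually.of_forall fun q => ?_)
    exact abs_flagKernel_le _
  have hz : ∀ x, ∫ ω, h x (V ω) ∂μ = 0 := by
    intro x
    rw [← hh.deg x, ← hVF, integral_map hV.aemeasurable]
    exact (hh.meas.comp (measurable_prodMk_left (x := x))).aestronglyMeasurable
  have hz' : ∀ x, ∫ ω, h (U ω) x ∂μ = 0 := by
    intro x
    simp only [hh.symm _ x]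
    rw [← hh.deg x, ← hUF, integral_map hU.aemeasurable]
    exact (hh.meas.comp (measurable_prodMk_left (x := x))).aestronglyMeasurable
  rcases hAB with h1 | h1
  · rw [integral_prod_symm _ hi]
    refine integral_eq_zero_of_ae (Eventually.of_forall fun ω' => ?_)
    by_cases hb : B ω' = true
    · simpa [flagKernel, h1, hb] using hz' (V ω')
    · simp [flagKernel, hb]
  · rw [integral_prod _ hi]
    refine integral_eq_zero_of_ae (Eventually.of_forall fun ω' => ?_)
    by_cases hb : A ω' = true
    · simpa [flagKernel, h1, hb] using hz (U ω')
    · simp [flagKernel, hb]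

lemma setIntegral_eq_integral_flagKernel {μ : Measure Ω} (hh : Measurable (Function.uncurry h))
    (hU : Measurable U) (hV : Measurable V) {A B : Ω → Bool}
    (hA : Measurable A) (hB : Measurable B) :
    ∫ ω in {ω | A ω = true ∧ B ω = true}, h (U ω) (V ω) ∂μ
      = ∫ z, flagKernel h z ∂(μ.map fun ω => ((U ω, A ω), (V ω, B ω))) := by
  have hm : MeasurableSet {ω | A ω = true ∧ B ω = true} :=
    (hA (measurableSet_singleton true)).inter (hB (measurableSet_singleton true))
  rw [integral_map ((hU.prodMk hA).prodMk (hV.prodMk hB)).aemeasurable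
    (measurable_flagKernel hh).aestronglyMeasurable, ← integral_indicator hm]
  refine integral_congr_ae (Eventually.of_forall fun ω => ?_)
  simp only [Set.indicator, flagKernel, Set.mem_ofPred_eq]

/-- Closeness to independence in total variation makes the mean of a degenerate kernel small. -/
lemma MomPair.abs_setIntegral_le (hp : MomPair μ F h δ M U V) (hh : DegKernel F h δ M)
    {A B : Ω → Bool} (hA : Measurable A) (hB : Measurable B)
    (hAB : (∀ ω, A ω = true) ∨ ∀ ω, B ω = true) {p K : ℝ} (hp0 : 0 ≤ p) (hK : 0 < K)
    (hdep : DepLE μ (fun ω => (U ω, A ω)) (fun ω => (V ω, B ω)) (ENNReal.ofReal p)) :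
    |∫ ω in {ω | A ω = true ∧ B ω = true}, h (U ω) (V ω) ∂μ|
      ≤ 2 * (K * p) + 2 * (K ^ (-(1 + δ)) * M) := by
  have hUA : Measurable fun ω => (U ω, A ω) := hp.measU.prodMk hA
  have hVB : Measurable fun ω => (V ω, B ω) := hp.measV.prodMk hB
  have hfm := measurable_flagKernel hh.meas
  have := Measure.isProbabilityMeasure_map (μ := μ) hUA.aemeasurable
  have := Measure.isProbabilityMeasure_map (μ := μ) hVB.aemeasurable
  have := Measure.isProbabilityMeasure_map (μ := μ) (hUA.prodMk hVB).aemeasurable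
  have hz := hh.integral_flagKernel hp.measU hp.measV hp.lawU hp.lawV hA hB hAB
  rw [setIntegral_eq_integral_flagKernel hh.meas hp.measU hp.measV hA hB]
  set π := μ.map fun ω => ((U ω, A ω), (V ω, B ω))
  set ν := (μ.map fun ω => (U ω, A ω)).prod (μ.map fun ω => (V ω, B ω))
  have hmomπ : ∫⁻ z, ENNReal.ofReal (|flagKernel h z| ^ (2 + δ)) ∂π ≤ ENNReal.ofReal M := by
    refine le_trans ?_ hp.mom
    rw [lintegral_map (by fun_prop) (hUA.prodMk hVB)]
    refine lintegral_mono fun ω => ENNReal.ofReal_le_ofReal ?_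
    have := abs_flagKernel_le (h := h) ((U ω, A ω), (V ω, B ω))
    have hδ := hh.δ_pos
    gcongr
  have hmomν : ∫⁻ z, ENNReal.ofReal (|flagKernel h z| ^ (2 + δ)) ∂ν ≤ ENNReal.ofReal M := by
    refine le_trans ?_ (hh.comp_prod hp.measU hp.measV hp.lawU hp.lawV)
    simp only [ν]
    rw [Measure.map_prod_map _ _ hUA hVB, lintegral_map (by fun_prop) (hUA.prodMap hVB)]
    refine lintegral_mono fun q => ENNReal.ofReal_le_ofReal ?_
    have := abs_flagKernel_le (h := h) ((U q.1, A q.1), (V q.2, B q.2))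
    have hδ := hh.δ_pos
    simp only [Prod.map]
    gcongr
  have htail : ∀ κ : Measure ((ℝ × Bool) × (ℝ × Bool)), IsProbabilityMeasure κ →
      ∫⁻ z, ENNReal.ofReal (|flagKernel h z| ^ (2 + δ)) ∂κ ≤ ENNReal.ofReal M →
      |∫ z, flagKernel h z ∂κ - ∫ z, clamp K (flagKernel h z) ∂κ| ≤ K ^ (-(1 + δ)) * M := by
    intro κ _ hκ
    have hcm : Measurable fun z => clamp K (flagKernel h z) := (measurable_clamp K).comp hfm
    have hci : Integrable (fun z => clamp K (flagKernel h z)) κ :=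
      Integrable.of_bound hcm.aestronglyMeasurable K
        (Eventually.of_forall fun z => abs_clamp_le hK.le _)
    have hfi := integrable_of_mom hfm hh.δ_pos hκ
    rw [← integral_sub hfi hci]
    calc |∫ z, (flagKernel h z - clamp K (flagKernel h z)) ∂κ|
        ≤ ∫ z, |flagKernel h z - clamp K (flagKernel h z)| ∂κ := abs_integral_le_integral_abs
      _ ≤ ∫ z, K ^ (-(1 + δ)) * |flagKernel h z| ^ (2 + δ) ∂κ :=
          integral_mono (hfi.sub hci).abs ((integrable_rpow_of_mom hfm hκ).const_mul _)
            fun z => abs_sub_clamp_le hK hh.δ_pos _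
      _ ≤ _ := by
          rw [integral_const_mul]
          have := integral_rpow_le_of_mom hfm hh.M_nonneg hκ
          gcongr
  have h1 := htail π inferInstance hmomπ
  have h2 := htail ν inferInstance hmomν
  have h3 := abs_integral_sub_le_of_measure_le (π := π) (ν := ν) ENNReal.ofReal_ne_top hdep
    ((measurable_clamp K).comp hfm) (fun z => abs_clamp_le hK.le _)
  rw [ENNReal.toReal_ofReal hp0] at h3
  simp only [Function.comp_apply] at h3
  rw [hz] at h2
  rw [abs_le] at h1 h2 h3 ⊢
  constructor <;> linarith

/-- The same for a kernel that is Lipschitz in mean, if only the cell of the first argument, in a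
partition into sets of diameter at most `ε`, is close to independence: the first argument is
replaced by an independent one in the same cell. -/
lemma MomPair.abs_setIntegral_le_of_cells (hp : MomPair μ F h δ M U V) (hh : DegKernel F h δ M)
    {A B : Ω → Bool} (hA : Measurable A) (hB : Measurable B)
    (hAB : (∀ ω, A ω = true) ∨ ∀ ω, B ω = true) {p K L ε : ℝ} (hp0 : 0 ≤ p) (hK : 0 < K)
    (hε : 0 < ε) (hL0 : 0 ≤ L) (hL : LipOn h F (μ.map fun ω => (U ω, V ω)) L)
    {c : ℝ → ℤ} (hc : Measurable c) (hcε : ∀ x y, c x = c y → |x - y| ≤ ε)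
    (hdep : DepLE μ (fun ω => (c (U ω), A ω)) (fun ω => (V ω, B ω)) (ENNReal.ofReal p)) :
    |∫ ω in {ω | A ω = true ∧ B ω = true}, h (U ω) (V ω) ∂μ|
      ≤ L * ε + 2 * (K * p) + 2 * (K ^ (-(1 + δ)) * M) := by
  have hUA : Measurable fun ω => (U ω, A ω) := hp.measU.prodMk hA
  have hVB : Measurable fun ω => (V ω, B ω) := hp.measV.prodMk hB
  have hfm := measurable_flagKernel hh.meas
  have := Measure.isProbabilityMeasure_map (μ := μ) hUA.aemeasurable
  have := Measure.isProbabilityMeasure_map (μ := μ) hVB.aemeasurable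
  have := Measure.isProbabilityMeasure_map (μ := μ) (hUA.prodMk hVB).aemeasurable
  have hz := hh.integral_flagKernel hp.measU hp.measV hp.lawU hp.lawV hA hB hAB
  rw [setIntegral_eq_integral_flagKernel hh.meas hp.measU hp.measV hA hB]
  set π := μ.map fun ω => ((U ω, A ω), (V ω, B ω)) with hπ
  have hfst : π.fst = μ.map fun ω => (U ω, A ω) := Measure.fst_map_prodMk hVB
  have hsnd : π.snd = μ.map fun ω => (V ω, B ω) := Measure.snd_map_prodMk hUA
  set c' : ℝ × Bool → ℤ × Bool := fun x => (c x.1, x.2) with hc'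
  have hcm : Measurable c' := (hc.comp measurable_fst).prodMk measurable_snd
  have hcm2 : Measurable fun z : (ℝ × Bool) × (ℝ × Bool) => (c' z.1, z.2) :=
    (hcm.comp measurable_fst).prodMk measurable_snd
  obtain ⟨ρ, hρ1, hρ2, hρ3⟩ := exists_cell_coupling π hcm (p := ENNReal.ofReal p) (by
    intro S hS
    rw [hfst, hsnd, hπ, Measure.map_map hcm hUA, Measure.map_map hcm2 (hUA.prodMk hVB)]
    exact hdep S hS)
  rw [hfst, hsnd] at hρ2
  have hm1 : Measurable fun t : (ℝ × Bool) × (ℝ × Bool) × (ℝ × Bool) => (t.1, t.2.2) := by fun_prop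
  have hm2 : Measurable fun t : (ℝ × Bool) × (ℝ × Bool) × (ℝ × Bool) => (t.2.1, t.2.2) := by
    fun_prop
  have hρp : IsProbabilityMeasure ρ := by
    constructor
    have : (ρ.map fun t => (t.1, t.2.2)) Set.univ = 1 := by rw [hρ1]; simp
    rwa [Measure.map_apply hm1 MeasurableSet.univ, Set.preimage_univ] at this
  -- the kernel at the two pairs, as functions on the coupling space
  set H : (ℝ × Bool) × (ℝ × Bool) × (ℝ × Bool) → ℝ := fun t => h t.1.1 t.2.2.1 with hH
  set H' : (ℝ × Bool) × (ℝ × Bool) × (ℝ × Bool) → ℝ := fun t => h t.2.1.1 t.2.2.1 with hH'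
  have hHm : Measurable H := hh.meas.comp (measurable_fst.fst.prodMk measurable_snd.snd.fst)
  have hHm' : Measurable H' := hh.meas.comp (measurable_snd.fst.fst.prodMk measurable_snd.snd.fst)
  have hpair1 : ρ.map (fun t => (t.1.1, t.2.2.1)) = μ.map fun ω => (U ω, V ω) := by
    have : (fun t : (ℝ × Bool) × (ℝ × Bool) × (ℝ × Bool) => (t.1.1, t.2.2.1))
        = (fun z : (ℝ × Bool) × (ℝ × Bool) => (z.1.1, z.2.1)) ∘ fun t => (t.1, t.2.2) := rfl
    rw [this, ← Measure.map_map (by fun_prop) hm1, hρ1, hπ,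
      Measure.map_map (by fun_prop) (hUA.prodMk hVB)]
    rfl
  have hpair2 : ρ.map (fun t => (t.2.1.1, t.2.2.1)) = F.prod F := by
    have : (fun t : (ℝ × Bool) × (ℝ × Bool) × (ℝ × Bool) => (t.2.1.1, t.2.2.1))
        = (Prod.map Prod.fst Prod.fst) ∘ fun t => (t.2.1, t.2.2) := rfl
    rw [this, ← Measure.map_map (by fun_prop) hm2, hρ2,
      ← Measure.map_prod_map _ _ measurable_fst measurable_fst,
      Measure.map_map measurable_fst hUA, Measure.map_map measurable_fst hVB]
    change (μ.map U).prod (μ.map V) = _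
    rw [hp.lawU, hp.lawV]
  have hhm : Measurable fun z : ℝ × ℝ => ENNReal.ofReal (|h z.1 z.2| ^ (2 + δ)) := by
    have h2 : Measurable fun p : ℝ × ℝ => h p.1 p.2 := hh.meas
    fun_prop
  have hmom1 : ∫⁻ t, ENNReal.ofReal (|H t| ^ (2 + δ)) ∂ρ ≤ ENNReal.ofReal M := by
    refine le_trans (le_of_eq ?_) hp.mom
    have e1 := lintegral_map (μ := ρ) hhm
      (by fun_prop : Measurable fun t : (ℝ × Bool) × (ℝ × Bool) × (ℝ × Bool) => (t.1.1, t.2.2.1))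
    have e2 := lintegral_map (μ := μ) hhm (hp.measU.prodMk hp.measV)
    rw [hpair1] at e1
    exact e1.symm.trans e2
  have hmom2 : ∫⁻ t, ENNReal.ofReal (|H' t| ^ (2 + δ)) ∂ρ ≤ ENNReal.ofReal M := by
    refine le_trans (le_of_eq ?_) hh.mom
    have e1 := lintegral_map (μ := ρ) hhm
      (by fun_prop : Measurable fun t : (ℝ × Bool) × (ℝ × Bool) × (ℝ × Bool) => (t.2.1.1, t.2.2.1))
    rw [hpair2] at e1
    exact e1.symm
  set f1 : (ℝ × Bool) × (ℝ × Bool) × (ℝ × Bool) → ℝ := fun t => flagKernel h (t.1, t.2.2) with hf1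
  set f2 : (ℝ × Bool) × (ℝ × Bool) × (ℝ × Bool) → ℝ := fun t => flagKernel h (t.2.1, t.2.2) with hf2
  have hfm1 : Measurable f1 := hfm.comp hm1
  have hfm2 : Measurable f2 := hfm.comp hm2
  have hi1 : Integrable f1 ρ := (integrable_of_mom hHm hh.δ_pos hmom1).mono
    hfm1.aestronglyMeasurable (Eventually.of_forall fun t => abs_flagKernel_le _)
  have hi2 : Integrable f2 ρ := (integrable_of_mom hHm' hh.δ_pos hmom2).mono
    hfm2.aestronglyMeasurable (Eventually.of_forall fun t => abs_flagKernel_le _)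
  have e1 : ∫ z, flagKernel h z ∂π = ∫ t, f1 t ∂ρ := by
    rw [← hρ1, integral_map hm1.aemeasurable hfm.aestronglyMeasurable]
  have e2 : ∫ t, f2 t ∂ρ = 0 := by
    rw [← hz, ← hρ2, integral_map hm2.aemeasurable hfm.aestronglyMeasurable]
  set E : Set ((ℝ × Bool) × (ℝ × Bool) × (ℝ × Bool)) := {t | c' t.1 ≠ c' t.2.1} with hE
  have hEm : MeasurableSet E :=
    (measurableSet_eq_fun (hcm.comp measurable_fst) (hcm.comp measurable_snd.fst)).compl
  have hlip := hL ε hε (ρ.map fun t => (t.1.1, t.2.1.1, t.2.2.1))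
    (Measure.isProbabilityMeasure_map (by fun_prop : Measurable
      fun t : (ℝ × Bool) × (ℝ × Bool) × (ℝ × Bool) => (t.1.1, t.2.1.1, t.2.2.1)).aemeasurable)
    (by rw [Measure.map_map (by fun_prop) (by fun_prop)]; exact hpair1)
    (by rw [Measure.map_map (by fun_prop) (by fun_prop)]; exact hpair2)
  have hindm : Measurable (Set.indicator {t : ℝ × ℝ × ℝ | |t.1 - t.2.1| ≤ ε}
      (fun t => ENNReal.ofReal |h t.1 t.2.2 - h t.2.1 t.2.2|)) := by
    have m1 : Measurable fun t : ℝ × ℝ × ℝ => h t.1 t.2.2 :=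
      hh.meas.comp (measurable_fst.prodMk measurable_snd.snd)
    have m2 : Measurable fun t : ℝ × ℝ × ℝ => h t.2.1 t.2.2 :=
      hh.meas.comp (measurable_snd.fst.prodMk measurable_snd.snd)
    refine Measurable.indicator (m1.sub m2).abs.ennreal_ofReal ?_
    exact measurableSet_le (by fun_prop) measurable_const
  rw [lintegral_map hindm (by fun_prop)] at hlip
  have hmain : ∫⁻ t, ENNReal.ofReal |f1 t - f2 t| ∂ρ
      ≤ ENNReal.ofReal (L * ε + 2 * (K * p) + 2 * (K ^ (-(1 + δ)) * M)) := by
    calc ∫⁻ t, ENNReal.ofReal |f1 t - f2 t| ∂ρ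
        ≤ ∫⁻ t, (Set.indicator {t : ℝ × ℝ × ℝ | |t.1 - t.2.1| ≤ ε}
            (fun t => ENNReal.ofReal |h t.1 t.2.2 - h t.2.1 t.2.2|) (t.1.1, t.2.1.1, t.2.2.1)
            + (E.indicator (fun t => ENNReal.ofReal |H t|) t
              + E.indicator (fun t => ENNReal.ofReal |H' t|) t)) ∂ρ := by
          refine lintegral_mono fun t => ?_
          by_cases ht : t ∈ E
          · refine le_trans ?_ le_add_self
            rw [Set.indicator_of_mem ht, Set.indicator_of_mem ht,
              ← ENNReal.ofReal_add (abs_nonneg _) (abs_nonneg _)]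
            refine ENNReal.ofReal_le_ofReal ((abs_sub _ _).trans ?_)
            exact add_le_add (abs_flagKernel_le _) (abs_flagKernel_le _)
          · refine le_trans ?_ le_self_add
            simp only [hE, Set.mem_ofPred_eq, not_not, hc', Prod.mk.injEq] at ht
            rw [Set.indicator_of_mem
              (show (t.1.1, t.2.1.1, t.2.2.1) ∈ {t : ℝ × ℝ × ℝ | |t.1 - t.2.1| ≤ ε} from
                hcε _ _ ht.1)]
            refine ENNReal.ofReal_le_ofReal ?_
            simp only [hf1, hf2, flagKernel, ht.2]
            split_ifs <;> simp
      _ = ∫⁻ t, Set.indicator {t : ℝ × ℝ × ℝ | |t.1 - t.2.1| ≤ ε}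
            (fun t => ENNReal.ofReal |h t.1 t.2.2 - h t.2.1 t.2.2|) (t.1.1, t.2.1.1, t.2.2.1) ∂ρ
          + (∫⁻ t in E, ENNReal.ofReal |H t| ∂ρ + ∫⁻ t in E, ENNReal.ofReal |H' t| ∂ρ) := by
          have m1 : Measurable (E.indicator fun t => ENNReal.ofReal |H t|) :=
            Measurable.indicator (by fun_prop) hEm
          have m2 : Measurable (E.indicator fun t => ENNReal.ofReal |H' t|) :=
            Measurable.indicator (by fun_prop) hEm
          have m3 : Measurable fun t => E.indicator (fun t => ENNReal.ofReal |H t|) t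
              + E.indicator (fun t => ENNReal.ofReal |H' t|) t := m1.add m2
          rw [lintegral_add_right _ m3, lintegral_add_right _ m2,
            lintegral_indicator hEm, lintegral_indicator hEm]
      _ ≤ ENNReal.ofReal (L * ε)
          + ((ENNReal.ofReal K * ENNReal.ofReal p + ENNReal.ofReal (K ^ (-(1 + δ)) * M))
            + (ENNReal.ofReal K * ENNReal.ofReal p + ENNReal.ofReal (K ^ (-(1 + δ)) * M))) := by
          refine add_le_add hlip (add_le_add ?_ ?_)
          · refine (setLIntegral_abs_le_of_mom hHm hh.δ_pos hmom1 hK E).trans ?_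
            gcongr
          · refine (setLIntegral_abs_le_of_mom hHm' hh.δ_pos hmom2 hK E).trans ?_
            gcongr
      _ = _ := by
          have hM0 := hh.M_nonneg
          rw [← ENNReal.ofReal_mul hK.le, ← ENNReal.ofReal_add (by positivity) (by positivity),
            ← ENNReal.ofReal_add (by positivity) (by positivity),
            ← ENNReal.ofReal_add (by positivity) (by positivity)]
          congr 1; ring
  have hM0 := hh.M_nonneg
  rw [e1, ← sub_zero (∫ t, f1 t ∂ρ), ← e2, ← integral_sub hi1 hi2]
  refine abs_integral_le_integral_abs.trans ?_
  have hm12 : Measurable fun t => |f1 t - f2 t| := (hfm1.sub hfm2).abs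
  rw [integral_eq_lintegral_of_nonneg_ae (Eventually.of_forall fun _ => abs_nonneg _)
    hm12.aestronglyMeasurable]
  exact ENNReal.toReal_le_of_le_ofReal (by positivity) hmain

end EventBounds

/-! ### From events to products -/

section Products

variable {Ω : Type*} {𝒢 : MeasurableSpace Ω} [m₀ : MeasurableSpace Ω] {μ : Measure Ω} [IsProbabilityMeasure μ]
  {δ M K : ℝ}

/-- `∫ H g = ∫ H E(g | 𝒢)`, and `∫ |E(g | 𝒢)|` is a difference of integrals of `g` over the two events
of `𝒢` on which `E(g | 𝒢)` has constant sign. -/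
lemma abs_integral_mul_le_of_bounded (h𝒢 : 𝒢 ≤ m₀) {g H : Ω → ℝ}
    (hg : Integrable g μ) (hH : Measurable[𝒢] H) (hHK : ∀ ω, |H ω| ≤ K) {D : ℝ}
    (hD : ∀ A, MeasurableSet[𝒢] A → |∫ ω in A, g ω ∂μ| ≤ D) :
    |∫ ω, H ω * g ω ∂μ| ≤ 2 * (K * D) := by
  have hK : 0 ≤ K := by
    obtain ⟨ω⟩ : Nonempty Ω := μ.nonempty_of_neZero
    exact (abs_nonneg _).trans (hHK ω)
  have hHg : Integrable (H * g) μ :=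
    hg.bdd_mul (hH.mono h𝒢 le_rfl).aestronglyMeasurable (Eventually.of_forall hHK)
  have h1 : ∫ ω, H ω * g ω ∂μ = ∫ ω, H ω * (μ[g|𝒢]) ω ∂μ := by
    rw [← integral_condExp h𝒢]
    refine integral_congr_ae ?_
    exact condExp_mul_of_stronglyMeasurable_left hH.stronglyMeasurable hHg hg
  set B : Set Ω := {ω | 0 ≤ (μ[g|𝒢]) ω} with hB
  have hBm : MeasurableSet[𝒢] B :=
    measurableSet_le measurable_const stronglyMeasurable_condExp.measurable
  have hi : Integrable (fun ω => |(μ[g|𝒢]) ω|) μ := integrable_condExp.abs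
  rw [h1]
  calc |∫ ω, H ω * (μ[g|𝒢]) ω ∂μ| ≤ ∫ ω, |H ω * (μ[g|𝒢]) ω| ∂μ := abs_integral_le_integral_abs
    _ ≤ ∫ ω, K * |(μ[g|𝒢]) ω| ∂μ := by
        refine integral_mono_of_nonneg (Eventually.of_forall fun ω => abs_nonneg _)
          (hi.const_mul K) (Eventually.of_forall fun ω => ?_)
        simp only [abs_mul]
        exact mul_le_mul_of_nonneg_right (hHK ω) (abs_nonneg _)
    _ = K * (∫ ω in B, |(μ[g|𝒢]) ω| ∂μ + ∫ ω in Bᶜ, |(μ[g|𝒢]) ω| ∂μ) := by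
        rw [integral_const_mul, integral_add_compl (h𝒢 _ hBm) hi]
    _ = K * (∫ ω in B, g ω ∂μ - ∫ ω in Bᶜ, g ω ∂μ) := by
        have e1 : ∫ ω in B, |(μ[g|𝒢]) ω| ∂μ = ∫ ω in B, g ω ∂μ := by
          rw [← setIntegral_condExp h𝒢 hg hBm]
          exact setIntegral_congr_fun (h𝒢 _ hBm) fun ω hω => abs_of_nonneg hω
        have e2 : ∫ ω in Bᶜ, |(μ[g|𝒢]) ω| ∂μ = -∫ ω in Bᶜ, g ω ∂μ := by
          rw [← setIntegral_condExp h𝒢 hg hBm.compl, ← integral_neg]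
          exact setIntegral_congr_fun (h𝒢 _ hBm).compl fun ω hω => abs_of_neg (not_le.1 hω)
        rw [e1, e2]; ring
    _ ≤ K * (2 * D) := by
        have h2 := abs_le.1 (hD B hBm)
        have h3 := abs_le.1 (hD Bᶜ hBm.compl)
        gcongr
        linarith
    _ = _ := by ring

lemma abs_mul_le_add_rpow {x y : ℝ} (hK : 0 < K) (hδ : 0 < δ) :
    |x * y| ≤ K * |y| + K ^ (-δ) * (|y| ^ (2 + δ) + |x| ^ (2 + δ)) := by
  rw [abs_mul]
  have h0 : 0 ≤ K ^ (-δ) * (|y| ^ (2 + δ) + |x| ^ (2 + δ)) := by positivity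
  rcases le_or_gt |x| K with h | h
  · have := mul_le_mul_of_nonneg_right h (abs_nonneg y)
    linarith
  · have h1 := mul_le_rpow_add_of_lt hK (abs_nonneg y) h hδ
    have h2 : 0 ≤ K * |y| := by positivity
    linarith [mul_comm |x| |y|]

lemma integrable_mul_of_mom {X Y : Ω → ℝ} (hX : Measurable X) (hY : Measurable Y) (hδ : 0 < δ)
    (hXM : ∫⁻ ω, ENNReal.ofReal (|X ω| ^ (2 + δ)) ∂μ ≤ ENNReal.ofReal M)
    (hYM : ∫⁻ ω, ENNReal.ofReal (|Y ω| ^ (2 + δ)) ∂μ ≤ ENNReal.ofReal M) :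
    Integrable (fun ω => X ω * Y ω) μ := by
  refine Integrable.mono' (g := fun ω => 1 * |Y ω| + 1 ^ (-δ) * (|Y ω| ^ (2 + δ) + |X ω| ^ (2 + δ)))
    ?_ (hX.mul hY).aestronglyMeasurable
    (Eventually.of_forall fun ω => abs_mul_le_add_rpow one_pos hδ)
  exact ((integrable_of_mom hY hδ hYM).abs.const_mul _).add
    (((integrable_rpow_of_mom hY hYM).add (integrable_rpow_of_mom hX hXM)).const_mul _)

/-- If the means of `g` over all events of `𝒢` are at most `D`, then the mean of `H g` for a
`𝒢`-measurable `H` is controlled by truncating `H` at level `K`. -/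
lemma abs_integral_mul_le_of_events (h𝒢 : 𝒢 ≤ m₀) {g H : Ω → ℝ}
    (hg : Measurable g) (hδ : 0 < δ) (hM : 0 ≤ M) (hK : 0 < K)
    (hgM : ∫⁻ ω, ENNReal.ofReal (|g ω| ^ (2 + δ)) ∂μ ≤ ENNReal.ofReal M)
    (hH : Measurable[𝒢] H)
    (hHK : (∀ ω, |H ω| ≤ K) ∨ ∫⁻ ω, ENNReal.ofReal (|H ω| ^ (2 + δ)) ∂μ ≤ ENNReal.ofReal M)
    {D : ℝ} (hD : ∀ A, MeasurableSet[𝒢] A → |∫ ω in A, g ω ∂μ| ≤ D) :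
    |∫ ω, H ω * g ω ∂μ| ≤ 2 * (K * D) + 2 * (K ^ (-δ) * M) := by
  have hgi := integrable_of_mom hg hδ hgM
  have hH0 : Measurable H := hH.mono h𝒢 le_rfl
  rcases hHK with h | hHM
  · have := abs_integral_mul_le_of_bounded h𝒢 hgi hH h hD
    have h0 : 0 ≤ K ^ (-δ) * M := by positivity
    linarith
  · have hcm : Measurable[𝒢] fun ω => clamp K (H ω) := (measurable_clamp K).comp hH
    have h1 := abs_integral_mul_le_of_bounded h𝒢 hgi hcm (fun ω => abs_clamp_le hK.le (H ω)) hD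
    have hci : Integrable (fun ω => clamp K (H ω) * g ω) μ :=
      hgi.bdd_mul (hcm.mono h𝒢 le_rfl).aestronglyMeasurable
        (Eventually.of_forall fun ω => abs_clamp_le hK.le (H ω))
    have hHg := integrable_mul_of_mom hH0 hg hδ hHM hgM
    have h2 : |∫ ω, H ω * g ω ∂μ - ∫ ω, clamp K (H ω) * g ω ∂μ| ≤ 2 * (K ^ (-δ) * M) := by
      rw [← integral_sub hHg hci]
      refine abs_integral_le_integral_abs.trans ?_
      calc ∫ ω, |H ω * g ω - clamp K (H ω) * g ω| ∂μ
          ≤ ∫ ω, K ^ (-δ) * (|g ω| ^ (2 + δ) + |H ω| ^ (2 + δ)) ∂μ := by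
            refine integral_mono (hHg.sub hci).abs
              (((integrable_rpow_of_mom hg hgM).add (integrable_rpow_of_mom hH0 hHM)).const_mul _)
              fun ω => ?_
            simp only
            rw [← sub_mul, abs_mul]
            rcases le_or_gt |H ω| K with h | h
            · rw [clamp_of_abs_le h]; simp; positivity
            · have h3 := mul_le_rpow_add_of_lt hK (abs_nonneg (g ω)) h hδ
              have h4 : |H ω - clamp K (H ω)| ≤ |H ω| := by
                have := abs_clamp_le hK.le (H ω)
                have h5 := abs_sub_clamp_le hK hδ (H ω)
                rcases le_or_gt 0 (H ω) with hp | hn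
                · rw [abs_of_nonneg hp] at h ⊢
                  unfold clamp
                  rw [min_eq_left h.le, max_eq_right (by linarith), abs_of_nonneg (by linarith)]
                  linarith
                · rw [abs_of_neg hn] at h ⊢
                  unfold clamp
                  rw [min_eq_right (by linarith), max_eq_left (by linarith),
                    abs_of_neg (by linarith)]
                  linarith
              calc _ ≤ |H ω| * |g ω| := by gcongr
                _ ≤ _ := by rw [mul_comm]; exact h3
        _ = K ^ (-δ) * (∫ ω, |g ω| ^ (2 + δ) ∂μ + ∫ ω, |H ω| ^ (2 + δ) ∂μ) := by
            rw [integral_const_mul, integral_add (integrable_rpow_of_mom hg hgM)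
              (integrable_rpow_of_mom hH0 hHM)]
        _ ≤ K ^ (-δ) * (M + M) := by
            have := integral_rpow_le_of_mom hg hM hgM
            have := integral_rpow_le_of_mom hH0 hM hHM
            gcongr
        _ = _ := by ring
    rw [abs_le] at h1 h2 ⊢
    constructor <;> linarith

/-- If `G` is bounded by `K` and close to `X` in `L¹`, then `X - G` is small against any `Y` with a
`(2 + δ)`-th moment. -/
lemma integral_abs_sub_mul_le {X G Y : Ω → ℝ} (hX : Measurable X) (hG : Measurable G)
    (hY : Measurable Y) (hδ : 0 < δ) (hM : 0 ≤ M) (hK : 0 < K)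
    (hXM : ∫⁻ ω, ENNReal.ofReal (|X ω| ^ (2 + δ)) ∂μ ≤ ENNReal.ofReal M)
    (hYM : ∫⁻ ω, ENNReal.ofReal (|Y ω| ^ (2 + δ)) ∂μ ≤ ENNReal.ofReal M)
    (hGK : ∀ ω, |G ω| ≤ K) {D : ℝ} (hD : ∫ ω, |X ω - G ω| ∂μ ≤ D) :
    ∫ ω, |(X ω - G ω) * Y ω| ∂μ ≤ K * D + 3 * (K ^ (-δ) * M) := by
  have hGi : Integrable G μ := Integrable.of_bound hG.aestronglyMeasurable K
    (Eventually.of_forall hGK)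
  have hXi := integrable_of_mom hX hδ hXM
  have i1 : Integrable (fun ω => K * |X ω - G ω|) μ := (hXi.sub hGi).abs.const_mul K
  have i2 : Integrable (fun ω => 2 * |Y ω| ^ (2 + δ)) μ :=
    (integrable_rpow_of_mom hY hYM).const_mul 2
  have i3 : Integrable (fun ω => K ^ (-δ) * (|X ω| ^ (2 + δ) + 2 * |Y ω| ^ (2 + δ))) μ :=
    ((integrable_rpow_of_mom hX hXM).add i2).const_mul _
  have hb : Integrable (fun ω => K * |X ω - G ω|
      + K ^ (-δ) * (|X ω| ^ (2 + δ) + 2 * |Y ω| ^ (2 + δ))) μ :=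
    i1.add i3
  have hXr := integral_rpow_le_of_mom hX hM hXM
  have hYr := integral_rpow_le_of_mom hY hM hYM
  calc ∫ ω, |(X ω - G ω) * Y ω| ∂μ
      ≤ ∫ ω, (K * |X ω - G ω| + K ^ (-δ) * (|X ω| ^ (2 + δ) + 2 * |Y ω| ^ (2 + δ))) ∂μ := by
        refine integral_mono_of_nonneg (Eventually.of_forall fun ω => abs_nonneg _) hb
          (Eventually.of_forall fun ω => ?_)
        simp only [abs_mul]
        have h0 : 0 ≤ K ^ (-δ) * (|X ω| ^ (2 + δ) + 2 * |Y ω| ^ (2 + δ)) := by positivity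
        rcases le_or_gt |Y ω| K with h | h
        · have := mul_le_mul_of_nonneg_left h (abs_nonneg (X ω - G ω))
          linarith
        · have h1 := mul_le_rpow_add_of_lt hK (abs_nonneg (X ω)) h hδ
          have h2 := sq_le_rpow_of_lt hK h hδ
          have h3 : |X ω - G ω| ≤ |X ω| + K := (abs_sub _ _).trans (by linarith [hGK ω])
          have h4 : 0 ≤ K * |X ω - G ω| := by positivity
          nlinarith [abs_nonneg (Y ω), mul_le_mul_of_nonneg_right h3 (abs_nonneg (Y ω))]
    _ = K * ∫ ω, |X ω - G ω| ∂μ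
        + K ^ (-δ) * (∫ ω, |X ω| ^ (2 + δ) ∂μ + 2 * ∫ ω, |Y ω| ^ (2 + δ) ∂μ) := by
        rw [integral_add i1 i3, integral_const_mul, integral_const_mul, integral_add
          (integrable_rpow_of_mom hX hXM) i2, integral_const_mul]
    _ ≤ K * D + K ^ (-δ) * (M + 2 * M) := by gcongr
    _ = _ := by ring

/-- An `L¹`-approximation of `X` bounded by `K` is an `L²`-approximation. -/
lemma integral_sub_sq_le {X G : Ω → ℝ} (hX : Measurable X) (hG : Measurable G)
    (hδ : 0 < δ) (hM : 0 ≤ M) (hK : 0 < K)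
    (hXM : ∫⁻ ω, ENNReal.ofReal (|X ω| ^ (2 + δ)) ∂μ ≤ ENNReal.ofReal M)
    (hGK : ∀ ω, |G ω| ≤ K) {D : ℝ} (hD : ∫ ω, |X ω - G ω| ∂μ ≤ D) :
    Integrable (fun ω => (X ω - G ω) ^ 2) μ ∧
      ∫ ω, (X ω - G ω) ^ 2 ∂μ ≤ 2 * (K * D) + 4 * (K ^ (-δ) * M) := by
  have hGi : Integrable G μ := Integrable.of_bound hG.aestronglyMeasurable K
    (Eventually.of_forall hGK)
  have hXi := integrable_of_mom hX hδ hXM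
  have hXr := integral_rpow_le_of_mom hX hM hXM
  have i1 : Integrable (fun ω => 2 * K * |X ω - G ω|) μ := (hXi.sub hGi).abs.const_mul _
  have hb : Integrable (fun ω => 2 * K * |X ω - G ω| + 4 * K ^ (-δ) * |X ω| ^ (2 + δ)) μ :=
    i1.add ((integrable_rpow_of_mom hX hXM).const_mul _)
  have hpt : ∀ ω, (X ω - G ω) ^ 2 ≤ 2 * K * |X ω - G ω| + 4 * K ^ (-δ) * |X ω| ^ (2 + δ) := by
    intro ω
    have h0 : 0 ≤ K ^ (-δ) * |X ω| ^ (2 + δ) := by positivity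
    have h3 : |X ω - G ω| ≤ |X ω| + K := (abs_sub _ _).trans (by linarith [hGK ω])
    have ha := abs_nonneg (X ω - G ω)
    rw [← sq_abs]
    rcases le_or_gt |X ω| K with h | h
    · nlinarith
    · have h2 := sq_le_rpow_of_lt hK h hδ
      have h4 : 0 ≤ K * |X ω - G ω| := by positivity
      nlinarith [abs_nonneg (X ω)]
  have hsq : Integrable (fun ω => (X ω - G ω) ^ 2) μ :=
    hb.mono' ((hX.sub hG).pow_const 2).aestronglyMeasurable
      (Eventually.of_forall fun ω => by
        rw [Real.norm_of_nonneg (sq_nonneg _)]; exact hpt ω)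
  refine ⟨hsq, (integral_mono hsq hb hpt).trans ?_⟩
  rw [integral_add i1 ((integrable_rpow_of_mom hX hXM).const_mul _),
    integral_const_mul, integral_const_mul]
  have h1 : 2 * K * ∫ ω, |X ω - G ω| ∂μ ≤ 2 * K * D := by gcongr
  have h2 : 4 * K ^ (-δ) * ∫ ω, |X ω| ^ (2 + δ) ∂μ ≤ 4 * K ^ (-δ) * M := by gcongr
  linarith

end Products

/-! ### Dyadic maximal inequality -/

/-- Sum of the squares of the sums of `ξ` over all dyadic blocks contained in `[s, s + 2 ^ k)`. -/
def dyadicSq (ξ : ℕ → ℝ) : ℕ → ℕ → ℝ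
  | 0, s => ξ s ^ 2
  | k + 1, s => (∑ j ∈ Finset.range (2 ^ (k + 1)), ξ (s + j)) ^ 2
      + (dyadicSq ξ k s + dyadicSq ξ k (s + 2 ^ k))

lemma dyadicSq_nonneg (ξ : ℕ → ℝ) (k s : ℕ) : 0 ≤ dyadicSq ξ k s := by
  induction k generalizing s with
  | zero => simp [dyadicSq, sq_nonneg]
  | succ k ih =>
    have := ih s; have := ih (s + 2 ^ k)
    simp only [dyadicSq]; positivity

lemma sq_sum_block_le (ξ : ℕ → ℝ) (k s : ℕ) :
    (∑ j ∈ Finset.range (2 ^ k), ξ (s + j)) ^ 2 ≤ dyadicSq ξ k s := by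
  cases k with
  | zero => simp [dyadicSq]
  | succ k =>
    have := dyadicSq_nonneg ξ k s; have := dyadicSq_nonneg ξ k (s + 2 ^ k)
    simp only [dyadicSq]; linarith

/-- The chaining step of the Rademacher–Menshov inequality: every partial sum is a sum of at most
`k + 1` dyadic blocks. -/
lemma sq_sum_range_le_dyadicSq (ξ : ℕ → ℝ) (k s n : ℕ) (hn : n ≤ 2 ^ k) :
    (∑ j ∈ Finset.range n, ξ (s + j)) ^ 2 ≤ (k + 1) * dyadicSq ξ k s := by
  induction k generalizing s n with
  | zero =>
    have hn' : n = 0 ∨ n = 1 := by rw [pow_zero] at hn; omega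
    rcases hn' with rfl | rfl <;> simp [dyadicSq, sq_nonneg]
  | succ k ih =>
    have h1 := dyadicSq_nonneg ξ k s
    have h2 := dyadicSq_nonneg ξ k (s + 2 ^ k)
    simp only [dyadicSq]
    push_cast
    have h3 := sq_nonneg (∑ j ∈ Finset.range (2 ^ (k + 1)), ξ (s + j))
    have hk : (0 : ℝ) ≤ k := Nat.cast_nonneg k
    rcases le_or_gt n (2 ^ k) with h | h
    · have := ih s n h
      nlinarith
    · obtain ⟨m, rfl⟩ := Nat.exists_eq_add_of_lt h
      have h5 := ih (s + 2 ^ k) (m + 1) (by rw [pow_succ] at hn; omega)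
      have h6 := sq_sum_block_le ξ k s
      rw [show 2 ^ k + m + 1 = 2 ^ k + (m + 1) by ring, Finset.sum_range_add]
      have e : ∀ x, s + (2 ^ k + x) = s + 2 ^ k + x := fun x => by ring
      simp only [e]
      set B := ∑ j ∈ Finset.range (2 ^ k), ξ (s + j)
      set R := ∑ j ∈ Finset.range (m + 1), ξ (s + 2 ^ k + j)
      set D := dyadicSq ξ k (s + 2 ^ k)
      have h7 : (k + 1) * (B + R) ^ 2 ≤ (k + 1) * ((k + 2) * (B ^ 2 + D)) := by
        nlinarith [sq_nonneg ((k + 1) * B - R)]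
      have h8 := le_of_mul_le_mul_left h7 (by positivity)
      nlinarith

section Dyadic

variable {Ω : Type*} [MeasurableSpace Ω] {μ : Measure Ω}

lemma integrable_dyadicSq {ξ : ℕ → Ω → ℝ} (hξ : ∀ i j, Integrable (fun ω => ξ i ω * ξ j ω) μ)
    (k s : ℕ) : Integrable (fun ω => dyadicSq (fun j => ξ j ω) k s) μ := by
  induction k generalizing s with
  | zero => simpa [dyadicSq, sq] using hξ s s
  | succ k ih =>
    simp only [dyadicSq]
    refine Integrable.add ?_ ((ih s).add (ih _))
    simp only [sq, Finset.sum_mul_sum]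
    exact integrable_finsetSum _ fun i _ => integrable_finsetSum _ fun j _ => hξ _ _

lemma integral_dyadicSq_le {ξ : ℕ → Ω → ℝ} (hξ : ∀ i j, Integrable (fun ω => ξ i ω * ξ j ω) μ)
    (k s : ℕ) : ∫ ω, dyadicSq (fun j => ξ j ω) k s ∂μ
      ≤ (k + 1) * ∑ i ∈ Finset.range (2 ^ k), ∑ j ∈ Finset.range (2 ^ k),
        |∫ ω, ξ (s + i) ω * ξ (s + j) ω ∂μ| := by
  induction k generalizing s with
  | zero =>
    simp only [dyadicSq, pow_zero, Finset.range_one, Finset.sum_singleton, add_zero, sq]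
    simpa using le_abs_self _
  | succ k ih =>
    have hsq : Integrable (fun ω => (∑ j ∈ Finset.range (2 ^ (k + 1)), ξ (s + j) ω) ^ 2) μ := by
      simp only [sq, Finset.sum_mul_sum]
      exact integrable_finsetSum _ fun i _ => integrable_finsetSum _ fun j _ => hξ _ _
    simp only [dyadicSq]
    have hadd : Integrable (fun ω => dyadicSq (fun j => ξ j ω) k s
        + dyadicSq (fun j => ξ j ω) k (s + 2 ^ k)) μ :=
      (integrable_dyadicSq hξ k s).add (integrable_dyadicSq hξ k _)
    rw [integral_add hsq hadd,
      integral_add (integrable_dyadicSq hξ k s) (integrable_dyadicSq hξ k _)]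
    set a : ℕ → ℕ → ℝ := fun i j => |∫ ω, ξ (s + i) ω * ξ (s + j) ω ∂μ| with ha
    have ha0 : ∀ i j, 0 ≤ a i j := fun i j => abs_nonneg _
    have h1 : ∫ ω, (∑ j ∈ Finset.range (2 ^ (k + 1)), ξ (s + j) ω) ^ 2 ∂μ
        ≤ ∑ i ∈ Finset.range (2 ^ (k + 1)), ∑ j ∈ Finset.range (2 ^ (k + 1)), a i j := by
      simp only [sq, Finset.sum_mul_sum]
      rw [integral_finsetSum _ fun i _ => integrable_finsetSum _ fun j _ => hξ _ _]
      refine Finset.sum_le_sum fun i _ => ?_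
      rw [integral_finsetSum _ fun j _ => hξ _ _]
      exact Finset.sum_le_sum fun j _ => le_abs_self _
    have h2 := ih s
    have h3 := ih (s + 2 ^ k)
    have h4 : ∑ i ∈ Finset.range (2 ^ k), ∑ j ∈ Finset.range (2 ^ k), a i j
        + ∑ i ∈ Finset.range (2 ^ k), ∑ j ∈ Finset.range (2 ^ k), a (2 ^ k + i) (2 ^ k + j)
        ≤ ∑ i ∈ Finset.range (2 ^ (k + 1)), ∑ j ∈ Finset.range (2 ^ (k + 1)), a i j := by
      rw [pow_succ, mul_two, Finset.sum_range_add]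
      refine add_le_add (Finset.sum_le_sum fun i _ => ?_) (Finset.sum_le_sum fun i _ => ?_)
      · rw [Finset.sum_range_add]
        have : 0 ≤ ∑ x ∈ Finset.range (2 ^ k), a i (2 ^ k + x) :=
          Finset.sum_nonneg fun _ _ => ha0 _ _
        linarith
      · rw [Finset.sum_range_add]
        have : 0 ≤ ∑ x ∈ Finset.range (2 ^ k), a (2 ^ k + i) x :=
          Finset.sum_nonneg fun _ _ => ha0 _ _
        linarith
    have h5 : ∑ i ∈ Finset.range (2 ^ k), ∑ j ∈ Finset.range (2 ^ k),
        |∫ ω, ξ (s + 2 ^ k + i) ω * ξ (s + 2 ^ k + j) ω ∂μ|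
        = ∑ i ∈ Finset.range (2 ^ k), ∑ j ∈ Finset.range (2 ^ k), a (2 ^ k + i) (2 ^ k + j) := by
      simp only [ha, add_assoc]
    rw [h5] at h3
    have hk : (0 : ℝ) ≤ k + 1 := by positivity
    have h6 := mul_le_mul_of_nonneg_left h4 hk
    push_cast
    linarith

end Dyadic

/-! ### Counting quadruples by their extremal gaps -/

section Counting

variable {ψ : ℕ → ℝ}

lemma sum_sum_max_le (hψ : ∀ m, 0 ≤ ψ m) (N : ℕ) :
    ∑ a ∈ Finset.range N, ∑ b ∈ Finset.range N, ψ (max a b)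
      ≤ 2 * ∑ m ∈ Finset.range N, ((m : ℝ) + 1) * ψ m := by
  have h1 : ∀ f : ℕ → ℝ, (∀ m, 0 ≤ f m) → ∑ b ∈ Finset.range N, ∑ a ∈ Finset.range N,
      (if a ≤ b then f b else 0) ≤ ∑ m ∈ Finset.range N, ((m : ℝ) + 1) * f m := by
    intro f hf
    refine Finset.sum_le_sum fun b hb => ?_
    rw [← Finset.sum_filter, Finset.sum_const, nsmul_eq_mul]
    have : ((Finset.range N).filter (· ≤ b)).card ≤ b + 1 := by
      calc _ ≤ (Finset.range (b + 1)).card := Finset.card_le_card fun x hx => by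
            simp only [Finset.mem_filter, Finset.mem_range] at hx ⊢; omega
        _ = b + 1 := Finset.card_range _
    have h2 : (((Finset.range N).filter (· ≤ b)).card : ℝ) ≤ b + 1 := by exact_mod_cast this
    exact mul_le_mul_of_nonneg_right h2 (hf b)
  calc ∑ a ∈ Finset.range N, ∑ b ∈ Finset.range N, ψ (max a b)
      ≤ ∑ a ∈ Finset.range N, ∑ b ∈ Finset.range N,
        ((if a ≤ b then ψ b else 0) + (if b ≤ a then ψ a else 0)) := by
        refine Finset.sum_le_sum fun a _ => Finset.sum_le_sum fun b _ => ?_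
        have := hψ a; have := hψ b
        rcases le_total a b with h | h
        · rw [max_eq_right h, if_pos h]; split_ifs <;> linarith
        · rw [max_eq_left h, if_pos h]; split_ifs <;> linarith
    _ = ∑ a ∈ Finset.range N, ∑ b ∈ Finset.range N, (if a ≤ b then ψ b else 0)
        + ∑ a ∈ Finset.range N, ∑ b ∈ Finset.range N, (if b ≤ a then ψ a else 0) := by
        simp only [Finset.sum_add_distrib]
    _ ≤ _ := by
        rw [Finset.sum_comm]
        have := h1 ψ hψ
        linarith

/-- The bound attached to the ordered quadruple `x₁ ≤ x₂`, `x₃ ≤ x₄` by the larger of the gaps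
`x₂ - x₁` and `x₄ - x₃`. -/
def gapBound (ψ : ℕ → ℝ) (x₁ x₂ x₃ x₄ : ℕ) : ℝ :=
  if x₁ ≤ x₂ ∧ x₃ ≤ x₄ then ψ (max (x₂ - x₁) (x₄ - x₃)) else 0

lemma gapBound_nonneg (hψ : ∀ m, 0 ≤ ψ m) (x₁ x₂ x₃ x₄ : ℕ) : 0 ≤ gapBound ψ x₁ x₂ x₃ x₄ := by
  unfold gapBound; split_ifs <;> simp [hψ]

lemma sum_ite_sub_le {f : ℕ → ℝ} (hf : ∀ m, 0 ≤ f m) (N x : ℕ) (hx : 1 ≤ x) :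
    ∑ y ∈ Finset.Icc 1 N, (if x ≤ y then f (y - x) else 0) ≤ ∑ a ∈ Finset.range N, f a := by
  rw [← Finset.sum_filter]
  have h1 : (Finset.Icc 1 N).filter (x ≤ ·) = Finset.Ico x (N + 1) := by
    ext y; simp only [Finset.mem_filter, Finset.mem_Icc, Finset.mem_Ico]; omega
  rw [h1, Finset.sum_Ico_eq_sum_range]
  simp only [Nat.add_sub_cancel_left]
  exact Finset.sum_le_sum_of_subset_of_nonneg (fun a ha => by
    simp only [Finset.mem_range] at ha ⊢; omega) fun a _ _ => hf a

/-- Two of the four indices and the two gaps determine the quadruple, and `m` is the larger of two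
nonnegative gaps in at most `2 (m + 1)` ways. -/
lemma sum_gapBound_le (hψ : ∀ m, 0 ≤ ψ m) (N : ℕ) :
    ∑ x₁ ∈ Finset.Icc 1 N, ∑ x₂ ∈ Finset.Icc 1 N, ∑ x₃ ∈ Finset.Icc 1 N, ∑ x₄ ∈ Finset.Icc 1 N,
      gapBound ψ x₁ x₂ x₃ x₄ ≤ 2 * (N : ℝ) ^ 2 * ∑ m ∈ Finset.range N, ((m : ℝ) + 1) * ψ m := by
  set W := ∑ a ∈ Finset.range N, ∑ b ∈ Finset.range N, ψ (max a b) with hW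
  have h1 : ∀ x₁ ∈ Finset.Icc 1 N, ∑ x₂ ∈ Finset.Icc 1 N, ∑ x₃ ∈ Finset.Icc 1 N,
      ∑ x₄ ∈ Finset.Icc 1 N, gapBound ψ x₁ x₂ x₃ x₄ ≤ N * W := by
    intro x₁ hx₁
    rw [Finset.sum_comm]
    calc _ ≤ ∑ x₃ ∈ Finset.Icc 1 N, W := by
          refine Finset.sum_le_sum fun x₃ hx₃ => ?_
          calc ∑ x₂ ∈ Finset.Icc 1 N, ∑ x₄ ∈ Finset.Icc 1 N, gapBound ψ x₁ x₂ x₃ x₄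
              ≤ ∑ x₂ ∈ Finset.Icc 1 N, (if x₁ ≤ x₂ then
                  (fun a => ∑ b ∈ Finset.range N, ψ (max a b)) (x₂ - x₁) else 0) := by
                refine Finset.sum_le_sum fun x₂ _ => ?_
                by_cases h : x₁ ≤ x₂
                · simp only [gapBound, h, true_and, if_true]
                  exact sum_ite_sub_le (f := fun b => ψ (max (x₂ - x₁) b)) (fun _ => hψ _) N x₃
                    (Finset.mem_Icc.1 hx₃).1
                · simp [gapBound, h]
            _ ≤ W := sum_ite_sub_le (f := fun a => ∑ b ∈ Finset.range N, ψ (max a b))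
                (fun _ => Finset.sum_nonneg fun _ _ => hψ _) N x₁ (Finset.mem_Icc.1 hx₁).1
      _ = N * W := by simp
  calc _ ≤ ∑ x₁ ∈ Finset.Icc 1 N, N * W := Finset.sum_le_sum h1
    _ = (N : ℝ) ^ 2 * W := by simp; ring
    _ ≤ (N : ℝ) ^ 2 * (2 * ∑ m ∈ Finset.range N, ((m : ℝ) + 1) * ψ m) := by
        have := sum_sum_max_le hψ N
        gcongr
    _ = _ := by ring

/-- If a quantity attached to two pairs `p < q` and `i < j` is at most `ψ m` as soon as the least
index is separated by `m` from the others, or the largest one is, then its sum over all pairs in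
`[1, N]` is of order `N² ∑ m ψ m`. -/
lemma sum_pairs_le (hψ : ∀ m, 0 ≤ ψ m) {A : ℕ → ℕ → ℕ → ℕ → ℝ}
    (hsymm : ∀ p q i j, A p q i j = A i j p q)
    (hfirst : ∀ p q i j m, 1 ≤ p → p < q → i < j → p + m ≤ q → p + m ≤ i → A p q i j ≤ ψ m)
    (hlast : ∀ p q i j m, 1 ≤ p → 1 ≤ i → p < q → i < j → i + m ≤ j → q + m ≤ j →
      A p q i j ≤ ψ m) (N : ℕ) :
    ∑ p ∈ Finset.Icc 1 N, ∑ q ∈ Finset.Icc 1 N, ∑ i ∈ Finset.Icc 1 N, ∑ j ∈ Finset.Icc 1 N,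
      (if p < q ∧ i < j then A p q i j else 0)
      ≤ 12 * (N : ℝ) ^ 2 * ∑ m ∈ Finset.range N, ((m : ℝ) + 1) * ψ m := by
  set I := Finset.Icc 1 N with hI
  set W := 2 * (N : ℝ) ^ 2 * ∑ m ∈ Finset.range N, ((m : ℝ) + 1) * ψ m with hWd
  have hW : ∑ x₁ ∈ I, ∑ x₂ ∈ I, ∑ x₃ ∈ I, ∑ x₄ ∈ I, gapBound ψ x₁ x₂ x₃ x₄ ≤ W :=
    sum_gapBound_le hψ N
  -- the bound when the least index is `p`
  have half : ∀ p q i j, 1 ≤ p → p < q → i < j → p ≤ i → A p q i j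
      ≤ gapBound ψ p q i j + gapBound ψ p i q j + gapBound ψ p i j q := by
    intro p q i j hp hpq hij hpi
    have n1 := gapBound_nonneg hψ p q i j
    have n2 := gapBound_nonneg hψ p i q j
    have n3 := gapBound_nonneg hψ p i j q
    rcases le_or_gt q i with h1 | h1
    · have : A p q i j ≤ gapBound ψ p q i j := by
        rw [gapBound, if_pos ⟨hpq.le, hij.le⟩]
        rcases le_total (q - p) (j - i) with h | h
        · rw [max_eq_right h]; exact hlast _ _ _ _ _ hp (by omega) hpq hij (by omega) (by omega)
        · rw [max_eq_left h]; exact hfirst _ _ _ _ _ hp hpq hij (by omega) (by omega)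
      linarith
    rcases le_or_gt q j with h2 | h2
    · have : A p q i j ≤ gapBound ψ p i q j := by
        rw [gapBound, if_pos ⟨hpi, h2⟩]
        rcases le_total (i - p) (j - q) with h | h
        · rw [max_eq_right h]; exact hlast _ _ _ _ _ hp (by omega) hpq hij (by omega) (by omega)
        · rw [max_eq_left h]; exact hfirst _ _ _ _ _ hp hpq hij (by omega) (by omega)
      linarith
    · have : A p q i j ≤ gapBound ψ p i j q := by
        rw [gapBound, if_pos ⟨hpi, h2.le⟩]
        rcases le_total (i - p) (q - j) with h | h
        · rw [max_eq_right h, hsymm]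
          exact hlast _ _ _ _ _ (by omega) hp hij hpq (by omega) (by omega)
        · rw [max_eq_left h]; exact hfirst _ _ _ _ _ hp hpq hij (by omega) (by omega)
      linarith
  have hpt : ∀ p ∈ I, ∀ q ∈ I, ∀ i ∈ I, ∀ j ∈ I, (if p < q ∧ i < j then A p q i j else 0)
      ≤ gapBound ψ p q i j + gapBound ψ p i q j + gapBound ψ p i j q
        + (gapBound ψ i j p q + gapBound ψ i p j q + gapBound ψ i p q j) := by
    intro p hp q _ i hi j _
    have hp1 := (Finset.mem_Icc.1 hp).1
    have hi1 := (Finset.mem_Icc.1 hi).1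
    have m1 := gapBound_nonneg hψ p q i j
    have m2 := gapBound_nonneg hψ p i q j
    have m3 := gapBound_nonneg hψ p i j q
    have m4 := gapBound_nonneg hψ i j p q
    have m5 := gapBound_nonneg hψ i p j q
    have m6 := gapBound_nonneg hψ i p q j
    by_cases h : p < q ∧ i < j
    · rw [if_pos h]
      rcases le_total p i with h1 | h1
      · have := half p q i j hp1 h.1 h.2 h1; linarith
      · have := half i j p q hi1 h.2 h.1 h1; rw [hsymm]; linarith
    · rw [if_neg h]; linarith
  have e2 : ∀ f : ℕ → ℕ → ℕ → ℕ → ℝ, ∑ p ∈ I, ∑ q ∈ I, ∑ i ∈ I, ∑ j ∈ I, f p i q j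
      = ∑ p ∈ I, ∑ q ∈ I, ∑ i ∈ I, ∑ j ∈ I, f p q i j := fun f =>
    Finset.sum_congr rfl fun p _ => Finset.sum_comm
  have e3 : ∀ f : ℕ → ℕ → ℕ → ℕ → ℝ, ∑ p ∈ I, ∑ q ∈ I, ∑ i ∈ I, ∑ j ∈ I, f p q j i
      = ∑ p ∈ I, ∑ q ∈ I, ∑ i ∈ I, ∑ j ∈ I, f p q i j := fun f =>
    Finset.sum_congr rfl fun p _ => Finset.sum_congr rfl fun q _ => Finset.sum_comm
  have e1 : ∀ f : ℕ → ℕ → ℕ → ℕ → ℝ, ∑ p ∈ I, ∑ q ∈ I, ∑ i ∈ I, ∑ j ∈ I, f q p i j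
      = ∑ p ∈ I, ∑ q ∈ I, ∑ i ∈ I, ∑ j ∈ I, f p q i j := fun f => Finset.sum_comm
  calc _ ≤ ∑ p ∈ I, ∑ q ∈ I, ∑ i ∈ I, ∑ j ∈ I,
        (gapBound ψ p q i j + gapBound ψ p i q j + gapBound ψ p i j q
        + (gapBound ψ i j p q + gapBound ψ i p j q + gapBound ψ i p q j)) :=
        Finset.sum_le_sum fun p hp => Finset.sum_le_sum fun q hq => Finset.sum_le_sum fun i hi =>
          Finset.sum_le_sum fun j hj => hpt p hp q hq i hi j hj
    _ = 6 * ∑ p ∈ I, ∑ q ∈ I, ∑ i ∈ I, ∑ j ∈ I, gapBound ψ p q i j := by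
        simp only [Finset.sum_add_distrib]
        have f1 := e2 (gapBound ψ)
        have f2 : ∑ p ∈ I, ∑ q ∈ I, ∑ i ∈ I, ∑ j ∈ I, gapBound ψ p i j q
            = ∑ p ∈ I, ∑ q ∈ I, ∑ i ∈ I, ∑ j ∈ I, gapBound ψ p q i j :=
          (e2 fun p i q j => gapBound ψ p i j q).trans (e3 (gapBound ψ))
        have f3 : ∑ p ∈ I, ∑ q ∈ I, ∑ i ∈ I, ∑ j ∈ I, gapBound ψ i p q j
            = ∑ p ∈ I, ∑ q ∈ I, ∑ i ∈ I, ∑ j ∈ I, gapBound ψ p q i j :=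
          (e2 fun p i q j => gapBound ψ i p q j).trans (e1 (gapBound ψ))
        have f4 : ∑ p ∈ I, ∑ q ∈ I, ∑ i ∈ I, ∑ j ∈ I, gapBound ψ i p j q
            = ∑ p ∈ I, ∑ q ∈ I, ∑ i ∈ I, ∑ j ∈ I, gapBound ψ p q i j :=
          (e2 fun p i q j => gapBound ψ i p j q).trans
            ((e1 fun i p q j => gapBound ψ i p j q).trans (e3 (gapBound ψ)))
        have f5 : ∑ p ∈ I, ∑ q ∈ I, ∑ i ∈ I, ∑ j ∈ I, gapBound ψ i j p q
            = ∑ p ∈ I, ∑ q ∈ I, ∑ i ∈ I, ∑ j ∈ I, gapBound ψ p q i j :=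
          (e2 fun p i q j => gapBound ψ i j p q).trans
            ((e1 fun i p q j => gapBound ψ i j p q).trans
              ((e3 fun i p j q => gapBound ψ i j p q).trans (e2 (gapBound ψ))))
        rw [f1, f2, f3, f4, f5]
        ring
    _ ≤ 6 * W := by gcongr
    _ = _ := by rw [hWd]; ring

end Counting


/-! ### Maxima of sums over pairs -/

section MaxSq
variable {Ω : Type*} [MeasurableSpace Ω] {μ : Measure Ω}

/-- The running maxima of `S ^ 2` over `n ≤ 2 ^ k` are dominated by integrable variables whose means
grow at most like `(k + 1) ^ 2 * (2 ^ k) ^ (2 + τ)`. -/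
def MaxSqBound (μ : Measure Ω) (S : ℕ → Ω → ℝ) (τ : ℝ) : Prop :=
  ∃ (g : ℕ → Ω → ℝ) (C : ℝ), 0 ≤ C ∧ (∀ k, Integrable (g k) μ) ∧
    (∀ k n ω, n ≤ 2 ^ k → S n ω ^ 2 ≤ g k ω) ∧
    ∀ k : ℕ, ∫ ω, g k ω ∂μ ≤ C * ((k : ℝ) + 1) ^ 2 * ((2 : ℝ) ^ k) ^ (2 + τ)

lemma MaxSqBound.add {S T : ℕ → Ω → ℝ} {τ : ℝ} (hS : MaxSqBound μ S τ) (hT : MaxSqBound μ T τ) :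
    MaxSqBound μ (fun n ω => S n ω + T n ω) τ := by
  obtain ⟨g, C, hC, hg, hSg, hgC⟩ := hS
  obtain ⟨g', C', hC', hg', hSg', hgC'⟩ := hT
  refine ⟨fun k ω => 2 * g k ω + 2 * g' k ω, 2 * C + 2 * C', by positivity,
    fun k => ((hg k).const_mul 2).add ((hg' k).const_mul 2), fun k n ω hn => ?_, fun k => ?_⟩
  · have h1 := hSg k n ω hn
    have h2 := hSg' k n ω hn
    nlinarith [sq_nonneg (S n ω - T n ω)]
  · rw [integral_add ((hg k).const_mul 2) ((hg' k).const_mul 2), integral_const_mul,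
      integral_const_mul]
    have h1 := hgC k
    have h2 := hgC' k
    calc _ ≤ 2 * (C * ((k : ℝ) + 1) ^ 2 * ((2 : ℝ) ^ k) ^ (2 + τ))
          + 2 * (C' * ((k : ℝ) + 1) ^ 2 * ((2 : ℝ) ^ k) ^ (2 + τ)) := by linarith
      _ = _ := by ring

lemma sum_Icc_Ioc_eq (f : ℕ → ℕ → ℝ) (n : ℕ) :
    ∑ i ∈ Finset.Icc 1 n, ∑ j ∈ Finset.Ioc i n, f i j
      = ∑ j ∈ Finset.range n, ∑ i ∈ Finset.Ico 1 (1 + j), f i (1 + j) := by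
  rw [Finset.sum_comm' (s' := fun j => Finset.Ico 1 j) (t' := Finset.Ico 1 (n + 1)),
    Finset.sum_Ico_eq_sum_range]
  · simp
  · intro i j
    simp only [Finset.mem_Icc, Finset.mem_Ioc, Finset.mem_Ico]
    omega

/-- A decay of the covariances of `Y` in the first or in the last gap of the four indices bounds the
maxima of the sums of `Y` over pairs. -/
lemma maxSqBound_of_cov {Y : ℕ → ℕ → Ω → ℝ} {ψ : ℕ → ℝ} {C τ : ℝ} (hψ : ∀ m, 0 ≤ ψ m)
    (hY : ∀ p q i j, 1 ≤ p → p < q → 1 ≤ i → i < j →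
      Integrable (fun ω => Y p q ω * Y i j ω) μ)
    (hfirst : ∀ p q i j m, 1 ≤ p → p < q → i < j → p + m ≤ q → p + m ≤ i →
      |∫ ω, Y p q ω * Y i j ω ∂μ| ≤ ψ m)
    (hlast : ∀ p q i j m, 1 ≤ p → 1 ≤ i → p < q → i < j → i + m ≤ j → q + m ≤ j →
      |∫ ω, Y p q ω * Y i j ω ∂μ| ≤ ψ m)
    (hC : 0 ≤ C)
    (hsum : ∀ N : ℕ, 1 ≤ N → ∑ m ∈ Finset.range N, ((m : ℝ) + 1) * ψ m ≤ C * (N : ℝ) ^ τ) :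
    MaxSqBound μ (fun n ω => ∑ i ∈ Finset.Icc 1 n, ∑ j ∈ Finset.Ioc i n, Y i j ω) τ := by
  set ξ : ℕ → Ω → ℝ := fun j ω => ∑ i ∈ Finset.Ico 1 j, Y i j ω with hξd
  have hprod : ∀ q j ω, ξ q ω * ξ j ω
      = ∑ p ∈ Finset.Ico 1 q, ∑ i ∈ Finset.Ico 1 j, Y p q ω * Y i j ω := by
    intro q j ω
    simp only [hξd, Finset.sum_mul_sum]
  have hprodi : ∀ q j, ∀ p ∈ Finset.Ico 1 q, ∀ i ∈ Finset.Ico 1 j,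
      Integrable (fun ω => Y p q ω * Y i j ω) μ := by
    intro q j p hp i hi
    rw [Finset.mem_Ico] at hp hi
    exact hY p q i j hp.1 hp.2 hi.1 hi.2
  have hξ : ∀ q j, Integrable (fun ω => ξ q ω * ξ j ω) μ := by
    intro q j
    simp only [hprod]
    exact integrable_finsetSum _ fun p hp => integrable_finsetSum _ fun i hi => hprodi q j p hp i hi
  have hcov : ∀ k : ℕ, ∑ q ∈ Finset.range (2 ^ k), ∑ j ∈ Finset.range (2 ^ k),
      |∫ ω, ξ (1 + q) ω * ξ (1 + j) ω ∂μ| ≤ 12 * ((2 : ℝ) ^ k) ^ 2 * (C * ((2 : ℝ) ^ k) ^ τ) := by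
    intro k
    set N := 2 ^ k with hN
    have hNr : (N : ℝ) = (2 : ℝ) ^ k := by rw [hN]; push_cast; rfl
    set A : ℕ → ℕ → ℕ → ℕ → ℝ := fun p q i j => |∫ ω, Y p q ω * Y i j ω ∂μ| with hA
    calc ∑ q ∈ Finset.range N, ∑ j ∈ Finset.range N, |∫ ω, ξ (1 + q) ω * ξ (1 + j) ω ∂μ|
        = ∑ q ∈ Finset.Icc 1 N, ∑ j ∈ Finset.Icc 1 N, |∫ ω, ξ q ω * ξ j ω ∂μ| := by
          have h1 : Finset.Icc 1 N = Finset.Ico 1 (N + 1) := by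
            ext x; simp only [Finset.mem_Icc, Finset.mem_Ico]; omega
          rw [h1, Finset.sum_Ico_eq_sum_range]
          simp only [Nat.add_sub_cancel]
          refine Finset.sum_congr rfl fun q _ => ?_
          rw [Finset.sum_Ico_eq_sum_range]
          simp
      _ ≤ ∑ q ∈ Finset.Icc 1 N, ∑ j ∈ Finset.Icc 1 N,
            ∑ p ∈ Finset.Icc 1 N, ∑ i ∈ Finset.Icc 1 N, (if p < q ∧ i < j then A p q i j else 0) := by
          refine Finset.sum_le_sum fun q hq => Finset.sum_le_sum fun j hj => ?_
          rw [Finset.mem_Icc] at hq hj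
          simp only [hprod]
          rw [integral_finsetSum _ fun p hp => integrable_finsetSum _ fun i hi => hprodi q j p hp i hi]
          refine (Finset.abs_sum_le_sum_abs _ _).trans ?_
          have h2 : ∀ p ∈ Finset.Ico 1 q,
              |∫ ω, ∑ i ∈ Finset.Ico 1 j, Y p q ω * Y i j ω ∂μ| ≤ ∑ i ∈ Finset.Icc 1 N,
                (if p < q ∧ i < j then A p q i j else 0) := by
            intro p hp
            rw [integral_finsetSum _ fun i hi => hprodi q j p hp i hi]
            refine (Finset.abs_sum_le_sum_abs _ _).trans ?_
            calc ∑ i ∈ Finset.Ico 1 j, A p q i j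
                = ∑ i ∈ Finset.Ico 1 j, (if p < q ∧ i < j then A p q i j else 0) := by
                  refine Finset.sum_congr rfl fun i hi => ?_
                  rw [Finset.mem_Ico] at hp hi
                  rw [if_pos ⟨hp.2, hi.2⟩]
              _ ≤ _ := by
                  refine Finset.sum_le_sum_of_subset_of_nonneg (fun x hx => ?_) fun i _ _ => ?_
                  · rw [Finset.mem_Ico] at hx; rw [Finset.mem_Icc]; omega
                  · split_ifs <;> simp [hA]
          refine (Finset.sum_le_sum h2).trans ?_
          refine Finset.sum_le_sum_of_subset_of_nonneg (fun x hx => ?_) fun p _ _ =>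
            Finset.sum_nonneg fun i _ => ?_
          · rw [Finset.mem_Ico] at hx; rw [Finset.mem_Icc]; omega
          · split_ifs <;> simp [hA]
      _ = ∑ p ∈ Finset.Icc 1 N, ∑ q ∈ Finset.Icc 1 N, ∑ i ∈ Finset.Icc 1 N,
            ∑ j ∈ Finset.Icc 1 N, (if p < q ∧ i < j then A p q i j else 0) := by
          rw [Finset.sum_comm]
          conv_rhs => rw [Finset.sum_comm]
          rw [Finset.sum_comm]
          refine Finset.sum_congr rfl fun q _ => ?_
          rw [Finset.sum_comm]
          exact Finset.sum_congr rfl fun p _ => Finset.sum_comm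
      _ ≤ 12 * (N : ℝ) ^ 2 * ∑ m ∈ Finset.range N, ((m : ℝ) + 1) * ψ m :=
          sum_pairs_le hψ (fun p q i j => by simp only [mul_comm (Y p q _)]) hfirst hlast N
      _ ≤ 12 * (N : ℝ) ^ 2 * (C * (N : ℝ) ^ τ) := by
          gcongr
          exact hsum N Nat.one_le_two_pow
      _ = _ := by rw [hNr]
  refine ⟨fun k ω => ((k : ℝ) + 1) * dyadicSq (fun j => ξ j ω) k 1, 12 * C, by positivity,
    fun k => (integrable_dyadicSq hξ k 1).const_mul _, fun k n ω hn => ?_, fun k => ?_⟩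
  · have := sq_sum_range_le_dyadicSq (fun j => ξ j ω) k 1 n hn
    simp only [sum_Icc_Ioc_eq (fun i j => Y i j ω)]
    exact this
  · rw [integral_const_mul]
    have h1 := integral_dyadicSq_le hξ k 1
    have h2 : ((2 : ℝ) ^ k) ^ (2 + τ) = ((2 : ℝ) ^ k) ^ 2 * ((2 : ℝ) ^ k) ^ τ := by
      rw [Real.rpow_add (by positivity)]; norm_cast
    calc ((k : ℝ) + 1) * ∫ ω, dyadicSq (fun j => ξ j ω) k 1 ∂μ
        ≤ ((k : ℝ) + 1) * (((k : ℝ) + 1) * (12 * ((2 : ℝ) ^ k) ^ 2 * (C * ((2 : ℝ) ^ k) ^ τ))) := by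
          gcongr
          refine h1.trans ?_
          gcongr
          exact hcov k
      _ = _ := by rw [h2]; ring

lemma sum_pairs_sub_le {f : ℕ → ℝ} (hf : ∀ m, 0 ≤ f m) {n N : ℕ} (hn : n ≤ N) :
    ∑ i ∈ Finset.Icc 1 n, ∑ j ∈ Finset.Ioc i n, f (j - i) ≤ N * ∑ r ∈ Finset.range N, f r := by
  calc ∑ i ∈ Finset.Icc 1 n, ∑ j ∈ Finset.Ioc i n, f (j - i)
      ≤ ∑ i ∈ Finset.Icc 1 n, ∑ r ∈ Finset.range N, f r := by
        refine Finset.sum_le_sum fun i hi => ?_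
        rw [Finset.mem_Icc] at hi
        refine le_trans ?_ (sum_ite_sub_le hf N i hi.1)
        rw [← Finset.sum_filter]
        refine Finset.sum_le_sum_of_subset_of_nonneg (fun x hx => ?_) fun i _ _ => hf _
        rw [Finset.mem_Ioc] at hx
        rw [Finset.mem_filter, Finset.mem_Icc]
        omega
    _ = n * ∑ r ∈ Finset.range N, f r := by simp
    _ ≤ _ := by
        gcongr
        exact Finset.sum_nonneg fun r _ => hf r

lemma sum_range_inv_le (k : ℕ) : ∑ r ∈ Finset.range (2 ^ k), ((r : ℝ))⁻¹ ≤ k + 1 := by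
  have h1 : ∑ r ∈ Finset.range (2 ^ k), ((r : ℝ))⁻¹ ≤ ∑ r ∈ Finset.range (2 ^ k + 1), ((r : ℝ))⁻¹ :=
    Finset.sum_le_sum_of_subset_of_nonneg (Finset.range_mono (by omega)) fun r _ _ => by positivity
  rw [Finset.sum_range_succ'] at h1
  have h2 := harmonic_le_one_add_log (2 ^ k)
  unfold harmonic at h2
  push_cast at h2 h1
  rw [Real.log_pow] at h2
  have h3 := Real.log_two_lt_d9
  have h4 : (k : ℝ) * Real.log 2 ≤ k := by nlinarith [(Nat.cast_nonneg k : (0 : ℝ) ≤ k)]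
  simp only [inv_zero, add_zero] at h1
  linarith

/-- Cauchy–Schwarz with weights `1 / (j - i)`: no dependence structure is needed for terms whose
second moments decay in the distance of the indices. -/
lemma maxSqBound_of_sq {e : ℕ → ℕ → Ω → ℝ} {ψ : ℕ → ℝ} {C τ : ℝ} (hψ : ∀ m, 0 ≤ ψ m)
    (he : ∀ i j, 1 ≤ i → i < j → Integrable (fun ω => e i j ω ^ 2) μ)
    (heψ : ∀ i j, 1 ≤ i → i < j → ∫ ω, e i j ω ^ 2 ∂μ ≤ ψ (j - i)) (hC : 0 ≤ C)
    (hsum : ∀ N : ℕ, 1 ≤ N → ∑ m ∈ Finset.range N, ((m : ℝ) + 1) * ψ m ≤ C * (N : ℝ) ^ τ) :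
    MaxSqBound μ (fun n ω => ∑ i ∈ Finset.Icc 1 n, ∑ j ∈ Finset.Ioc i n, e i j ω) τ := by
  have hint : ∀ N, ∀ i ∈ Finset.Icc 1 N, ∀ j ∈ Finset.Ioc i N,
      Integrable (fun ω => ((j - i : ℕ) : ℝ) * e i j ω ^ 2) μ := by
    intro N i hi j hj
    rw [Finset.mem_Icc] at hi
    rw [Finset.mem_Ioc] at hj
    exact (he i j hi.1 hj.1).const_mul _
  refine ⟨fun k ω => (2 : ℝ) ^ k * (k + 1) * ∑ i ∈ Finset.Icc 1 (2 ^ k), ∑ j ∈ Finset.Ioc i (2 ^ k),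
    ((j - i : ℕ) : ℝ) * e i j ω ^ 2, C, hC, fun k => ?_, fun k n ω hn => ?_, fun k => ?_⟩
  · exact (integrable_finsetSum _ fun i hi => integrable_finsetSum _ fun j hj =>
      hint _ i hi j hj).const_mul _
  · have h1 : (∑ i ∈ Finset.Icc 1 n, ∑ j ∈ Finset.Ioc i n, e i j ω) ^ 2
        ≤ (∑ i ∈ Finset.Icc 1 n, ∑ j ∈ Finset.Ioc i n, (((j - i : ℕ) : ℝ))⁻¹)
          * ∑ i ∈ Finset.Icc 1 n, ∑ j ∈ Finset.Ioc i n, ((j - i : ℕ) : ℝ) * e i j ω ^ 2 := by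
      rw [Finset.sum_sigma', Finset.sum_sigma', Finset.sum_sigma']
      refine Finset.sum_sq_le_sum_mul_sum_of_sq_le_mul _ (fun x _ => by positivity)
        (fun x _ => by positivity) fun x hx => ?_
      simp only [Finset.mem_sigma, Finset.mem_Icc, Finset.mem_Ioc] at hx
      have : ((x.2 - x.1 : ℕ) : ℝ) ≠ 0 := by
        have : x.2 - x.1 ≠ 0 := by omega
        exact_mod_cast this
      refine le_of_eq ?_
      field_simp
    refine h1.trans ?_
    have h2 : ∑ i ∈ Finset.Icc 1 n, ∑ j ∈ Finset.Ioc i n, (((j - i : ℕ) : ℝ))⁻¹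
        ≤ (2 : ℝ) ^ k * (k + 1) := by
      refine (sum_pairs_sub_le (f := fun r => ((r : ℝ))⁻¹) (fun m => by positivity) hn).trans ?_
      push_cast
      gcongr
      exact sum_range_inv_le k
    have h3 : ∑ i ∈ Finset.Icc 1 n, ∑ j ∈ Finset.Ioc i n, ((j - i : ℕ) : ℝ) * e i j ω ^ 2
        ≤ ∑ i ∈ Finset.Icc 1 (2 ^ k), ∑ j ∈ Finset.Ioc i (2 ^ k), ((j - i : ℕ) : ℝ) * e i j ω ^ 2 := by
      calc _ ≤ ∑ i ∈ Finset.Icc 1 n, ∑ j ∈ Finset.Ioc i (2 ^ k), ((j - i : ℕ) : ℝ) * e i j ω ^ 2 :=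
            Finset.sum_le_sum fun i _ => Finset.sum_le_sum_of_subset_of_nonneg
              (Finset.Ioc_subset_Ioc_right hn) fun j _ _ => by positivity
        _ ≤ _ := Finset.sum_le_sum_of_subset_of_nonneg (Finset.Icc_subset_Icc_right hn)
              fun i _ _ => Finset.sum_nonneg fun j _ => by positivity
    exact mul_le_mul h2 h3 (Finset.sum_nonneg fun i _ => Finset.sum_nonneg fun j _ => by positivity)
      (by positivity)
  · rw [integral_const_mul, integral_finsetSum _ fun i hi => integrable_finsetSum _ fun j hj =>
      hint _ i hi j hj]
    have h1 : ∑ i ∈ Finset.Icc 1 (2 ^ k), ∫ ω, ∑ j ∈ Finset.Ioc i (2 ^ k),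
          ((j - i : ℕ) : ℝ) * e i j ω ^ 2 ∂μ
        ≤ ∑ i ∈ Finset.Icc 1 (2 ^ k), ∑ j ∈ Finset.Ioc i (2 ^ k),
          ((fun r : ℕ => ((r : ℝ) + 1) * ψ r) (j - i)) := by
      refine Finset.sum_le_sum fun i hi => ?_
      rw [integral_finsetSum _ fun j hj => hint _ i hi j hj]
      refine Finset.sum_le_sum fun j hj => ?_
      rw [Finset.mem_Icc] at hi
      rw [Finset.mem_Ioc] at hj
      rw [integral_const_mul]
      have := heψ i j hi.1 hj.1
      have h0 := hψ (j - i)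
      calc ((j - i : ℕ) : ℝ) * ∫ ω, e i j ω ^ 2 ∂μ ≤ ((j - i : ℕ) : ℝ) * ψ (j - i) := by gcongr
        _ ≤ _ := by simp only; nlinarith
    have h2 := sum_pairs_sub_le (f := fun r : ℕ => ((r : ℝ) + 1) * ψ r)
      (fun m => mul_nonneg (by positivity) (hψ m)) (le_refl (2 ^ k))
    have h3 := hsum (2 ^ k) Nat.one_le_two_pow
    push_cast at h2 h3
    have h4 : ((2 : ℝ) ^ k) ^ (2 + τ) = ((2 : ℝ) ^ k) ^ 2 * ((2 : ℝ) ^ k) ^ τ := by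
      rw [Real.rpow_add (by positivity)]; norm_cast
    calc _ ≤ (2 : ℝ) ^ k * (k + 1) * ((2 : ℝ) ^ k * (C * ((2 : ℝ) ^ k) ^ τ)) := by
          gcongr
          exact (h1.trans h2).trans (by gcongr)
      _ ≤ (2 : ℝ) ^ k * ((k + 1) ^ 2) * ((2 : ℝ) ^ k * (C * ((2 : ℝ) ^ k) ^ τ)) := by
          gcongr
          nlinarith [(Nat.cast_nonneg k : (0 : ℝ) ≤ k)]
      _ = _ := by rw [h4]; ring

end MaxSq


/-! ### Almost sure convergence -/

section AlmostSure
variable {Ω : Type*} [MeasurableSpace Ω] {μ : Measure Ω}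

lemma summable_inv_mul_log_sq :
    Summable fun k : ℕ => (((k : ℝ) + 2) * Real.log ((k : ℝ) + 2) ^ 2)⁻¹ := by
  have hlog : ∀ n : ℕ, 2 ≤ n → 0 < Real.log n := fun n hn =>
    Real.log_pos (by exact_mod_cast (by omega : 1 < n))
  -- the value at `n ≤ 1` is modified so that the sequence is monotone
  set f : ℕ → ℝ := fun n => ((max 2 n : ℕ) * Real.log ((max 2 n : ℕ) : ℝ) ^ 2)⁻¹ with hf
  have hs : Summable f := by
    rw [← summable_condensed_iff_of_nonneg (fun n => by simp only [hf]; positivity)]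
    · have h2 : Summable fun k : ℕ => (Real.log 2 ^ 2)⁻¹ * (1 / (k : ℝ) ^ 2) :=
        (Real.summable_one_div_nat_pow.2 one_lt_two).mul_left _
      rw [← summable_nat_add_iff 1] at h2 ⊢
      refine h2.congr fun k => ?_
      have hm : max 2 (2 ^ (k + 1)) = 2 ^ (k + 1) :=
        max_eq_right (by rw [pow_succ]; have := Nat.one_le_two_pow (n := k); omega)
      have hl : 0 < Real.log 2 := Real.log_pos one_lt_two
      simp only [hf, hm]
      push_cast
      rw [Real.log_pow]
      push_cast
      have : (k : ℝ) + 1 ≠ 0 := by positivity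
      field_simp
    · intro m n _ hmn
      simp only [hf]
      have h1 : max 2 m ≤ max 2 n := max_le_max le_rfl hmn
      have h2 := hlog (max 2 m) (le_max_left _ _)
      have h3 : 0 < max 2 m := by omega
      have h4 : ((max 2 m : ℕ) : ℝ) ≤ ((max 2 n : ℕ) : ℝ) := by exact_mod_cast h1
      have h5 : (0 : ℝ) < ((max 2 m : ℕ) : ℝ) := by exact_mod_cast h3
      have h6 := Real.log_le_log h5 h4
      have h7 : 0 < ((max 2 m : ℕ) : ℝ) * Real.log ((max 2 m : ℕ) : ℝ) ^ 2 := by positivity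
      exact inv_anti₀ h7 (by gcongr)
  rw [← summable_nat_add_iff 2] at hs
  refine hs.congr fun k => ?_
  have hm : max 2 (k + 2) = k + 2 := max_eq_right (by omega)
  simp only [hf, hm]
  push_cast
  rfl

/-- The size of the dyadic block containing `n`, compared with the normalisation at `n`. -/
lemma eventually_dyadic_le {τ : ℝ} (hτ : 0 ≤ τ) : ∀ᶠ n : ℕ in atTop,
    0 < Real.log (Real.log n) ∧ 0 < Real.log n ∧
    ((2 : ℝ) ^ Nat.clog 2 n) ^ (2 + τ) * (((Nat.clog 2 n : ℝ) + 2) ^ 3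
        * Real.log ((Nat.clog 2 n : ℝ) + 2) ^ 2)
      ≤ (2 : ℝ) ^ (2 + τ) * 1125 *
        ((n : ℝ) ^ (2 + τ) * (Real.log n ^ 3 * Real.log (Real.log n) ^ 2)) := by
  have h1 : Tendsto (fun n : ℕ => Real.log n) atTop atTop :=
    Real.tendsto_log_atTop.comp tendsto_natCast_atTop_atTop
  have h2 : Tendsto (fun n : ℕ => Real.log (Real.log n)) atTop atTop :=
    Real.tendsto_log_atTop.comp h1
  filter_upwards [h1.eventually_ge_atTop 1, h2.eventually_ge_atTop 1, eventually_ge_atTop 2]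
    with n hn1 hn2 hn
  refine ⟨by linarith, by linarith, ?_⟩
  set k := Nat.clog 2 n with hk
  have hkp : 0 < k := Nat.clog_pos one_lt_two hn
  have hlt : 2 ^ (k - 1) < n := Nat.pow_pred_clog_lt_self one_lt_two (by omega)
  have hltr : (2 : ℝ) ^ (k - 1) < n := by exact_mod_cast hlt
  have h2k : (2 : ℝ) ^ k ≤ 2 * n := by
    have : (2 : ℝ) ^ k = 2 * 2 ^ (k - 1) := by
      rw [← pow_succ']; congr 1; omega
    rw [this]; linarith
  have hl2 := Real.log_two_gt_d9
  have hkl : (k : ℝ) + 2 ≤ 5 * Real.log n := by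
    have := Real.log_le_log (by positivity) hltr.le
    rw [Real.log_pow, Nat.cast_sub hkp] at this
    push_cast at this
    have hk0 : (0 : ℝ) ≤ (k : ℝ) - 1 := by
      have : (1 : ℝ) ≤ k := by exact_mod_cast hkp
      linarith
    nlinarith
  have hkll : Real.log ((k : ℝ) + 2) ≤ 3 * Real.log (Real.log n) := by
    have h5 := Real.log_le_log (by positivity) hkl
    rw [Real.log_mul (by norm_num) (by linarith)] at h5
    have h6 : Real.log 5 ≤ 2 := by
      rw [Real.log_le_iff_le_exp (by norm_num)]
      have := Real.exp_one_gt_d9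
      rw [show (2 : ℝ) = 1 + 1 by norm_num, Real.exp_add]
      nlinarith
    linarith
  have hl0 : 0 ≤ Real.log ((k : ℝ) + 2) := Real.log_nonneg (by
    have : (0 : ℝ) ≤ k := Nat.cast_nonneg _
    linarith)
  calc ((2 : ℝ) ^ k) ^ (2 + τ) * (((k : ℝ) + 2) ^ 3 * Real.log ((k : ℝ) + 2) ^ 2)
      ≤ (2 * (n : ℝ)) ^ (2 + τ) * ((5 * Real.log n) ^ 3 * (3 * Real.log (Real.log n)) ^ 2) := by
        gcongr
    _ = _ := by rw [Real.mul_rpow (by norm_num) (by positivity)]; ring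

/-- With weights `v k` of the order of the squared normalisation on the `k`-th dyadic block, the means of
`g k / v k` are summable, like `1 / ((k + 2) log² (k + 2))`. Hence `∑ k, g k / v k` converges
almost surely and its terms tend to zero. -/
lemma MaxSqBound.ae_tendsto {S : ℕ → Ω → ℝ} {τ : ℝ} (hτ : 0 ≤ τ) (hS : MaxSqBound μ S τ) :
    ∀ᵐ ω ∂μ, Tendsto (fun n : ℕ => S n ω /
      ((n : ℝ) ^ (1 + τ / 2) * (Real.log n ^ (3 / 2 : ℝ) * Real.log (Real.log n)))) atTop (𝓝 0) := by
  obtain ⟨g, C, hC, hg, hSg, hgC⟩ := hS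
  have hg0 : ∀ k ω, 0 ≤ g k ω := fun k ω => (sq_nonneg _).trans (hSg k 0 ω (Nat.zero_le _))
  set v : ℕ → ℝ := fun k => ((2 : ℝ) ^ k) ^ (2 + τ) * (((k : ℝ) + 2) ^ 3
    * Real.log ((k : ℝ) + 2) ^ 2) with hv
  have hv0 : ∀ k, 0 < v k := by
    intro k
    have : 0 < Real.log ((k : ℝ) + 2) := Real.log_pos (by
      have : (0 : ℝ) ≤ k := Nat.cast_nonneg _
      linarith)
    simp only [hv]; positivity
  have hsum : Summable fun k => ∫ ω, g k ω / v k ∂μ := by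
    refine Summable.of_nonneg_of_le (fun k => integral_nonneg fun ω =>
      div_nonneg (hg0 k ω) (hv0 k).le) (fun k => ?_) (summable_inv_mul_log_sq.mul_left C)
    rw [integral_div, div_le_iff₀ (hv0 k)]
    refine (hgC k).trans ?_
    have hl : 0 < Real.log ((k : ℝ) + 2) := Real.log_pos (by
      have : (0 : ℝ) ≤ k := Nat.cast_nonneg _
      linarith)
    calc C * ((k : ℝ) + 1) ^ 2 * ((2 : ℝ) ^ k) ^ (2 + τ)
        ≤ C * ((k : ℝ) + 2) ^ 2 * ((2 : ℝ) ^ k) ^ (2 + τ) := by gcongr; linarith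
      _ = _ := by
        simp only [hv]
        have : (k : ℝ) + 2 ≠ 0 := by positivity
        field_simp
  have hfin : ∀ᵐ ω ∂μ, ∑' k, ENNReal.ofReal (g k ω / v k) < ∞ := by
    refine ae_lt_top' (AEMeasurable.tsum fun k =>
      ((hg k).div_const _).aestronglyMeasurable.aemeasurable.ennreal_ofReal) ?_
    rw [lintegral_tsum fun k =>
      ((hg k).div_const _).aestronglyMeasurable.aemeasurable.ennreal_ofReal]
    have : ∀ k, ∫⁻ ω, ENNReal.ofReal (g k ω / v k) ∂μ = ENNReal.ofReal (∫ ω, g k ω / v k ∂μ) :=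
      fun k => (ofReal_integral_eq_lintegral_ofReal ((hg k).div_const _)
        (Eventually.of_forall fun ω => div_nonneg (hg0 k ω) (hv0 k).le)).symm
    simp only [this]
    exact hsum.tsum_ofReal_ne_top
  filter_upwards [hfin] with ω hω
  have ht : Tendsto (fun k => g k ω / v k) atTop (𝓝 0) := by
    have := ENNReal.tendsto_atTop_zero_of_tsum_ne_top hω.ne
    have := (ENNReal.tendsto_toReal ENNReal.zero_ne_top).comp this
    refine this.congr fun k => ?_
    simp [ENNReal.toReal_ofReal (div_nonneg (hg0 k ω) (hv0 k).le)]
  have hclog : Tendsto (fun n : ℕ => Nat.clog 2 n) atTop atTop := by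
    refine tendsto_atTop_mono (fun n => Nat.log_le_clog 2 n) ?_
    refine tendsto_atTop_atTop.2 fun b => ⟨2 ^ b, fun a ha => ?_⟩
    exact Nat.le_log_of_pow_le one_lt_two ha
  have ht2 := (ht.comp hclog).const_mul ((2 : ℝ) ^ (2 + τ) * 1125)
  rw [mul_zero] at ht2
  have hsq : Tendsto (fun n : ℕ => (S n ω /
      ((n : ℝ) ^ (1 + τ / 2) * (Real.log n ^ (3 / 2 : ℝ) * Real.log (Real.log n)))) ^ 2)
      atTop (𝓝 0) := by
    refine squeeze_zero' (Eventually.of_forall fun n => sq_nonneg _) ?_ ht2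
    filter_upwards [eventually_dyadic_le hτ, eventually_ge_atTop 1] with n ⟨hll, hl, hn⟩ hn1
    have hnp : (0 : ℝ) < n := by exact_mod_cast hn1
    set w := (n : ℝ) ^ (2 + τ) * (Real.log n ^ 3 * Real.log (Real.log n) ^ 2) with hw
    have hw0 : 0 < w := by positivity
    have hden : ((n : ℝ) ^ (1 + τ / 2) * (Real.log n ^ (3 / 2 : ℝ) * Real.log (Real.log n))) ^ 2
        = w := by
      rw [mul_pow, mul_pow, ← Real.rpow_natCast, ← Real.rpow_natCast (Real.log n ^ (3 / 2 : ℝ)),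
        ← Real.rpow_mul hnp.le, ← Real.rpow_mul hl.le, hw, ← Real.rpow_natCast (Real.log n) 3]
      congr 2
      · push_cast; ring
      · norm_num
    rw [div_pow, hden]
    have hSn := hSg (Nat.clog 2 n) n ω (Nat.le_pow_clog one_lt_two n)
    have hvw : v (Nat.clog 2 n) ≤ (2 : ℝ) ^ (2 + τ) * 1125 * w := hn
    simp only [Function.comp]
    rw [div_le_iff₀ hw0]
    calc S n ω ^ 2 ≤ g (Nat.clog 2 n) ω := hSn
      _ = g (Nat.clog 2 n) ω / v (Nat.clog 2 n) * v (Nat.clog 2 n) := by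
          field_simp [(hv0 (Nat.clog 2 n)).ne']
      _ ≤ g (Nat.clog 2 n) ω / v (Nat.clog 2 n) * ((2 : ℝ) ^ (2 + τ) * 1125 * w) := by
          have := div_nonneg (hg0 (Nat.clog 2 n) ω) (hv0 (Nat.clog 2 n)).le
          gcongr
      _ = _ := by ring
  have hs := hsq.sqrt
  simp only [Real.sqrt_sq_eq_abs, Real.sqrt_zero] at hs
  exact (tendsto_zero_iff_abs_tendsto_zero _).2 hs

lemma ae_tendsto_uStat {X : ℕ → Ω → ℝ} {h : ℝ → ℝ → ℝ} {τ : ℝ} (hτ : 0 ≤ τ)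
    (hS : MaxSqBound μ
      (fun n ω => ∑ i ∈ Finset.Icc 1 n, ∑ j ∈ Finset.Ioc i n, h (X i ω) (X j ω)) τ) :
    ∀ᵐ ω ∂μ, Tendsto (fun n : ℕ =>
        (n : ℝ) ^ (1 - τ / 2) / (Real.log n ^ (3 / 2 : ℝ) * Real.log (Real.log n)) *
          uStat X h n ω) atTop (𝓝 0) := by
  filter_upwards [hS.ae_tendsto hτ] with ω hω
  have h4 := (hω.abs.const_mul 4)
  simp only [abs_zero, mul_zero] at h4
  rw [tendsto_zero_iff_abs_tendsto_zero]
  refine squeeze_zero' (Eventually.of_forall fun n => abs_nonneg _) ?_ h4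
  filter_upwards [eventually_ge_atTop 2] with n hn
  have hnp : (0 : ℝ) < n := by exact_mod_cast (by omega : 0 < n)
  have hn2 : (2 : ℝ) ≤ n := by exact_mod_cast hn
  simp only [Function.comp, uStat]
  set T := ∑ i ∈ Finset.Icc 1 n, ∑ j ∈ Finset.Ioc i n, h (X i ω) (X j ω)
  set w := Real.log n ^ (3 / 2 : ℝ) * Real.log (Real.log n)
  have hch : ((n.choose 2 : ℕ) : ℝ) = n * (n - 1) / 2 := Nat.cast_choose_two ℝ n
  have hch4 : (n : ℝ) ^ 2 / 4 ≤ ((n.choose 2 : ℕ) : ℝ) := by rw [hch]; nlinarith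
  have hchi : (((n.choose 2 : ℕ) : ℝ))⁻¹ ≤ 4 / (n : ℝ) ^ 2 := by
    rw [inv_le_comm₀ (lt_of_lt_of_le (by positivity) hch4) (by positivity)]
    rw [inv_div]; exact hch4
  have hpow : (n : ℝ) ^ (1 - τ / 2) * (4 / (n : ℝ) ^ 2) = 4 * ((n : ℝ) ^ (1 + τ / 2))⁻¹ := by
    rw [← Real.rpow_neg hnp.le, ← Real.rpow_natCast, mul_div_assoc', mul_comm _ (4 : ℝ),
      mul_div_assoc, ← Real.rpow_sub hnp]
    congr 2
    push_cast; ring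
  rw [abs_mul, abs_div _ w, abs_mul _ T, abs_div T, abs_mul _ w,
    abs_of_nonneg (by positivity : 0 ≤ (n : ℝ) ^ (1 - τ / 2)),
    abs_of_nonneg (by positivity : 0 ≤ (((n.choose 2 : ℕ) : ℝ))⁻¹),
    abs_of_nonneg (by positivity : 0 ≤ (n : ℝ) ^ (1 + τ / 2))]
  calc (n : ℝ) ^ (1 - τ / 2) / |w| * ((((n.choose 2 : ℕ) : ℝ))⁻¹ * |T|)
      ≤ (n : ℝ) ^ (1 - τ / 2) / |w| * (4 / (n : ℝ) ^ 2 * |T|) := by gcongr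
    _ = (n : ℝ) ^ (1 - τ / 2) * (4 / (n : ℝ) ^ 2) * |T| / |w| := by ring
    _ = _ := by rw [hpow]; ring

end AlmostSure


/-! ### Covariance bounds from weak dependence -/

section CovarianceOfDependence

variable {Ω : Type*} {𝓕 𝓖 : MeasurableSpace Ω} [m₀ : MeasurableSpace Ω] {μ : Measure Ω}
  [IsProbabilityMeasure μ] {F : Measure ℝ} {h : ℝ → ℝ → ℝ} {δ M : ℝ} {U V H : Ω → ℝ}

/-- If `h (U, V)` has small mean on every event of the past `𝓕` and on every event of the future `𝓖`, it is
nearly uncorrelated with every `H` measurable with respect to one of the two. Events are encoded by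
`Bool`-valued variables; one of the two flags `A`, `B` is always trivial. -/
lemma MomPair.abs_integral_mul_le_of_flags (hp : MomPair μ F h δ M U V) (hh : DegKernel F h δ M)
    (hF : 𝓕 ≤ m₀) (hG : 𝓖 ≤ m₀) (hH : Measurable[𝓕] H ∨ Measurable[𝓖] H) {K D : ℝ} (hK : 0 < K)
    (hHK : (∀ ω, |H ω| ≤ K) ∨ ∫⁻ ω, ENNReal.ofReal (|H ω| ^ (2 + δ)) ∂μ ≤ ENNReal.ofReal M)
    (hD : ∀ A B : Ω → Bool, Measurable[𝓕] A → Measurable[𝓖] B →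
      ((∀ ω, A ω = true) ∨ ∀ ω, B ω = true) →
      |∫ ω in {ω | A ω = true ∧ B ω = true}, h (U ω) (V ω) ∂μ| ≤ D) :
    |∫ ω, H ω * h (U ω) (V ω) ∂μ| ≤ 2 * (K * D) + 2 * (K ^ (-δ) * M) := by
  classical
  have hm : Measurable fun ω => h (U ω) (V ω) := hh.meas.comp (hp.measU.prodMk hp.measV)
  have hflag : ∀ (𝒢 : MeasurableSpace Ω) (A : Set Ω), MeasurableSet[𝒢] A →
      Measurable[𝒢] fun ω => decide (ω ∈ A) := by
    intro 𝒢 A hA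
    refine measurable_to_bool ?_
    have : (fun ω => decide (ω ∈ A)) ⁻¹' {true} = A := by ext ω; simp
    rw [this]; exact hA
  rcases hH with hH | hH
  · refine abs_integral_mul_le_of_events hF hm hh.δ_pos hh.M_nonneg hK hp.mom hH hHK fun A hA => ?_
    have := hD (fun ω => decide (ω ∈ A)) (fun _ => true) (hflag _ A hA) (@measurable_const _ _ _ 𝓖 _)
      (Or.inr fun _ => rfl)
    simpa using this
  · refine abs_integral_mul_le_of_events hG hm hh.δ_pos hh.M_nonneg hK hp.mom hH hHK fun A hA => ?_
    have := hD (fun _ => true) (fun ω => decide (ω ∈ A)) (@measurable_const _ _ _ 𝓕 _) (hflag _ A hA)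
      (Or.inl fun _ => rfl)
    simpa using this

/-- Covariance bound when `U` and `V`, each observed together with an event, are `p`-close to
independence. The truncation level `K` is balanced when `p` is of the order `K ^ (-(2 + δ))`. -/
lemma MomPair.abs_integral_mul_le (hp : MomPair μ F h δ M U V) (hh : DegKernel F h δ M)
    (hF : 𝓕 ≤ m₀) (hG : 𝓖 ≤ m₀) (hH : Measurable[𝓕] H ∨ Measurable[𝓖] H) {K p P : ℝ} (hK : 0 < K)
    (hHK : (∀ ω, |H ω| ≤ K) ∨ ∫⁻ ω, ENNReal.ofReal (|H ω| ^ (2 + δ)) ∂μ ≤ ENNReal.ofReal M)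
    (hp0 : 0 ≤ p) (hpK : p ≤ P * K ^ (-(2 + δ)))
    (hdep : ∀ A B : Ω → Bool, Measurable[𝓕] A → Measurable[𝓖] B →
      DepLE μ (fun ω => (U ω, A ω)) (fun ω => (V ω, B ω)) (ENNReal.ofReal p)) :
    |∫ ω, H ω * h (U ω) (V ω) ∂μ| ≤ (4 * P + 6 * M) * K ^ (-δ) := by
  have h1 := hp.abs_integral_mul_le_of_flags hh hF hG hH hK hHK fun A B hA hB hAB =>
    hp.abs_setIntegral_le hh (hA.mono hF le_rfl) (hB.mono hG le_rfl) hAB hp0 hK (hdep A B hA hB)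
  refine h1.trans ?_
  have e1 : K * K ^ (-(1 + δ)) = K ^ (-δ) := by
    rw [← Real.rpow_one_add' hK.le (by linarith [hh.δ_pos])]; congr 1; ring
  have e2 : K * (K * K ^ (-(2 + δ))) = K ^ (-δ) := by
    rw [← Real.rpow_one_add' hK.le (by linarith [hh.δ_pos]), ← Real.rpow_one_add' hK.le
      (by linarith [hh.δ_pos])]
    congr 1; ring
  have h2 : K * (K * p) ≤ P * K ^ (-δ) := by
    calc K * (K * p) ≤ K * (K * (P * K ^ (-(2 + δ)))) := by gcongr
      _ = P * (K * (K * K ^ (-(2 + δ)))) := by ring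
      _ = _ := by rw [e2]
  calc 2 * (K * (2 * (K * p) + 2 * (K ^ (-(1 + δ)) * M))) + 2 * (K ^ (-δ) * M)
      = 4 * (K * (K * p)) + 4 * ((K * K ^ (-(1 + δ))) * M) + 2 * (K ^ (-δ) * M) := by ring
    _ ≤ 4 * (P * K ^ (-δ)) + 4 * (K ^ (-δ) * M) + 2 * (K ^ (-δ) * M) := by rw [e1]; linarith
    _ = _ := by ring

/-- Covariance bound when only the cell of `U`, in a partition into cells of diameter at most `ε`, is close
to being independent of `V`. The Lipschitz property in mean pays for moving `U` inside its cell. -/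
lemma MomPair.abs_integral_mul_le_of_cells (hp : MomPair μ F h δ M U V) (hh : DegKernel F h δ M)
    (hF : 𝓕 ≤ m₀) (hG : 𝓖 ≤ m₀) (hH : Measurable[𝓕] H ∨ Measurable[𝓖] H) {K p P L ε E : ℝ}
    (hK : 0 < K)
    (hHK : (∀ ω, |H ω| ≤ K) ∨ ∫⁻ ω, ENNReal.ofReal (|H ω| ^ (2 + δ)) ∂μ ≤ ENNReal.ofReal M)
    (hp0 : 0 ≤ p) (hpK : p ≤ P * K ^ (-(2 + δ))) (hε : 0 < ε) (hεK : ε ≤ E * K ^ (-(1 + δ)))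
    (hL0 : 0 ≤ L) (hL : LipOn h F (μ.map fun ω => (U ω, V ω)) L)
    {c : ℝ → ℤ} (hc : Measurable c) (hcε : ∀ x y, c x = c y → |x - y| ≤ ε)
    (hdep : ∀ A B : Ω → Bool, Measurable[𝓕] A → Measurable[𝓖] B →
      DepLE μ (fun ω => (c (U ω), A ω)) (fun ω => (V ω, B ω)) (ENNReal.ofReal p)) :
    |∫ ω, H ω * h (U ω) (V ω) ∂μ| ≤ (2 * L * E + 4 * P + 6 * M) * K ^ (-δ) := by
  have h1 := hp.abs_integral_mul_le_of_flags hh hF hG hH hK hHK fun A B hA hB hAB =>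
    hp.abs_setIntegral_le_of_cells hh (hA.mono hF le_rfl) (hB.mono hG le_rfl) hAB hp0 hK hε hL0 hL
      hc hcε (hdep A B hA hB)
  refine h1.trans ?_
  have e1 : K * K ^ (-(1 + δ)) = K ^ (-δ) := by
    rw [← Real.rpow_one_add' hK.le (by linarith [hh.δ_pos])]; congr 1; ring
  have e2 : K * (K * K ^ (-(2 + δ))) = K ^ (-δ) := by
    rw [← Real.rpow_one_add' hK.le (by linarith [hh.δ_pos]), ← Real.rpow_one_add' hK.le
      (by linarith [hh.δ_pos])]
    congr 1; ring
  have h2 : K * (K * p) ≤ P * K ^ (-δ) := by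
    calc K * (K * p) ≤ K * (K * (P * K ^ (-(2 + δ)))) := by gcongr
      _ = P * (K * (K * K ^ (-(2 + δ)))) := by ring
      _ = _ := by rw [e2]
  have h3 : L * (K * ε) ≤ L * E * K ^ (-δ) := by
    calc L * (K * ε) ≤ L * (K * (E * K ^ (-(1 + δ)))) := by gcongr
      _ = L * E * (K * K ^ (-(1 + δ))) := by ring
      _ = _ := by rw [e1]
  calc 2 * (K * (L * ε + 2 * (K * p) + 2 * (K ^ (-(1 + δ)) * M))) + 2 * (K ^ (-δ) * M)
      = 2 * (L * (K * ε)) + 4 * (K * (K * p)) + 4 * ((K * K ^ (-(1 + δ))) * M)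
        + 2 * (K ^ (-δ) * M) := by ring
    _ ≤ 2 * (L * E * K ^ (-δ)) + 4 * (P * K ^ (-δ)) + 4 * (K ^ (-δ) * M) + 2 * (K ^ (-δ) * M) := by
        rw [e1]; linarith
    _ = _ := by ring

/-- Covariance bound under absolute regularity. -/
lemma MomPair.abs_integral_mul_le_of_beta (hp : MomPair μ F h δ M U V) (hh : DegKernel F h δ M)
    (hF : 𝓕 ≤ m₀) (hG : 𝓖 ≤ m₀) (hU : Measurable[𝓕] U) (hV : Measurable[𝓖] V)
    (hH : Measurable[𝓕] H ∨ Measurable[𝓖] H) {K b : ℝ} (hK : 0 < K)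
    (hHM : ∫⁻ ω, ENNReal.ofReal (|H ω| ^ (2 + δ)) ∂μ ≤ ENNReal.ofReal M)
    (hb0 : 0 ≤ b) (hb : betaBetween 𝓕 𝓖 μ ≤ ENNReal.ofReal b) (hbK : b ≤ K ^ (-(2 + δ))) :
    |∫ ω, H ω * h (U ω) (V ω) ∂μ| ≤ (4 + 6 * M) * K ^ (-δ) := by
  have := hp.abs_integral_mul_le hh hF hG hH hK (Or.inr hHM) hb0 (P := 1) (by rwa [one_mul])
    fun A B hA hB => (depLE_betaBetween hF hG (hU.prodMk hA) (hV.prodMk hB)).mono hb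
  simpa using this

lemma measurable_floor_div (ε θ : ℝ) : Measurable fun x : ℝ => ⌊x / ε + θ⌋ := by fun_prop

lemma abs_sub_le_of_floor_eq {ε θ x y : ℝ} (hε : 0 < ε) (hxy : ⌊x / ε + θ⌋ = ⌊y / ε + θ⌋) :
    |x - y| ≤ ε := by
  have h1 := Int.abs_sub_lt_one_of_floor_eq_floor hxy
  have h2 : x / ε + θ - (y / ε + θ) = (x - y) / ε := by ring
  rw [h2, abs_div, abs_of_pos hε, div_lt_one hε] at h1
  exact h1.le

/-- Covariance bound under strong mixing: the first variable is discretised into cells of size `ε`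
inside `[-T, T]`. -/
lemma MomPair.abs_integral_mul_le_of_alpha (hp : MomPair μ F h δ M U V) (hh : DegKernel F h δ M)
    (hF : 𝓕 ≤ m₀) (hG : 𝓖 ≤ m₀) (hU : Measurable[𝓕] U) (hV : Measurable[𝓖] V)
    (hH : Measurable[𝓕] H ∨ Measurable[𝓖] H) {K a L T G : ℝ} (hK : 1 ≤ K)
    (hHM : ∫⁻ ω, ENNReal.ofReal (|H ω| ^ (2 + δ)) ∂μ ≤ ENNReal.ofReal M)
    (hL0 : 0 ≤ L) (hL : LipOn h F (μ.map fun ω => (U ω, V ω)) L)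
    (ha : ∀ A B, MeasurableSet[𝓕] A → MeasurableSet[𝓖] B →
      |μ.real (A ∩ B) - μ.real A * μ.real B| ≤ a)
    (hT : 1 ≤ T) (hTG : μ.real {ω | T < |U ω|} ≤ G * K ^ (-(2 + δ)))
    (haK : Real.sqrt (T * K ^ (1 + δ)) * a ≤ K ^ (-(2 + δ))) :
    |∫ ω, H ω * h (U ω) (V ω) ∂μ| ≤ (2 * L + 4 * (54 + 2 * G) + 6 * M) * K ^ (-δ) := by
  have hK0 : 0 < K := by linarith
  have hδ := hh.δ_pos
  have ha0 : 0 ≤ a := (abs_nonneg _).trans (ha ∅ ∅ (@MeasurableSet.empty _ 𝓕) (@MeasurableSet.empty _ 𝓖))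
  set ε := K ^ (-(1 + δ)) with hε
  have hε0 : 0 < ε := by positivity
  have hεK : ε * K ^ (1 + δ) = 1 := by rw [hε, ← Real.rpow_add hK0]; simp
  set c : ℝ → ℤ := fun x => ⌊x / ε + 0⌋ with hcd
  have hc : Measurable c := measurable_floor_div ε 0
  set R := T * K ^ (1 + δ) with hR
  have hK1 : 1 ≤ K ^ (1 + δ) := Real.one_le_rpow hK (by linarith)
  have hR1 : 1 ≤ R := by nlinarith
  have hRε : ∀ x, |x| ≤ T → |x / ε| ≤ R := by
    intro x hx
    rw [abs_div, abs_of_pos hε0, div_le_iff₀ hε0, hR, mul_assoc, mul_comm _ ε, hεK]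
    linarith
  set c' : ℝ → ℤ := fun x => if |x| ≤ T then c x else 0 with hc'd
  have hc' : Measurable c' :=
    Measurable.ite (measurableSet_le measurable_id.abs measurable_const) hc measurable_const
  set I : Finset (ℤ × Bool) := (Finset.Icc (⌊-R⌋) (⌊R⌋)) ×ˢ Finset.univ with hI
  have hcI : ∀ x b, (c' x, b) ∈ I := by
    intro x b
    simp only [hI, Finset.mem_product, Finset.mem_Icc, Finset.mem_univ, and_true, hc'd]
    split_ifs with hx
    · have := abs_le.1 (hRε x hx)
      simp only [hcd, add_zero]
      exact ⟨Int.floor_le_floor this.1, Int.floor_le_floor this.2⟩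
    · exact ⟨by rw [← Int.floor_zero (R := ℝ)]; exact Int.floor_le_floor (by linarith),
        Int.floor_nonneg.2 (by linarith)⟩
  have hcard : (I.card : ℝ) ≤ 9 * R := by
    have h1 : (⌊R⌋ + 1 - ⌊-R⌋ : ℤ) ≤ (2 * R + 2 : ℝ) := by
      push_cast
      have := Int.floor_le R
      have := Int.lt_floor_add_one (-R)
      linarith
    have h0 : (0 : ℤ) ≤ ⌊R⌋ + 1 - ⌊-R⌋ := by
      have h2 : ⌊-R⌋ ≤ ⌊R⌋ := Int.floor_le_floor (by linarith)
      omega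
    have h3 : (((⌊R⌋ + 1 - ⌊-R⌋).toNat : ℕ) : ℝ) = ((⌊R⌋ + 1 - ⌊-R⌋ : ℤ) : ℝ) := by
      rw [← Int.cast_natCast, Int.toNat_of_nonneg h0]
    rw [hI, Finset.card_product, Int.card_Icc]
    push_cast
    rw [h3]
    simp only [Finset.card_univ, Fintype.card_bool, Nat.cast_ofNat]
    linarith
  have hsq : Real.sqrt I.card ≤ 3 * Real.sqrt R := by
    calc Real.sqrt I.card ≤ Real.sqrt (9 * R) := Real.sqrt_le_sqrt hcard
      _ = 3 * Real.sqrt R := by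
        rw [Real.sqrt_mul (by norm_num), show (9 : ℝ) = 3 ^ 2 by norm_num, Real.sqrt_sq (by norm_num)]
  set q := μ.real {ω | T < |U ω|} with hq
  have hpK : 18 * Real.sqrt I.card * a + 2 * q ≤ (54 + 2 * G) * K ^ (-(2 + δ)) := by
    have : 18 * Real.sqrt I.card * a ≤ 54 * (Real.sqrt R * a) := by nlinarith
    linarith
  have hU0 : Measurable U := hU.mono hF le_rfl
  have := hp.abs_integral_mul_le_of_cells hh hF hG hH hK0 (Or.inr hHM)
    (by positivity) hpK hε0 (E := 1) (by rw [one_mul]) hL0 hL hc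
    (fun x y => abs_sub_le_of_floor_eq hε0) fun A B hA hB => ?_
  · refine this.trans (le_of_eq (by ring))
  have hA0 : Measurable A := hA.mono hF le_rfl
  have hB0 : Measurable B := hB.mono hG le_rfl
  have h1 := depLE_of_alpha hF hG ha (κ := fun ω => (c' (U ω), A ω)) (fun ω => hcI _ _)
    ((hc'.comp hU).prodMk hA) (hV.prodMk hB)
  have h2 := h1.of_measure_ne_le (U := fun ω => (c (U ω), A ω)) (q := ENNReal.ofReal q)
    ((hc.comp hU0).prodMk hA0) ((hc'.comp hU0).prodMk hA0) (hp.measV.prodMk hB0) (by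
      rw [hq, ofReal_measureReal]
      refine measure_mono fun ω hω => ?_
      rw [Set.mem_ofPred_eq] at hω ⊢
      by_contra hcon
      exact hω (by simp only [hc'd, if_pos (not_lt.1 hcon)]))
  refine h2.mono ?_
  rw [ENNReal.ofReal_add (by positivity) (by positivity), ENNReal.ofReal_mul zero_le_two]
  simp

end CovarianceOfDependence


/-! ### Consequences of stationarity and of the hypotheses on the kernel -/

lemma measurable_of_sigmaOf {Ω ι : Type*} {Y : ι → Ω → ℝ} {S : Set ι} {i : ι} (hi : i ∈ S) :
    Measurable[sigmaOf Y S] (Y i) :=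
  Measurable.mono (comap_measurable (Y i))
    (le_iSup₂ (f := fun i (_ : i ∈ S) => MeasurableSpace.comap (Y i) inferInstance) i hi) le_rfl

lemma sigmaOf_mono {Ω ι : Type*} {Y : ι → Ω → ℝ} {S T : Set ι} (h : S ⊆ T) :
    sigmaOf Y S ≤ sigmaOf Y T :=
  biSup_mono fun _ hi => h hi

section Reductions
variable {Ω : Type*} [MeasurableSpace Ω] {μ : Measure Ω} {X : ℕ → Ω → ℝ} {h : ℝ → ℝ → ℝ}
  {δ τ : ℝ}

lemma StationaryNat.map_eq (hX : StationaryNat μ X) {i : ℕ} (hi : 1 ≤ i) :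
    μ.map (X i) = law μ X := by
  have h1 := ((hX.2 (i - 1)).comp (measurable_pi_apply 0)).map_eq
  have e1 : ((fun f : ℕ → ℝ => f 0) ∘ fun ω (k : ℕ) => X (k + 1 + (i - 1)) ω) = X i := by
    funext ω
    simp only [Function.comp]
    congr 1; omega
  have e2 : ((fun f : ℕ → ℝ => f 0) ∘ fun ω (k : ℕ) => X (k + 1) ω) = X 1 := rfl
  rw [e1, e2] at h1
  exact h1

lemma StationaryNat.map_pair_eq (hX : StationaryNat μ X) {i j : ℕ} (hi : 1 ≤ i) (hij : i ≤ j) :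
    μ.map (fun ω => (X i ω, X j ω)) = pairLaw μ X (j - i + 1) := by
  have h1 := ((hX.2 (i - 1)).comp
    ((measurable_pi_apply 0).prodMk (measurable_pi_apply (j - i)) :
      Measurable fun f : ℕ → ℝ => (f 0, f (j - i)))).map_eq
  have e1 : ((fun f : ℕ → ℝ => (f 0, f (j - i))) ∘ fun ω (k : ℕ) => X (k + 1 + (i - 1)) ω)
      = fun ω => (X i ω, X j ω) := by
    funext ω
    simp only [Function.comp]
    congr 2 <;> omega
  rw [e1] at h1
  exact h1

/-- Stationarity gives every pair `(X i, X j)` with `i < j` the law of `(X 1, X (j - i + 1))`, so one moment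
bound serves all pairs. -/
lemma exists_degKernel_momPair [IsProbabilityMeasure μ] (hX : StationaryNat μ X) (hker : IsKernel h)
    (hdeg : Degenerate μ X h) (hδ : 0 < δ) (hmom : UniformMoments μ X h (2 + δ)) :
    ∃ M, DegKernel (law μ X) h δ M ∧
      ∀ i j, 1 ≤ i → i < j → MomPair μ (law μ X) h δ M (X i) (X j) := by
  obtain ⟨M, hM, hMk⟩ := hmom
  have hle : ENNReal.ofReal M ≤ ENNReal.ofReal (max M 0) := ENNReal.ofReal_le_ofReal (le_max_left _ _)
  refine ⟨max M 0, ⟨hker.1, hker.2, fun x => (hdeg x).2, hδ, le_max_right _ _, hM.trans hle⟩,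
    fun i j hi hij => ⟨hX.1 i hi, hX.1 j (by omega), hX.map_eq hi, hX.map_eq (by omega), ?_⟩⟩
  refine le_trans (le_of_eq ?_) ((hMk (j - i + 1) (by omega)).trans hle)
  have hm : Measurable fun p : ℝ × ℝ => ENNReal.ofReal (|h p.1 p.2| ^ (2 + δ)) := by
    have h2 : Measurable fun p : ℝ × ℝ => h p.1 p.2 := hker.1
    fun_prop
  rw [← hX.map_pair_eq hi hij.le, lintegral_map hm ((hX.1 i hi).prodMk (hX.1 j (by omega)))]

/-- The oscillation of `h` over the open disc around `p` of radius `ε`. Over open discs it is lower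
semicontinuous in `p`, hence measurable, whatever the kernel. -/
noncomputable def openOsc (h : ℝ → ℝ → ℝ) (ε : ℝ) (p : ℝ × ℝ) : ℝ≥0∞ :=
  ⨆ (q : ℝ × ℝ) (q' : ℝ × ℝ) (_ : (q.1 - p.1) ^ 2 + (q.2 - p.2) ^ 2 < ε ^ 2)
    (_ : (q'.1 - p.1) ^ 2 + (q'.2 - p.2) ^ 2 < ε ^ 2), ENNReal.ofReal |h q.1 q.2 - h q'.1 q'.2|

lemma measurable_openOsc (h : ℝ → ℝ → ℝ) (ε : ℝ) : Measurable (openOsc h ε) := by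
  refine measurable_of_Ioi fun a => IsOpen.measurableSet ?_
  have : openOsc h ε ⁻¹' Set.Ioi a = ⋃ (q : ℝ × ℝ) (q' : ℝ × ℝ)
      (_ : a < ENNReal.ofReal |h q.1 q.2 - h q'.1 q'.2|),
      {p | (q.1 - p.1) ^ 2 + (q.2 - p.2) ^ 2 < ε ^ 2} ∩
      {p | (q'.1 - p.1) ^ 2 + (q'.2 - p.2) ^ 2 < ε ^ 2} := by
    ext p
    simp only [openOsc, Set.mem_preimage, Set.mem_Ioi, lt_iSup_iff, Set.mem_iUnion, Set.mem_inter_iff,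
      Set.mem_ofPred_eq]
    constructor
    · rintro ⟨q, q', h1, h2, h3⟩; exact ⟨q, q', h3, h1, h2⟩
    · rintro ⟨q, q', h3, h1, h2⟩; exact ⟨q, q', h1, h2, h3⟩
  rw [this]
  refine isOpen_iUnion fun q => isOpen_iUnion fun q' => isOpen_iUnion fun _ => IsOpen.inter ?_ ?_
  · exact isOpen_lt (by fun_prop) continuous_const
  · exact isOpen_lt (by fun_prop) continuous_const

lemma openOsc_le (h : ℝ → ℝ → ℝ) {ε : ℝ} (hε : 0 < ε) (p : ℝ × ℝ) : openOsc h ε p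
    ≤ ⨆ (q ∈ disc p ε) (q' ∈ disc p ε), ENNReal.ofReal |h q.1 q.2 - h q'.1 q'.2| := by
  have hd : ∀ q : ℝ × ℝ, (q.1 - p.1) ^ 2 + (q.2 - p.2) ^ 2 < ε ^ 2 → q ∈ disc p ε := by
    intro q hq
    exact Real.sqrt_le_iff.2 ⟨hε.le, hq.le⟩
  refine iSup_le fun q => iSup_le fun q' => iSup_le fun h1 => iSup_le fun h2 => ?_
  exact le_iSup₂_of_le q (hd q h1) (le_iSup₂_of_le q' (hd q' h2) le_rfl)

/-- Either regularity condition gives the Lipschitz property in mean from every law of pairs occurring in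
the sequence to the product law. Under the variation condition only the law of the second pair
matters, since both points of the kernel lie in a disc around it. -/
lemma exists_lipOn [IsProbabilityMeasure μ] (hlip : PLipschitz μ X h ∨ VariationCondition μ X h) :
    ∃ L, 0 ≤ L ∧ LipOn h (law μ X) ((law μ X).prod (law μ X)) L ∧
      ∀ k, 1 ≤ k → LipOn h (law μ X) (pairLaw μ X k) L := by
  rcases hlip with ⟨L, hL, hLip⟩ | ⟨L, hV⟩
  · refine ⟨L, hL.le, fun ε hε ρ hρ h1 h2 => ?_, fun k hk ε hε ρ hρ h1 h2 => ?_⟩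
    · exact hLip ε hε ρ hρ (Or.inl h1) (Or.inl h2)
    · exact hLip ε hε ρ hρ (Or.inr ⟨k, hk, h1⟩) (Or.inl h2)
  · have key : ∀ π, LipOn h (law μ X) π (2 * max L 0) := by
      intro π ε hε ρ hρ _ h2
      calc ∫⁻ t, Set.indicator {t : ℝ × ℝ × ℝ | |t.1 - t.2.1| ≤ ε}
            (fun t => ENNReal.ofReal |h t.1 t.2.2 - h t.2.1 t.2.2|) t ∂ρ
          ≤ ∫⁻ t, openOsc h (2 * ε) (t.2.1, t.2.2) ∂ρ := by
            refine lintegral_mono fun t => ?_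
            refine Set.indicator_apply_le' (fun ht => ?_) fun _ => zero_le
            rw [Set.mem_ofPred_eq] at ht
            have hsq := sq_le_sq' (by linarith [(abs_le.1 ht).1]) (abs_le.1 ht).2
            refine le_iSup₂_of_le (t.1, t.2.2) (t.2.1, t.2.2) (le_iSup₂_of_le ?_ ?_ le_rfl)
            · simp only; nlinarith
            · have : 0 < (2 * ε) ^ 2 := by positivity
              simpa using this
        _ = ∫⁻ p, openOsc h (2 * ε) p ∂((law μ X).prod (law μ X)) := by
            rw [← h2, lintegral_map (measurable_openOsc h _) (by fun_prop)]
        _ ≤ _ := lintegral_mono fun p => openOsc_le h (by positivity) p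
        _ ≤ ENNReal.ofReal (L * (2 * ε)) := hV (2 * ε) (by positivity)
        _ ≤ _ := ENNReal.ofReal_le_ofReal (by nlinarith [le_max_left L 0])
    exact ⟨2 * max L 0, by positivity, key _, fun k _ => key _⟩

lemma sigmaOf_le {ι : Type*} {Y : ι → Ω → ℝ} {S : Set ι} (h : ∀ i ∈ S, Measurable (Y i)) :
    sigmaOf Y S ≤ ‹MeasurableSpace Ω› :=
  iSup₂_le fun i hi => (h i hi).comap_le

/-! ### Elementary properties of the mixing coefficients -/

section Coefficients
variable [IsProbabilityMeasure μ]

lemma bddAbove_alphaCoeff (X : ℕ → Ω → ℝ) (k : ℕ) :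
    (1 : ℝ) ∈ upperBounds {r : ℝ | ∃ n : ℕ, 1 ≤ n ∧ ∃ A B : Set Ω,
    MeasurableSet[sigmaOf X (Set.Icc 1 n)] A ∧ MeasurableSet[sigmaOf X (Set.Ici (n + k))] B ∧
    r = |μ.real (A ∩ B) - μ.real A * μ.real B|} := by
  rintro r ⟨n, _, A, B, _, _, rfl⟩
  have h1 : μ.real (A ∩ B) ≤ 1 := measureReal_le_one
  have h2 : μ.real A ≤ 1 := measureReal_le_one
  have h3 : μ.real B ≤ 1 := measureReal_le_one
  have h4 : 0 ≤ μ.real (A ∩ B) := measureReal_nonneg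
  have h5 : 0 ≤ μ.real A := measureReal_nonneg
  have h6 : 0 ≤ μ.real B := measureReal_nonneg
  rw [abs_le]
  constructor <;> nlinarith

lemma le_alphaCoeff {n k : ℕ} (hn : 1 ≤ n) {A B : Set Ω}
    (hA : MeasurableSet[sigmaOf X (Set.Icc 1 n)] A)
    (hB : MeasurableSet[sigmaOf X (Set.Ici (n + k))] B) :
    |μ.real (A ∩ B) - μ.real A * μ.real B| ≤ alphaCoeff μ X k :=
  le_csSup ⟨1, bddAbove_alphaCoeff X k⟩ ⟨n, hn, A, B, hA, hB, rfl⟩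

lemma alphaCoeff_nonneg (k : ℕ) : 0 ≤ alphaCoeff μ X k :=
  (abs_nonneg _).trans (le_alphaCoeff (n := 1) le_rfl (@MeasurableSet.empty _ (sigmaOf X _))
    (@MeasurableSet.empty _ (sigmaOf X _)))

lemma alphaCoeff_le_one (k : ℕ) : alphaCoeff μ X k ≤ 1 :=
  csSup_le ⟨_, 1, le_rfl, ∅, ∅, @MeasurableSet.empty _ (sigmaOf X _),
    @MeasurableSet.empty _ (sigmaOf X _), rfl⟩ (bddAbove_alphaCoeff X k)

lemma betaBetween_le_betaCoeffNat {n : ℕ} (hn : 1 ≤ n) (k : ℕ) :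
    betaBetween (sigmaOf X (Set.Icc 1 n)) (sigmaOf X (Set.Ici (n + k))) μ
      ≤ ENNReal.ofReal (betaCoeffNat μ X k) := by
  unfold betaCoeffNat
  rw [ENNReal.ofReal_toReal]
  · exact le_iSup₂ (f := fun (n : ℕ) (_ : 1 ≤ n) =>
      betaBetween (sigmaOf X (Set.Icc 1 n)) (sigmaOf X (Set.Ici (n + k))) μ) n hn
  · exact ((iSup₂_le fun n _ => betaBetween_le_two).trans_lt ENNReal.ofNat_lt_top).ne

lemma betaBetween_le_betaCoeffInt {Z : ℤ → Ω → ℝ} {n : ℕ} (hn : 1 ≤ n) (k : ℕ) :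
    betaBetween (sigmaOf Z (Set.Iic (n : ℤ))) (sigmaOf Z (Set.Ici ((n : ℤ) + k))) μ
      ≤ ENNReal.ofReal (betaCoeffInt μ Z k) := by
  unfold betaCoeffInt
  rw [ENNReal.ofReal_toReal]
  · exact le_iSup₂ (f := fun (n : ℕ) (_ : 1 ≤ n) =>
      betaBetween (sigmaOf Z (Set.Iic (n : ℤ))) (sigmaOf Z (Set.Ici ((n : ℤ) + k))) μ) n hn
  · exact ((iSup₂_le fun n _ => betaBetween_le_two).trans_lt ENNReal.ofNat_lt_top).ne

lemma betaCoeffInt_le_two {Z : ℤ → Ω → ℝ} (k : ℕ) : betaCoeffInt μ Z k ≤ 2 := by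
  unfold betaCoeffInt
  exact ENNReal.toReal_le_of_le_ofReal zero_le_two (by
    simpa using iSup₂_le fun n _ => betaBetween_le_two)

lemma betaCoeffInt_antitone {Z : ℤ → Ω → ℝ} : Antitone (betaCoeffInt μ Z) := by
  intro k l hkl
  refine ENNReal.toReal_mono ?_ ?_
  · exact ((iSup₂_le fun n _ => betaBetween_le_two).trans_lt ENNReal.ofNat_lt_top).ne
  · refine iSup₂_mono fun n _ => betaBetween_mono_right (sigmaOf_mono ?_)
    exact Set.Ici_subset_Ici.2 (by gcongr)

end Coefficients

/-- A weighted growth condition `∑ k * w k = O(n ^ τ)` survives adding a geometric sequence and the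
passage to the weights `k + 1`. -/
lemma exists_sum_le_of_isBigO {w ψ : ℕ → ℝ} (hτ : 0 ≤ τ) (hw : ∀ m, 0 ≤ w m)
    (hO : (fun n : ℕ => ∑ k ∈ Finset.range (n + 1), (k : ℝ) * w k) =O[atTop]
      (fun n : ℕ => (n : ℝ) ^ τ)) {c r : ℝ} (hc : 0 ≤ c) (hr0 : 0 ≤ r) (hr : r < 1)
    (hψ : ∀ m, ψ m ≤ c * (w m + r ^ m)) :
    ∃ C, 0 ≤ C ∧ ∀ N : ℕ, 1 ≤ N →
      ∑ m ∈ Finset.range N, ((m : ℝ) + 1) * ψ m ≤ C * (N : ℝ) ^ τ := by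
  obtain ⟨C₀, hC₀, hb⟩ := bound_of_isBigO_nat_atTop hO
  have hs : Summable fun m : ℕ => ((m : ℝ) + 1) * r ^ m := by
    have h1 := summable_pow_mul_geometric_of_norm_lt_one 1 (r := r)
      (by rwa [Real.norm_of_nonneg hr0])
    have h2 := summable_geometric_of_lt_one hr0 hr
    refine (h1.add h2).congr fun m => ?_
    ring
  set G := ∑' m : ℕ, ((m : ℝ) + 1) * r ^ m with hG
  have hG0 : 0 ≤ G := tsum_nonneg fun m => by positivity
  refine ⟨c * (w 0 + 2 * C₀ + G), by have := hw 0; positivity, fun N hN => ?_⟩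
  have hNτ : (1 : ℝ) ≤ (N : ℝ) ^ τ := Real.one_le_rpow (by exact_mod_cast hN) hτ
  have h1 : ∑ m ∈ Finset.range N, ((m : ℝ) + 1) * r ^ m ≤ G :=
    hs.sum_le_tsum _ fun m _ => by positivity
  have h2 : ∑ m ∈ Finset.range N, (m : ℝ) * w m ≤ C₀ * (N : ℝ) ^ τ := by
    have h3 := hb (x := N) (by positivity)
    rw [Real.norm_of_nonneg (Finset.sum_nonneg fun k _ => mul_nonneg (by positivity) (hw k)),
      Real.norm_of_nonneg (by positivity : 0 ≤ (N : ℝ) ^ τ)] at h3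
    refine le_trans (Finset.sum_le_sum_of_subset_of_nonneg (Finset.range_mono (by omega))
      fun k _ _ => mul_nonneg (by positivity) (hw k)) h3
  have h3 : ∑ m ∈ Finset.range N, ((m : ℝ) + 1) * w m
      ≤ w 0 + 2 * ∑ m ∈ Finset.range N, (m : ℝ) * w m := by
    have h4 : ∀ m ∈ Finset.range N, ((m : ℝ) + 1) * w m
        ≤ (if m = 0 then w 0 else 0) + 2 * ((m : ℝ) * w m) := by
      intro m _
      rcases Nat.eq_zero_or_pos m with rfl | hm
      · simp
      · have : (1 : ℝ) ≤ m := by exact_mod_cast hm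
        rw [if_neg hm.ne']
        nlinarith [hw m]
    refine (Finset.sum_le_sum h4).trans ?_
    rw [Finset.sum_add_distrib, ← Finset.mul_sum, Finset.sum_ite_eq' (Finset.range N) 0 fun _ => w 0]
    gcongr
    split_ifs <;> simp [hw]
  calc ∑ m ∈ Finset.range N, ((m : ℝ) + 1) * ψ m
      ≤ ∑ m ∈ Finset.range N, ((m : ℝ) + 1) * (c * (w m + r ^ m)) := by
        gcongr with m _; exact hψ m
    _ = c * (∑ m ∈ Finset.range N, ((m : ℝ) + 1) * w m
          + ∑ m ∈ Finset.range N, ((m : ℝ) + 1) * r ^ m) := by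
        rw [← Finset.sum_add_distrib, Finset.mul_sum]
        exact Finset.sum_congr rfl fun m _ => by ring
    _ ≤ c * (w 0 + 2 * (C₀ * (N : ℝ) ^ τ) + G) := by
        gcongr
        exact h3.trans (by linarith)
    _ ≤ c * ((w 0 + 2 * C₀ + G) * (N : ℝ) ^ τ) := by
        have := hw 0
        gcongr
        nlinarith
    _ = _ := by ring

end Reductions


/-! ### Absolutely regular and strongly mixing processes -/

section MixingCases
variable {Ω : Type*} [MeasurableSpace Ω] {μ : Measure Ω} [IsProbabilityMeasure μ]
  {X : ℕ → Ω → ℝ} {h : ℝ → ℝ → ℝ} {δ τ M : ℝ}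

/-- Mixing rates are replaced by their maxima with `2 ^ (-m)`: the rate becomes positive, so that negative
powers of it can serve as truncation levels, at the price of a geometric sequence. -/
lemma max_half_pow_rpow_le {b e : ℝ} (hb : 0 ≤ b) (m : ℕ) :
    (max b ((1 / 2) ^ m)) ^ e ≤ b ^ e + ((1 / 2 : ℝ) ^ e) ^ m := by
  have h1 : ((1 / 2 : ℝ) ^ m) ^ e = ((1 / 2 : ℝ) ^ e) ^ m := by
    rw [← Real.rpow_natCast, ← Real.rpow_mul (by norm_num), mul_comm, Real.rpow_mul (by norm_num),
      Real.rpow_natCast]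
  have h2 : 0 ≤ b ^ e := by positivity
  have h3 : 0 ≤ ((1 / 2 : ℝ) ^ e) ^ m := by positivity
  rcases max_choice b ((1 / 2 : ℝ) ^ m) with h | h <;> rw [h]
  · linarith
  · rw [h1]; linarith

lemma half_rpow_lt_one {e : ℝ} (he : 0 < e) : (1 / 2 : ℝ) ^ e < 1 :=
  Real.rpow_lt_one (by norm_num) (by norm_num) he

/-- It suffices to bound the covariance of `h (X i) (X j)` and a term depending only on the past
`1, …, n` or only on the future `n + m, …`, for `i ≤ n` and `n + m ≤ j`. -/
lemma maxSqBound_of_past_future (hh : DegKernel (law μ X) h δ M)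
    (hp : ∀ i j, 1 ≤ i → i < j → MomPair μ (law μ X) h δ M (X i) (X j))
    {ψ : ℕ → ℝ} {C : ℝ} (hψ : ∀ m, 0 ≤ ψ m)
    (hcov : ∀ n m i j p q, 1 ≤ i → i ≤ n → n + m ≤ j → i < j → 1 ≤ p → p < q →
      (q ≤ n ∨ n + m ≤ p) →
      |∫ ω, h (X p ω) (X q ω) * h (X i ω) (X j ω) ∂μ| ≤ ψ m) (hC : 0 ≤ C)
    (hsum : ∀ N : ℕ, 1 ≤ N → ∑ m ∈ Finset.range N, ((m : ℝ) + 1) * ψ m ≤ C * (N : ℝ) ^ τ) :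
    MaxSqBound μ (fun n ω => ∑ i ∈ Finset.Icc 1 n, ∑ j ∈ Finset.Ioc i n, h (X i ω) (X j ω)) τ := by
  refine maxSqBound_of_cov (Y := fun i j ω => h (X i ω) (X j ω)) hψ ?_ ?_ ?_ hC hsum
  · intro p q i j hp1 hpq hi hij
    have h1 := hp p q hp1 hpq
    have h2 := hp i j hi hij
    exact integrable_mul_of_mom (hh.meas.comp (h1.measU.prodMk h1.measV))
      (hh.meas.comp (h2.measU.prodMk h2.measV)) hh.δ_pos h1.mom h2.mom
  · intro p q i j m hp1 hpq hij hmq hmi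
    have := hcov p m p q i j hp1 le_rfl hmq hpq (by omega) hij (Or.inr hmi)
    simpa only [mul_comm] using this
  · intro p q i j m hp1 hi hpq hij hmi hmq
    exact hcov (max i q) m i j p q hi (le_max_left _ _) (by omega) hij hp1 hpq
      (Or.inl (le_max_right _ _))

/-- The truncation level at gap `m` is `K` with `K ^ (-(2 + δ)) = η m`, where `η m` is the regularised
coefficient `β(m)`; the covariances are then of order `K ^ (-δ) = η m ^ (δ / (2 + δ))`. -/
lemma maxSqBound_of_condAbsRegular (hX : StationaryNat μ X) (hh : DegKernel (law μ X) h δ M)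
    (hp : ∀ i j, 1 ≤ i → i < j → MomPair μ (law μ X) h δ M (X i) (X j)) (hτ : 0 ≤ τ)
    (hc : CondAbsRegular μ X δ τ) :
    MaxSqBound μ (fun n ω => ∑ i ∈ Finset.Icc 1 n, ∑ j ∈ Finset.Ioc i n, h (X i ω) (X j ω)) τ := by
  have hδ := hh.δ_pos
  have hM := hh.M_nonneg
  have hβ : ∀ m, 0 ≤ betaCoeffNat μ X m := fun m => ENNReal.toReal_nonneg
  set e := δ / (2 + δ) with he
  have he0 : 0 < e := by positivity
  set η : ℕ → ℝ := fun m => max (betaCoeffNat μ X m) ((1 / 2) ^ m) with hη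
  have hη0 : ∀ m, 0 < η m := fun m => lt_max_of_lt_right (by positivity)
  have hψ : ∀ m, (4 + 6 * M) * η m ^ e
      ≤ (4 + 6 * M) * (betaCoeffNat μ X m ^ e + ((1 / 2 : ℝ) ^ e) ^ m) := fun m => by
    gcongr
    exact max_half_pow_rpow_le (hβ m) m
  obtain ⟨C, hC, hsum⟩ := exists_sum_le_of_isBigO hτ (fun m => Real.rpow_nonneg (hβ m) e) hc.2
    (by positivity) (by positivity) (half_rpow_lt_one he0) hψ
  refine maxSqBound_of_past_future hh hp (fun m => by have := hη0 m; positivity) ?_ hC hsum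
  intro n m i j p q hi hin hnj hij hp1 hpq hcase
  have hF : sigmaOf X (Set.Icc 1 n) ≤ ‹MeasurableSpace Ω› := sigmaOf_le fun k hk => hX.1 k hk.1
  have hG : sigmaOf X (Set.Ici (n + m)) ≤ ‹MeasurableSpace Ω› :=
    sigmaOf_le fun k hk => hX.1 k (by rw [Set.mem_Ici] at hk; omega)
  have hHmeas : Measurable[sigmaOf X (Set.Icc 1 n)] (fun ω => h (X p ω) (X q ω)) ∨
      Measurable[sigmaOf X (Set.Ici (n + m))] (fun ω => h (X p ω) (X q ω)) := by
    rcases hcase with h1 | h1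
    · exact Or.inl (hh.meas.comp ((measurable_of_sigmaOf (Set.mem_Icc.2 ⟨hp1, by omega⟩)).prodMk
        (measurable_of_sigmaOf (Set.mem_Icc.2 ⟨by omega, h1⟩))))
    · exact Or.inr (hh.meas.comp ((measurable_of_sigmaOf (Set.mem_Ici.2 h1)).prodMk
        (measurable_of_sigmaOf (Set.mem_Ici.2 (by omega)))))
  have hK : (η m ^ (-(1 / (2 + δ)))) ^ (-δ) = η m ^ e := by
    rw [← Real.rpow_mul (hη0 m).le]; congr 1; rw [he]; ring
  have hKp : (η m ^ (-(1 / (2 + δ)))) ^ (-(2 + δ)) = η m := by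
    rw [← Real.rpow_mul (hη0 m).le]
    have : -(1 / (2 + δ)) * -(2 + δ) = 1 := by field_simp
    rw [this, Real.rpow_one]
  rw [← hK]
  exact (hp i j hi hij).abs_integral_mul_le_of_beta hh hF hG (measurable_of_sigmaOf ⟨hi, hin⟩)
    (measurable_of_sigmaOf hnj) hHmeas (Real.rpow_pos_of_pos (hη0 m) _) (hp p q hp1 hpq).mom (hβ m)
    (betaBetween_le_betaCoeffNat (by omega) m) (by rw [hKp]; exact le_max_left _ _)

lemma measureReal_lt_abs_le {U : Ω → ℝ} {γ T : ℝ} (hγ : 0 < γ) (hT : 0 < T)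
    (hi : Integrable (fun ω => |U ω| ^ γ) μ) :
    μ.real {ω | T < |U ω|} ≤ (∫ ω, |U ω| ^ γ ∂μ) * T ^ (-γ) := by
  have h1 := mul_meas_ge_le_integral_of_nonneg (Eventually.of_forall fun ω => by positivity) hi (T ^ γ)
  have h2 : μ.real {ω | T < |U ω|} ≤ μ.real {ω | T ^ γ ≤ |U ω| ^ γ} := by
    refine measureReal_mono fun ω hω => ?_
    rw [Set.mem_ofPred_eq] at hω ⊢
    exact Real.rpow_le_rpow hT.le hω.le hγ.le
  rw [Real.rpow_neg hT.le, ← div_eq_mul_inv, le_div_iff₀ (by positivity), mul_comm]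
  exact le_trans (by gcongr) h1

/-- With `e` the exponent in the hypothesis and `η m` the regularised coefficient `α(m)`, the truncation
level at gap `m` is `K = η m ^ (-e / δ)`, so the covariances are of order `K ^ (-δ) = η m ^ e`. Cells
have size `K ^ (-(1 + δ))` and cover `[-T, T]` with `T = K ^ ((2 + δ) / γ)`, which leaves out
probability of order `K ^ (-(2 + δ))`. There are about `T * K ^ (1 + δ)` cells, and `e` is the exponent for
which `√(T * K ^ (1 + δ)) * η m` equals `K ^ (-(2 + δ))`. -/
lemma maxSqBound_of_condStrongMixing (hX : StationaryNat μ X) (hh : DegKernel (law μ X) h δ M)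
    (hp : ∀ i j, 1 ≤ i → i < j → MomPair μ (law μ X) h δ M (X i) (X j)) (hτ : 0 ≤ τ)
    (hc : CondStrongMixing μ X h δ τ) :
    MaxSqBound μ (fun n ω => ∑ i ∈ Finset.Icc 1 n, ∑ j ∈ Finset.Ioc i n, h (X i ω) (X j ω)) τ := by
  have hδ := hh.δ_pos
  have hM := hh.M_nonneg
  obtain ⟨-, hlip, γ, hγ, hXγ, hO⟩ := hc
  obtain ⟨L, hL0, -, hL⟩ := exists_lipOn hlip
  set G := ∫ ω, |X 1 ω| ^ γ ∂μ with hGd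
  have hα : ∀ m, 0 ≤ alphaCoeff μ X m := alphaCoeff_nonneg
  set e := 2 * γ * δ / (3 * γ * δ + δ + 5 * γ + 2) with he
  have he0 : 0 < e := by positivity
  set η : ℕ → ℝ := fun m => max (alphaCoeff μ X m) ((1 / 2) ^ m) with hη
  have hη0 : ∀ m, 0 < η m := fun m => lt_max_of_lt_right (by positivity)
  have hη1 : ∀ m, η m ≤ 1 := fun m =>
    max_le (alphaCoeff_le_one m) (pow_le_one₀ (by norm_num) (by norm_num))
  have hG0 : 0 ≤ G := integral_nonneg fun ω => by positivity
  set c := 2 * L + 4 * (54 + 2 * G) + 6 * M with hcd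
  have hc0 : 0 ≤ c := by positivity
  have hψ : ∀ m, c * η m ^ e ≤ c * (alphaCoeff μ X m ^ e + ((1 / 2 : ℝ) ^ e) ^ m) := fun m => by
    gcongr
    exact max_half_pow_rpow_le (hα m) m
  obtain ⟨C, hC, hsum⟩ := exists_sum_le_of_isBigO hτ (fun m => Real.rpow_nonneg (hα m) e) hO
    hc0 (by positivity) (half_rpow_lt_one he0) hψ
  refine maxSqBound_of_past_future hh hp (fun m => by have := hη0 m; positivity) ?_ hC hsum
  intro n m i j p q hi hin hnj hij hp1 hpq hcase
  have hF : sigmaOf X (Set.Icc 1 n) ≤ ‹MeasurableSpace Ω› := sigmaOf_le fun k hk => hX.1 k hk.1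
  have hG : sigmaOf X (Set.Ici (n + m)) ≤ ‹MeasurableSpace Ω› :=
    sigmaOf_le fun k hk => hX.1 k (by rw [Set.mem_Ici] at hk; omega)
  have hHmeas : Measurable[sigmaOf X (Set.Icc 1 n)] (fun ω => h (X p ω) (X q ω)) ∨
      Measurable[sigmaOf X (Set.Ici (n + m))] (fun ω => h (X p ω) (X q ω)) := by
    rcases hcase with h1 | h1
    · exact Or.inl (hh.meas.comp ((measurable_of_sigmaOf (Set.mem_Icc.2 ⟨hp1, by omega⟩)).prodMk
        (measurable_of_sigmaOf (Set.mem_Icc.2 ⟨by omega, h1⟩))))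
    · exact Or.inr (hh.meas.comp ((measurable_of_sigmaOf (Set.mem_Ici.2 h1)).prodMk
        (measurable_of_sigmaOf (Set.mem_Ici.2 (by omega)))))
  set K := η m ^ (-(e / δ)) with hKd
  have hK0 : 0 < K := Real.rpow_pos_of_pos (hη0 m) _
  have hK1 : 1 ≤ K := Real.one_le_rpow_of_pos_of_le_one_of_nonpos (hη0 m) (hη1 m)
    (by have : 0 < e / δ := by positivity
        linarith)
  have hK : K ^ (-δ) = η m ^ e := by
    rw [hKd, ← Real.rpow_mul (hη0 m).le]; congr 1; field_simp
  have hKη : K ^ (-(δ / e)) = η m := by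
    rw [hKd, ← Real.rpow_mul (hη0 m).le]
    have : -(e / δ) * -(δ / e) = 1 := by field_simp
    rw [this, Real.rpow_one]
  set T := K ^ ((2 + δ) / γ) with hT
  have hT1 : 1 ≤ T := Real.one_le_rpow hK1 (by positivity)
  have hTγ : T ^ (-γ) = K ^ (-(2 + δ)) := by
    rw [hT, ← Real.rpow_mul hK0.le]; congr 1; field_simp
  have hint : Integrable (fun ω => |X i ω| ^ γ) μ ∧ ∫ ω, |X i ω| ^ γ ∂μ = G := by
    have hm : Measurable fun x : ℝ => |x| ^ γ := by fun_prop
    have h1 : Integrable (fun x : ℝ => |x| ^ γ) (law μ X) :=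
      (integrable_map_measure hm.aestronglyMeasurable (hX.1 1 le_rfl).aemeasurable).2 hXγ
    constructor
    · rw [← hX.map_eq hi] at h1
      exact (integrable_map_measure hm.aestronglyMeasurable (hX.1 i hi).aemeasurable).1 h1
    · rw [hGd, ← integral_map (f := fun x : ℝ => |x| ^ γ) (hX.1 i hi).aemeasurable hm.aestronglyMeasurable,
        hX.map_eq hi, law, integral_map (hX.1 1 le_rfl).aemeasurable hm.aestronglyMeasurable]
  rw [← hK]
  refine (hp i j hi hij).abs_integral_mul_le_of_alpha hh hF hG (measurable_of_sigmaOf ⟨hi, hin⟩)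
    (measurable_of_sigmaOf hnj) hHmeas hK1 (hp p q hp1 hpq).mom hL0 ?_
    (fun A B hA hB => le_alphaCoeff (by omega) hA hB) hT1 ?_ ?_
  · rw [hX.map_pair_eq hi hij.le]; exact hL _ (by omega)
  · have := measureReal_lt_abs_le hγ (by linarith) hint.1 (T := T)
    rwa [hint.2, hTγ] at this
  · calc Real.sqrt (T * K ^ (1 + δ)) * alphaCoeff μ X m
        ≤ Real.sqrt (T * K ^ (1 + δ)) * η m := by gcongr; exact le_max_left _ _
      _ = K ^ (-(2 + δ)) := by
        rw [hT, ← Real.rpow_add hK0, Real.sqrt_eq_rpow, ← Real.rpow_mul hK0.le, ← hKη,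
          ← Real.rpow_add hK0]
        congr 1
        rw [he]
        field_simp
        ring

end MixingCases


/-! ### Randomly shifted grids -/

section RandomGrid

lemma intervalIntegrable_floor_add (x a b : ℝ) :
    IntervalIntegrable (fun θ : ℝ => (⌊x + θ⌋ : ℝ)) volume a b := by
  refine MonotoneOn.intervalIntegrable fun s _ t _ hst => ?_
  exact_mod_cast Int.floor_le_floor (by linarith)

lemma integral_floor_add (x : ℝ) : ∫ θ in (0 : ℝ)..1, (⌊x + θ⌋ : ℝ) = x := by
  have hper : Function.Periodic (fun y : ℝ => Int.fract y) 1 := fun y => by simp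
  have hfr : ∫ θ in (0 : ℝ)..1, Int.fract (x + θ) = 1 / 2 := by
    rw [intervalIntegral.integral_comp_add_left (fun y => Int.fract y) x]
    have h1 := hper.intervalIntegral_add_eq x 0
    rw [add_zero, h1, zero_add]
    have h2 : ∫ θ in (0 : ℝ)..1, Int.fract θ = ∫ θ in (0 : ℝ)..1, θ := by
      refine intervalIntegral.integral_congr_ae ?_
      have : ∀ᵐ θ : ℝ, θ ≠ 1 := by simp [ae_iff]
      filter_upwards [this] with θ h1 hθ
      rw [Set.uIoc_of_le zero_le_one] at hθ
      exact Int.fract_eq_self.2 ⟨hθ.1.le, lt_of_le_of_ne hθ.2 h1⟩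
    rw [h2, integral_id]; norm_num
  have h3 : ∀ θ : ℝ, Int.fract (x + θ) = (x + θ) - ⌊x + θ⌋ := fun θ => rfl
  simp only [h3] at hfr
  rw [intervalIntegral.integral_sub
    (Continuous.intervalIntegrable (by fun_prop) _ _) (intervalIntegrable_floor_add x 0 1)] at hfr
  rw [intervalIntegral.integral_add (by simp) (by simp)] at hfr
  simp at hfr
  linarith

/-- A random grid of mesh one separates `a` and `b` with probability at most `|a - b|`. -/
lemma lintegral_floor_ne_le (a b : ℝ) :
    ∫⁻ θ in Set.Ioc (0 : ℝ) 1, Set.indicator {θ : ℝ | ⌊a + θ⌋ ≠ ⌊b + θ⌋} 1 θ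
      ≤ ENNReal.ofReal |a - b| := by
  wlog hab : a ≤ b generalizing a b
  · have := this b a (le_of_not_ge hab)
    rw [abs_sub_comm]
    simpa only [ne_comm] using this
  have hi : IntervalIntegrable (fun θ : ℝ => (⌊b + θ⌋ : ℝ) - ⌊a + θ⌋) volume 0 1 :=
    (intervalIntegrable_floor_add b 0 1).sub (intervalIntegrable_floor_add a 0 1)
  have hmono : ∀ θ, ⌊a + θ⌋ ≤ ⌊b + θ⌋ := fun θ => Int.floor_le_floor (by linarith)
  calc ∫⁻ θ in Set.Ioc (0 : ℝ) 1, Set.indicator {θ : ℝ | ⌊a + θ⌋ ≠ ⌊b + θ⌋} 1 θ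
      ≤ ∫⁻ θ in Set.Ioc (0 : ℝ) 1, ENNReal.ofReal ((⌊b + θ⌋ : ℝ) - ⌊a + θ⌋) := by
        refine lintegral_mono fun θ => Set.indicator_apply_le' (fun hθ => ?_) fun _ => zero_le
        rw [Set.mem_ofPred_eq] at hθ
        have h1 : ⌊a + θ⌋ + 1 ≤ ⌊b + θ⌋ := lt_of_le_of_ne (hmono θ) hθ
        have h2 : (⌊a + θ⌋ : ℝ) + 1 ≤ ⌊b + θ⌋ := by exact_mod_cast h1
        rw [Pi.one_apply, ← ENNReal.ofReal_one]
        exact ENNReal.ofReal_le_ofReal (by linarith)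
    _ = ENNReal.ofReal (∫ θ in (0 : ℝ)..1, ((⌊b + θ⌋ : ℝ) - ⌊a + θ⌋)) := by
        rw [intervalIntegral.integral_of_le zero_le_one, ofReal_integral_eq_lintegral_ofReal
          ((intervalIntegrable_iff_integrableOn_Ioc_of_le zero_le_one).1 hi)]
        exact Eventually.of_forall fun θ => sub_nonneg.2 (by exact_mod_cast hmono θ)
    _ = ENNReal.ofReal |a - b| := by
        rw [intervalIntegral.integral_sub (intervalIntegrable_floor_add b 0 1)
          (intervalIntegrable_floor_add a 0 1), integral_floor_add, integral_floor_add,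
          abs_of_nonpos (by linarith)]
        congr 1; ring

/-- Some shift of the grid of mesh `ε` separates two variables with probability at most their
`L¹`-distance divided by `ε`. -/
lemma exists_shift_measure_floor_ne_le {π : Measure (ℝ × ℝ)} [IsProbabilityMeasure π] {D ε : ℝ}
    (hε : 0 < ε) (hD : ∫⁻ z, ENNReal.ofReal |z.1 - z.2| ∂π ≤ ENNReal.ofReal D) :
    ∃ θ : ℝ, π {z | ⌊z.1 / ε + θ⌋ ≠ ⌊z.2 / ε + θ⌋} ≤ ENNReal.ofReal (D / ε) := by
  have : IsProbabilityMeasure (volume.restrict (Set.Ioc (0 : ℝ) 1)) := ⟨by simp⟩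
  set E : Set ((ℝ × ℝ) × ℝ) := {y | ⌊y.1.1 / ε + y.2⌋ ≠ ⌊y.1.2 / ε + y.2⌋} with hE
  have hEm : MeasurableSet E := by
    have h1 : Measurable fun y : (ℝ × ℝ) × ℝ => ⌊y.1.1 / ε + y.2⌋ := by fun_prop
    have h2 : Measurable fun y : (ℝ × ℝ) × ℝ => ⌊y.1.2 / ε + y.2⌋ := by fun_prop
    exact (measurableSet_eq_fun h1 h2).compl
  have hind : Measurable (E.indicator (1 : (ℝ × ℝ) × ℝ → ℝ≥0∞)) := measurable_one.indicator hEm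
  have hsec : ∀ θ, MeasurableSet {z : ℝ × ℝ | ⌊z.1 / ε + θ⌋ ≠ ⌊z.2 / ε + θ⌋} := fun θ =>
    hEm.preimage (f := fun z : ℝ × ℝ => (z, θ)) (by fun_prop)
  have hpi : ∀ θ, π {z | ⌊z.1 / ε + θ⌋ ≠ ⌊z.2 / ε + θ⌋} = ∫⁻ z, E.indicator 1 (z, θ) ∂π := by
    intro θ
    rw [← lintegral_indicator_one (hsec θ)]
    rfl
  obtain ⟨θ, hθ⟩ := exists_le_lintegral (μ := volume.restrict (Set.Ioc (0 : ℝ) 1))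
    (f := fun θ => ∫⁻ z, E.indicator 1 (z, θ) ∂π) hind.lintegral_prod_left'.aemeasurable
  refine ⟨θ, ?_⟩
  rw [hpi]
  refine hθ.trans ?_
  rw [lintegral_lintegral_swap (f := fun (θ : ℝ) (z : ℝ × ℝ) => E.indicator 1 (z, θ))
    (hind.comp measurable_swap).aemeasurable]
  calc ∫⁻ z : ℝ × ℝ, (∫⁻ θ : ℝ in Set.Ioc (0 : ℝ) 1, E.indicator 1 (z, θ)) ∂π
      ≤ ∫⁻ z, ENNReal.ofReal |z.1 / ε - z.2 / ε| ∂π :=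
        lintegral_mono fun z => lintegral_floor_ne_le (z.1 / ε) (z.2 / ε)
    _ = ∫⁻ z, ENNReal.ofReal ε⁻¹ * ENNReal.ofReal |z.1 - z.2| ∂π := by
        refine lintegral_congr fun z => ?_
        rw [← ENNReal.ofReal_mul (by positivity), ← sub_div, abs_div, abs_of_pos hε]
        congr 1; ring
    _ ≤ ENNReal.ofReal ε⁻¹ * ENNReal.ofReal D := by
        rw [lintegral_const_mul _ (by fun_prop)]
        gcongr
    _ = _ := by
        rw [← ENNReal.ofReal_mul (by positivity), div_eq_inv_mul]

end RandomGrid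

/-! ### Window approximations of functionals -/

section Windows
variable {Ω : Type*} [MeasurableSpace Ω] {μ : Measure Ω} {X : ℕ → Ω → ℝ} {Z : ℤ → Ω → ℝ}

lemma sigmaOf_eq_comap {Ω ι : Type*} (Y : ι → Ω → ℝ) (S : Set ι) :
    sigmaOf Y S = MeasurableSpace.comap (fun ω (i : S) => Y i ω) MeasurableSpace.pi := by
  simp only [MeasurableSpace.pi, MeasurableSpace.comap_iSup, MeasurableSpace.comap_comp, sigmaOf,
    iSup_subtype']
  rfl

/-- A version of a functional that is a functional of the shifted paths everywhere, together with
the window approximations: `Xt l n` depends on `Z (n - 1), …, Z (n - 1 + l)` only. -/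
lemma exists_window_approx {a : ℕ → ℝ} [IsProbabilityMeasure μ] (hZ : StationaryInt μ Z)
    (hf : IsFunctionalOf μ X Z) (ha : Approximating μ 1 X Z a) :
    ∃ (X' : ℕ → Ω → ℝ) (Xt : ℕ → ℕ → Ω → ℝ),
      (∀ n, 1 ≤ n → X n =ᵐ[μ] X' n) ∧
      (∀ n : ℕ, 1 ≤ n → Measurable[sigmaOf Z (Set.Ici (n : ℤ))] (X' n)) ∧
      (∀ l n : ℕ, 1 ≤ n → Measurable[sigmaOf Z (Set.Icc ((n : ℤ) - 1) ((n : ℤ) - 1 + l))] (Xt l n)) ∧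
      (∀ l n, μ.map (fun ω => (X' n ω, Xt l n ω)) = μ.map (fun ω => (X' 1 ω, Xt l 1 ω))) ∧
      ∀ l, ∫⁻ ω, ENNReal.ofReal |X' 1 ω - Xt l 1 ω| ∂μ ≤ ENNReal.ofReal (a l) := by
  obtain ⟨f, hfm, hfX⟩ := hf
  have hφ : ∀ l : ℕ, ∃ φ : (Set.Icc 0 (l : ℤ) → ℝ) → ℝ, Measurable φ ∧
      μ[X 1 | sigmaOf Z (Set.Icc 0 (l : ℤ))] = φ ∘ fun ω (i : Set.Icc 0 (l : ℤ)) => Z i ω := by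
    intro l
    have hm : Measurable[sigmaOf Z (Set.Icc 0 (l : ℤ))] (μ[X 1 | sigmaOf Z (Set.Icc 0 (l : ℤ))]) :=
      stronglyMeasurable_condExp.measurable
    rw [sigmaOf_eq_comap] at hm ⊢
    exact hm.exists_eq_measurable_comp
  choose φ hφm hφe using hφ
  set X' : ℕ → Ω → ℝ := fun n ω => f fun k : ℕ => Z (1 + (k : ℤ) + ((n : ℤ) - 1)) ω with hX'
  set Xt : ℕ → ℕ → Ω → ℝ := fun l n ω =>
    φ l fun i : Set.Icc 0 (l : ℤ) => Z ((i : ℤ) + ((n : ℤ) - 1)) ω with hXt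
  have hae : ∀ n, 1 ≤ n → X n =ᵐ[μ] X' n := by
    intro n hn
    filter_upwards [hfX n hn] with ω hω
    rw [hω]
    simp only [hX']
    congr 1; funext k; congr 1; ring
  refine ⟨X', Xt, hae, fun n hn => ?_, fun l n hn => ?_, fun l n => ?_, fun l => ?_⟩
  · refine hfm.comp (@measurable_pi_lambda _ _ _ (sigmaOf Z _) _ _ fun k =>
      measurable_of_sigmaOf ?_)
    rw [Set.mem_Ici]; omega
  · refine (hφm l).comp (@measurable_pi_lambda _ _ _ (sigmaOf Z _) _ _ fun i =>
      measurable_of_sigmaOf ?_)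
    have := i.2.1
    have := i.2.2
    rw [Set.mem_Icc]; omega
  · have hΨ : Measurable fun z : ℤ → ℝ => (f fun k : ℕ => z (1 + (k : ℤ)),
        φ l fun i : Set.Icc 0 (l : ℤ) => z (i : ℤ)) :=
      (hfm.comp (measurable_pi_lambda _ fun k => measurable_pi_apply _)).prodMk
        ((hφm l).comp (measurable_pi_lambda _ fun i => measurable_pi_apply _))
    have h1 := ((hZ.2 ((n : ℤ) - 1)).comp hΨ).map_eq
    have h2 := ((hZ.2 (((1 : ℕ) : ℤ) - 1)).comp hΨ).map_eq
    exact h1.trans h2.symm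
  · have h1 := (ha.2.2 l).2
    rw [eLpNorm_one_eq_lintegral_enorm] at h1
    refine le_trans (le_of_eq (lintegral_congr_ae ?_)) h1
    filter_upwards [hae 1 le_rfl] with ω hω
    rw [Pi.sub_apply, hω, hφe l, ← ofReal_norm, Real.norm_eq_abs]
    simp [hXt]

/-- A partition of the line into cells of diameter at most `η`, and for each `n` a variable that
depends on the window `Z (n - 1), …, Z (n - 1 + l)` only and predicts the cell of `X n` up to an
error probability `η`; moreover the past and future of `Z` at distance `l` are `2 η`-close to
independence. -/
structure CellApprox (μ : Measure Ω) (Z : ℤ → Ω → ℝ) (X : ℕ → Ω → ℝ) (η : ℝ) (l : ℕ) (c : ℝ → ℤ)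
    (W : ℕ → Ω → ℤ) : Prop where
  measurable_cell : Measurable c
  cell_le : ∀ x y, c x = c y → |x - y| ≤ η
  measurable_window : ∀ n : ℕ, 1 ≤ n →
    Measurable[sigmaOf Z (Set.Icc ((n : ℤ) - 1) ((n : ℤ) - 1 + l))] (W n)
  measure_ne_le : ∀ n : ℕ, 1 ≤ n → μ {ω | c (X n ω) ≠ W n ω} ≤ ENNReal.ofReal η
  beta_le : ∀ n : ℕ, 1 ≤ n → betaBetween (sigmaOf Z (Set.Iic (n : ℤ)))
    (sigmaOf Z (Set.Ici ((n : ℤ) + l))) μ ≤ ENNReal.ofReal (2 * η)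

lemma approxAlpha_antitone {a : ℕ → ℝ} (ha0 : ∀ l, 0 ≤ a l) (ha : Summable a) :
    Antitone (approxAlpha a) := by
  refine antitone_nat_of_succ_le fun l => Real.sqrt_le_sqrt ?_
  have h1 : Summable fun i => a (l + i) := by
    simpa only [add_comm l] using (summable_nat_add_iff l).2 ha
  have h2 := h1.tsum_eq_zero_add
  have h3 : ∀ i, a (l + (i + 1)) = a (l + 1 + i) := fun i => by congr 1; ring
  simp only [h3] at h2
  rw [h2]
  have := ha0 (l + 0)
  linarith

lemma two_mul_le_approxAlpha_sq {a : ℕ → ℝ} (ha0 : ∀ l, 0 ≤ a l) (ha : Summable a) (l : ℕ) :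
    2 * a l ≤ approxAlpha a l ^ 2 := by
  have h1 : Summable fun i => a (l + i) := by
    simpa only [add_comm l] using (summable_nat_add_iff l).2 ha
  have h2 := h1.le_tsum 0 fun i _ => ha0 _
  rw [approxAlpha, Real.sq_sqrt (by
    have := ha0 (l + 0)
    linarith)]
  simpa using h2

/-- The cells at scale `l` form a grid of mesh `η l`, shifted so that the window approximation of `X n`,
which is within `a l` in mean, falls into the same cell up to probability `a l / η l`; this is at
most `η l` as `2 a l ≤ α_l ^ 2`. The process is replaced by a version which is measurable with respect
to the future of `Z` everywhere, as the functional equation holds only almost surely. The rates are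
capped at one, where the requirements are void. -/
lemma exists_cellApprox {a : ℕ → ℝ} [IsProbabilityMeasure μ] (hZ : StationaryInt μ Z)
    (hf : IsFunctionalOf μ X Z) (ha : Approximating μ 1 X Z a) (hs : Summable a) {η : ℕ → ℝ}
    (hη0 : ∀ l, 0 < η l) (hηβ : ∀ l, min 1 (betaCoeffInt μ Z l) ≤ η l)
    (hηα : ∀ l, min 1 (approxAlpha a l) ≤ η l) :
    ∃ (X' : ℕ → Ω → ℝ) (c : ℕ → ℝ → ℤ) (W : ℕ → ℕ → Ω → ℤ),
      (∀ n, 1 ≤ n → X n =ᵐ[μ] X' n) ∧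
      (∀ n : ℕ, 1 ≤ n → Measurable[sigmaOf Z (Set.Ici (n : ℤ))] (X' n)) ∧
      ∀ l, CellApprox μ Z X' (η l) l (c l) (W l) := by
  obtain ⟨X', Xt, hae, hX'm, hXtm, hlaw, hdist⟩ := exists_window_approx hZ hf ha
  have hZle : ∀ S : Set ℤ, sigmaOf Z S ≤ ‹MeasurableSpace Ω› := fun S => sigmaOf_le fun i _ => hZ.1 i
  have hpm : ∀ l n, 1 ≤ n → Measurable fun ω => (X' n ω, Xt l n ω) := fun l n hn =>
    ((hX'm n hn).mono (hZle _) le_rfl).prodMk ((hXtm l n hn).mono (hZle _) le_rfl)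
  have hθ : ∀ l, ∃ θ : ℝ, μ.map (fun ω => (X' 1 ω, Xt l 1 ω))
      {z | ⌊z.1 / η l + θ⌋ ≠ ⌊z.2 / η l + θ⌋} ≤ ENNReal.ofReal (a l / η l) := by
    intro l
    have := Measure.isProbabilityMeasure_map (μ := μ) (hpm l 1 le_rfl).aemeasurable
    refine exists_shift_measure_floor_ne_le (hη0 l) ?_
    rw [lintegral_map (by fun_prop) (hpm l 1 le_rfl)]
    exact hdist l
  choose θ hθ using hθ
  refine ⟨X', fun l x => ⌊x / η l + θ l⌋, fun l n ω => ⌊Xt l n ω / η l + θ l⌋, hae, hX'm,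
    fun l => ⟨measurable_floor_div _ _, fun x y => abs_sub_le_of_floor_eq (hη0 l),
      fun n hn => (measurable_floor_div _ _).comp (hXtm l n hn), fun n hn => ?_, fun n hn => ?_⟩⟩
  · rcases le_or_gt 1 (η l) with h1 | h1
    · exact prob_le_one.trans (by rw [← ENNReal.ofReal_one]; exact ENNReal.ofReal_le_ofReal h1)
    · have hm : MeasurableSet {z : ℝ × ℝ | ⌊z.1 / η l + θ l⌋ ≠ ⌊z.2 / η l + θ l⌋} :=
        (measurableSet_eq_fun ((measurable_floor_div _ _).comp measurable_fst)
          ((measurable_floor_div _ _).comp measurable_snd)).compl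
      have h2 := hθ l
      rw [← hlaw l n, Measure.map_apply (hpm l n hn) hm] at h2
      refine h2.trans (ENNReal.ofReal_le_ofReal ?_)
      have h3 : approxAlpha a l ≤ η l := (min_le_iff.1 (hηα l)).resolve_left (not_le.2 h1)
      have h4 := two_mul_le_approxAlpha_sq (fun l => (ha.2.2 l).1) hs l
      have h5 : 0 ≤ approxAlpha a l := Real.sqrt_nonneg _
      have h6 := (ha.2.2 l).1
      rw [div_le_iff₀ (hη0 l)]
      nlinarith
  · refine (betaBetween_le_betaCoeffInt hn l).trans (ENNReal.ofReal_le_ofReal ?_)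
    rcases min_le_iff.1 (hηβ l) with h1 | h1
    · have := betaCoeffInt_le_two (μ := μ) (Z := Z) l
      linarith
    · have := hη0 l
      linarith

end Windows


/-! ### Step kernels -/

section StepKernel

variable {F : Measure ℝ} {c : ℝ → ℤ}

/-- The density of `(x, x')`, where `x` has law `F` and `x'` is redrawn from the cell of `x`, with
respect to `F ⊗ F`. -/
noncomputable def sameCellDens (F : Measure ℝ) (c : ℝ → ℤ) (x x' : ℝ) : ℝ≥0∞ :=
  if c x = c x' then (F (c ⁻¹' {c x}))⁻¹ else 0

/-- The law of `(x, x', y)` for independent `x` and `y` with law `F` and `x'` redrawn from the cell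
of `x`. -/
noncomputable def sameCellLaw (F : Measure ℝ) (c : ℝ → ℤ) : Measure (ℝ × ℝ × ℝ) :=
  (F.prod (F.prod F)).withDensity fun t => sameCellDens F c t.1 t.2.1

lemma measurable_sameCellDens (hc : Measurable c) :
    Measurable fun z : ℝ × ℝ => sameCellDens F c z.1 z.2 := by
  have h1 : Measurable fun s : ℤ => (F (c ⁻¹' {s}))⁻¹ := measurable_of_countable _
  exact Measurable.ite (measurableSet_eq_fun (hc.comp measurable_fst) (hc.comp measurable_snd))
    (h1.comp (hc.comp measurable_fst)) measurable_const

lemma sameCellDens_comm (x x' : ℝ) : sameCellDens F c x x' = sameCellDens F c x' x := by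
  unfold sameCellDens
  by_cases h : c x = c x'
  · rw [if_pos h, if_pos h.symm, h]
  · rw [if_neg h, if_neg (Ne.symm h)]

lemma lintegral_sameCellDens_mul (hc : Measurable c) (x : ℝ) {D : ℝ → ℝ≥0∞} (hD : Measurable D) :
    ∫⁻ x', sameCellDens F c x x' * D x' ∂F
      = (F (c ⁻¹' {c x}))⁻¹ * ∫⁻ x' in c ⁻¹' {c x}, D x' ∂F := by
  rw [← lintegral_indicator (hc (measurableSet_singleton _)),
    ← lintegral_const_mul _ (hD.indicator (hc (measurableSet_singleton _)))]
  refine lintegral_congr fun x' => ?_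
  unfold sameCellDens
  by_cases h : c x = c x'
  · rw [if_pos h, Set.indicator_of_mem (by simp [h])]
  · rw [if_neg h, Set.indicator_of_notMem (by simpa using Ne.symm h)]; simp

lemma lintegral_eq_tsum_cells (hc : Measurable c) (f : ℝ → ℝ≥0∞) :
    ∫⁻ x, f x ∂F = ∑' s : ℤ, ∫⁻ x in c ⁻¹' {s}, f x ∂F := by
  rw [← lintegral_iUnion (fun s => hc (measurableSet_singleton s))]
  · have : ⋃ s : ℤ, c ⁻¹' {s} = Set.univ := by ext x; simp
    rw [this, Measure.restrict_univ]
  · intro s t hst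
    exact Disjoint.preimage c (by simpa using hst)

lemma lintegral_sameCellDens [IsProbabilityMeasure F] (hc : Measurable c) :
    ∀ᵐ x ∂F, ∫⁻ x', sameCellDens F c x x' ∂F = 1 := by
  have h1 : ∀ᵐ x ∂F, F (c ⁻¹' {c x}) ≠ 0 := by
    have h2 : ∀ s : ℤ, ∀ᵐ x ∂F, c x = s → F (c ⁻¹' {s}) ≠ 0 := by
      intro s
      by_cases hs : F (c ⁻¹' {s}) = 0
      · filter_upwards [measure_eq_zero_iff_ae_notMem.1 hs] with x hx hxs
        exact absurd hxs hx
      · exact Eventually.of_forall fun x _ => hs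
    filter_upwards [ae_all_iff.2 h2] with x hx
    exact hx _ rfl
  filter_upwards [h1] with x hx
  have := lintegral_sameCellDens_mul (F := F) hc x (D := fun _ => 1) measurable_const
  simp only [mul_one, lintegral_const, Measure.restrict_apply MeasurableSet.univ, Set.univ_inter,
    one_mul] at this
  rw [this, ENNReal.inv_mul_cancel hx (measure_ne_top _ _)]

lemma lintegral_sameCellLaw [SFinite F] (hc : Measurable c) {ψ : ℝ × ℝ × ℝ → ℝ≥0∞}
    (hψ : Measurable ψ) : ∫⁻ t, ψ t ∂(sameCellLaw F c)
      = ∫⁻ x, ∫⁻ x', sameCellDens F c x x' * ∫⁻ y, ψ (x, x', y) ∂F ∂F ∂F := by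
  have hg : Measurable fun t : ℝ × ℝ × ℝ => sameCellDens F c t.1 t.2.1 :=
    (measurable_sameCellDens hc).comp (f := fun t : ℝ × ℝ × ℝ => (t.1, t.2.1)) (by fun_prop)
  rw [sameCellLaw, lintegral_withDensity_eq_lintegral_mul _ hg hψ,
    lintegral_prod _ (hg.mul hψ).aemeasurable]
  refine lintegral_congr fun x => ?_
  have hgψ : Measurable fun z : ℝ × ℝ => sameCellDens F c x z.1 * ψ (x, z) :=
    (hg.mul hψ).comp measurable_prodMk_left
  refine (lintegral_prod _ hgψ.aemeasurable).trans ?_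
  refine lintegral_congr fun x' => ?_
  exact lintegral_const_mul (f := fun y => ψ (x, x', y)) (sameCellDens F c x x') (hψ.comp (by fun_prop : Measurable fun y : ℝ => (x, x', y)))

lemma lintegral_sameCellLaw_fst [IsProbabilityMeasure F] (hc : Measurable c) {φ : ℝ × ℝ → ℝ≥0∞}
    (hφ : Measurable φ) :
    ∫⁻ t, φ (t.1, t.2.2) ∂(sameCellLaw F c) = ∫⁻ z, φ z ∂(F.prod F) := by
  rw [lintegral_sameCellLaw hc (ψ := fun t => φ (t.1, t.2.2)) (hφ.comp (by fun_prop)),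
    lintegral_prod _ hφ.aemeasurable]
  refine lintegral_congr_ae ?_
  filter_upwards [lintegral_sameCellDens hc] with x hx
  rw [lintegral_mul_const (f := fun x' => sameCellDens F c x x') _
    ((measurable_sameCellDens hc).comp measurable_prodMk_left), hx, one_mul]

lemma lintegral_sameCellLaw_snd [IsProbabilityMeasure F] (hc : Measurable c) {φ : ℝ × ℝ → ℝ≥0∞}
    (hφ : Measurable φ) :
    ∫⁻ t, φ (t.2.1, t.2.2) ∂(sameCellLaw F c) = ∫⁻ z, φ z ∂(F.prod F) := by
  rw [← lintegral_sameCellLaw_fst hc hφ,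
    lintegral_sameCellLaw hc (ψ := fun t => φ (t.1, t.2.2)) (hφ.comp (by fun_prop)),
    lintegral_sameCellLaw hc (ψ := fun t => φ (t.2.1, t.2.2)) (hφ.comp (by fun_prop)),
    lintegral_lintegral_swap]
  · simp only [sameCellDens_comm]
  · exact ((measurable_sameCellDens hc).mul
      ((hφ.lintegral_prod_right').comp measurable_snd)).aemeasurable

lemma map_sameCellLaw_fst [IsProbabilityMeasure F] (hc : Measurable c) :
    (sameCellLaw F c).map (fun t => (t.1, t.2.2)) = F.prod F := by
  refine Measure.ext_of_lintegral _ fun φ hφ => ?_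
  rw [lintegral_map hφ (by fun_prop), lintegral_sameCellLaw_fst hc hφ]

lemma map_sameCellLaw_snd [IsProbabilityMeasure F] (hc : Measurable c) :
    (sameCellLaw F c).map (fun t => (t.2.1, t.2.2)) = F.prod F := by
  refine Measure.ext_of_lintegral _ fun φ hφ => ?_
  rw [lintegral_map hφ (by fun_prop), lintegral_sameCellLaw_snd hc hφ]

lemma isProbabilityMeasure_sameCellLaw [IsProbabilityMeasure F] (hc : Measurable c) :
    IsProbabilityMeasure (sameCellLaw F c) := by
  refine ⟨?_⟩
  have h1 := congrArg (fun ν => ν Set.univ) (map_sameCellLaw_fst (F := F) hc)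
  simpa [Measure.map_apply (by fun_prop : Measurable fun t : ℝ × ℝ × ℝ => (t.1, t.2.2))
    MeasurableSet.univ] using h1

lemma ae_sameCellLaw [SFinite F] (hc : Measurable c) :
    ∀ᵐ t ∂(sameCellLaw F c), c t.1 = c t.2.1 := by
  have hg : Measurable fun t : ℝ × ℝ × ℝ => sameCellDens F c t.1 t.2.1 :=
    (measurable_sameCellDens hc).comp (f := fun t : ℝ × ℝ × ℝ => (t.1, t.2.1)) (by fun_prop)
  rw [sameCellLaw, ae_withDensity_iff hg]
  refine Eventually.of_forall fun t ht => ?_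
  by_contra h
  exact ht (by simp [sameCellDens, h])

/-- Choosing a good representative of each cell: freezing the first argument of `w` at the
representative costs no more than redrawing it at random from its cell. -/
lemma exists_representative [IsProbabilityMeasure F] (hc : Measurable c) {w : ℝ → ℝ → ℝ}
    (hw : Measurable (Function.uncurry w)) :
    ∃ r : ℤ → ℝ, ∫⁻ z, ENNReal.ofReal |w z.1 z.2 - w (r (c z.1)) z.2| ∂(F.prod F)
      ≤ ∫⁻ t, ENNReal.ofReal |w t.1 t.2.2 - w t.2.1 t.2.2| ∂(sameCellLaw F c) := by
  have hw1 : ∀ {S : Type} [MeasurableSpace S] {f g : S → ℝ}, Measurable f → Measurable g →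
      Measurable fun s => w (f s) (g s) := fun hf hg => hw.comp (hf.prodMk hg)
  have hcell : ∀ s, MeasurableSet (c ⁻¹' {s}) := fun s => hc (measurableSet_singleton s)
  set D : ℝ × ℝ → ℝ≥0∞ := fun z => ∫⁻ y, ENNReal.ofReal |w z.1 y - w z.2 y| ∂F with hDd
  have hD : Measurable D := by
    have : Measurable fun q : (ℝ × ℝ) × ℝ => ENNReal.ofReal |w q.1.1 q.2 - w q.1.2 q.2| :=
      ((hw1 measurable_fst.fst measurable_snd).sub
        (hw1 measurable_fst.snd measurable_snd)).abs.ennreal_ofReal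
    exact this.lintegral_prod_right'
  have hr : ∀ s : ℤ, ∃ r : ℝ, ∫⁻ x in c ⁻¹' {s}, D (x, r) ∂F
      ≤ ∫⁻ x in c ⁻¹' {s}, (F (c ⁻¹' {s}))⁻¹ * ∫⁻ x' in c ⁻¹' {s}, D (x, x') ∂F ∂F := by
    intro s
    by_cases hs : F (c ⁻¹' {s}) = 0
    · exact ⟨0, by rw [setLIntegral_measure_zero _ _ hs]; exact zero_le⟩
    · obtain ⟨r, -, hr⟩ := exists_le_setLAverage (μ := F) (s := c ⁻¹' {s})
        (f := fun r => ∫⁻ x in c ⁻¹' {s}, D (x, r) ∂F) hs (measure_ne_top _ _)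
        hD.lintegral_prod_left'.aemeasurable
      refine ⟨r, hr.trans (le_of_eq ?_)⟩
      rw [setLAverage_eq, lintegral_const_mul _ hD.lintegral_prod_right', ENNReal.div_eq_inv_mul,
        lintegral_lintegral_swap (f := fun r x => D (x, r)) (hD.comp measurable_swap).aemeasurable]
  choose r hr using hr
  refine ⟨r, ?_⟩
  have hrc : Measurable fun x => r (c x) := (measurable_of_countable r).comp hc
  rw [lintegral_sameCellLaw hc (ψ := fun t => ENNReal.ofReal |w t.1 t.2.2 - w t.2.1 t.2.2|)
      ((hw1 measurable_fst measurable_snd.snd).sub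
      (hw1 measurable_snd.fst measurable_snd.snd)).abs.ennreal_ofReal,
    lintegral_prod (fun z : ℝ × ℝ => ENNReal.ofReal |w z.1 z.2 - w (r (c z.1)) z.2|)
      ((hw1 measurable_fst measurable_snd).sub (hw1 (hrc.comp measurable_fst) measurable_snd)).abs.ennreal_ofReal.aemeasurable,
    lintegral_eq_tsum_cells hc, lintegral_eq_tsum_cells (F := F) hc]
  refine ENNReal.tsum_le_tsum fun s => ?_
  calc ∫⁻ x in c ⁻¹' {s}, ∫⁻ y, ENNReal.ofReal |w x y - w (r (c x)) y| ∂F ∂F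
      = ∫⁻ x in c ⁻¹' {s}, D (x, r s) ∂F := by
        refine setLIntegral_congr_fun (hcell s) fun x hx => ?_
        have : c x = s := hx
        simp only [hDd, this]
    _ ≤ _ := hr s
    _ = _ := by
        refine setLIntegral_congr_fun (hcell s) fun x hx => ?_
        have : c x = s := hx
        have h2 := lintegral_sameCellDens_mul (F := F) hc x (D := fun x' => D (x, x'))
          (hD.comp measurable_prodMk_left)
        rw [this] at h2
        exact h2.symm

/-- A kernel with the Lipschitz property in mean is approximated in `L¹(F ⊗ F)` by a function of the
cells of the two arguments. -/
lemma exists_step_kernel [IsProbabilityMeasure F] (hc : Measurable c) {h : ℝ → ℝ → ℝ}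
    (hm : Measurable (Function.uncurry h)) (hsymm : ∀ x y, h x y = h y x) {L ε : ℝ} (hL0 : 0 ≤ L)
    (hε : 0 < ε) (hcε : ∀ x y, c x = c y → |x - y| ≤ ε) (hL : LipOn h F (F.prod F) L) :
    ∃ u : ℤ → ℤ → ℝ, ∫⁻ z, ENNReal.ofReal |h z.1 z.2 - u (c z.1) (c z.2)| ∂(F.prod F)
      ≤ ENNReal.ofReal (4 * L * ε) := by
  have hρ := isProbabilityMeasure_sameCellLaw (F := F) hc
  have hLip : ∫⁻ t, ENNReal.ofReal |h t.1 t.2.2 - h t.2.1 t.2.2| ∂(sameCellLaw F c)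
      ≤ ENNReal.ofReal (L * ε) := by
    refine le_trans (le_of_eq (lintegral_congr_ae ?_))
      (hL ε hε _ hρ (map_sameCellLaw_fst hc) (map_sameCellLaw_snd hc))
    filter_upwards [ae_sameCellLaw hc] with t ht
    rw [Set.indicator_of_mem]
    exact hcε _ _ ht
  have hw1 : ∀ {S : Type} [MeasurableSpace S] {f g : S → ℝ}, Measurable f → Measurable g →
      Measurable fun s => h (f s) (g s) := fun hf hg => hm.comp (hf.prodMk hg)
  obtain ⟨r, hr⟩ := exists_representative (F := F) hc hm
  have hrc : Measurable fun x => r (c x) := (measurable_of_countable r).comp hc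
  have hr1 := hr.trans hLip
  -- the second argument is frozen in the kernel `h (r (c x)) y`, not in `h`
  obtain ⟨r', hr'⟩ := exists_representative (F := F) hc (w := fun y x => h (r (c x)) y)
    (hw1 (hrc.comp measurable_snd) measurable_fst)
  refine ⟨fun s t => h (r s) (r' t), ?_⟩
  set d : ℝ × ℝ → ℝ≥0∞ := fun z => ENNReal.ofReal |h z.1 z.2 - h (r (c z.1)) z.2| with hdd
  have hd : Measurable d := ((hw1 measurable_fst measurable_snd).sub
      (hw1 (hrc.comp measurable_fst) measurable_snd)).abs.ennreal_ofReal
  have hdsw : ∫⁻ z, d z.swap ∂(F.prod F) ≤ ENNReal.ofReal (L * ε) := by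
    rw [lintegral_prod_swap]; exact hr1
  have htri : ∀ a b c : ℝ, ENNReal.ofReal |a - c| ≤ ENNReal.ofReal |a - b| + ENNReal.ofReal |b - c| := by
    intro a b c
    rw [← ENNReal.ofReal_add (abs_nonneg _) (abs_nonneg _)]
    exact ENNReal.ofReal_le_ofReal (abs_sub_le a b c)
  have h2 : ∫⁻ t, ENNReal.ofReal |h (r (c t.2.2)) t.1 - h (r (c t.2.2)) t.2.1| ∂(sameCellLaw F c)
      ≤ ENNReal.ofReal (3 * (L * ε)) := by
    calc _ ≤ ∫⁻ t, (d (t.1, t.2.2).swap + (ENNReal.ofReal |h t.1 t.2.2 - h t.2.1 t.2.2|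
            + d (t.2.1, t.2.2).swap)) ∂(sameCellLaw F c) := by
          refine lintegral_mono fun t => ?_
          refine (htri _ (h t.2.2 t.1) _).trans ?_
          refine add_le_add (le_of_eq ?_) ((htri _ (h t.2.2 t.2.1) _).trans
            (add_le_add (le_of_eq ?_) (le_of_eq ?_)))
          · rw [abs_sub_comm]; rfl
          · rw [hsymm t.1, hsymm t.2.1]
          · rfl
      _ = ∫⁻ z, d z.swap ∂(F.prod F)
          + (∫⁻ t, ENNReal.ofReal |h t.1 t.2.2 - h t.2.1 t.2.2| ∂(sameCellLaw F c)
            + ∫⁻ z, d z.swap ∂(F.prod F)) := by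
          rw [lintegral_add_left (f := fun t : ℝ × ℝ × ℝ => d (t.1, t.2.2).swap)
            (hd.comp (by fun_prop)), lintegral_add_left
            (f := fun t : ℝ × ℝ × ℝ => ENNReal.ofReal |h t.1 t.2.2 - h t.2.1 t.2.2|) (((hw1 measurable_fst measurable_snd.snd).sub
              (hw1 measurable_snd.fst measurable_snd.snd)).abs.ennreal_ofReal),
            lintegral_sameCellLaw_fst hc (φ := fun z => d z.swap) (hd.comp measurable_swap),
            lintegral_sameCellLaw_snd hc (φ := fun z => d z.swap) (hd.comp measurable_swap)]
      _ ≤ ENNReal.ofReal (L * ε) + (ENNReal.ofReal (L * ε) + ENNReal.ofReal (L * ε)) := by gcongr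
      _ = _ := by
          rw [← ENNReal.ofReal_add (by positivity) (by positivity),
            ← ENNReal.ofReal_add (by positivity) (by positivity)]
          congr 1; ring
  have h3 : ∫⁻ z, ENNReal.ofReal |h (r (c z.1)) z.2 - h (r (c z.1)) (r' (c z.2))| ∂(F.prod F)
      ≤ ENNReal.ofReal (3 * (L * ε)) := by
    rw [← lintegral_prod_swap]
    exact hr'.trans h2
  calc _ ≤ ∫⁻ z, (d z + ENNReal.ofReal |h (r (c z.1)) z.2 - h (r (c z.1)) (r' (c z.2))|)
        ∂(F.prod F) := lintegral_mono fun z => htri _ _ _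
    _ ≤ ENNReal.ofReal (L * ε) + ENNReal.ofReal (3 * (L * ε)) := by
        rw [lintegral_add_left hd]
        exact add_le_add hr1 h3
    _ = _ := by
        rw [← ENNReal.ofReal_add (by positivity) (by positivity)]
        congr 1; ring

end StepKernel


/-! ### Covariance bounds through windows -/

section CellCovariance
variable {Ω : Type*} [MeasurableSpace Ω] {μ : Measure Ω} [IsProbabilityMeasure μ]
  {X : ℕ → Ω → ℝ} {Z : ℤ → Ω → ℝ} {F : Measure ℝ} {h : ℝ → ℝ → ℝ} {δ M η K L : ℝ} {l : ℕ}
  {c : ℝ → ℤ} {W : ℕ → Ω → ℤ}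

/-- The predicted cell `W i` and the past up to `n + l` are `2 η`-close to being independent of the future
from `n + 2 l` on; replacing `W i` by the true cell costs another `2 η`. -/
lemma CellApprox.depLE (hca : CellApprox μ Z X η l c W) (hη : 0 < η) (hZ : ∀ n, Measurable (Z n))
    {i n : ℕ} (hi : 1 ≤ i) (hin : i ≤ n) (hXi : Measurable (X i)) {S T : Type*} [MeasurableSpace S]
    [MeasurableSpace T] {A : Ω → S} {V : Ω → T}
    (hA : Measurable[sigmaOf Z (Set.Iic ((n + l : ℕ) : ℤ))] A)
    (hV : Measurable[sigmaOf Z (Set.Ici ((n + l : ℕ) + l : ℤ))] V) :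
    DepLE μ (fun ω => (c (X i ω), A ω)) V (ENNReal.ofReal (4 * η)) := by
  have hZle : ∀ S : Set ℤ, sigmaOf Z S ≤ ‹MeasurableSpace Ω› := fun S => sigmaOf_le fun i _ => hZ i
  have hW : Measurable[sigmaOf Z (Set.Iic ((n + l : ℕ) : ℤ))] (W i) := by
    refine (hca.measurable_window i hi).mono (sigmaOf_mono fun k hk => ?_) le_rfl
    rw [Set.mem_Icc] at hk
    rw [Set.mem_Iic]
    push_cast
    omega
  have hA0 : Measurable A := hA.mono (hZle _) le_rfl
  have h1 := (depLE_betaBetween (hZle _) (hZle _) (hW.prodMk hA) hV).mono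
    (hca.beta_le (n + l) (by omega))
  have h2 := h1.of_measure_ne_le (U := fun ω => (c (X i ω), A ω)) (q := ENNReal.ofReal η)
    ((hca.measurable_cell.comp hXi).prodMk hA0) ((hW.mono (hZle _) le_rfl).prodMk hA0)
    (hV.mono (hZle _) le_rfl) ((measure_mono fun ω hω => ?_).trans (hca.measure_ne_le i hi))
  · refine h2.mono (le_of_eq ?_)
    rw [show 4 * η = 2 * η + 2 * η by ring, ENNReal.ofReal_add (by positivity) (by positivity)]
    rw [ENNReal.ofReal_mul zero_le_two]
    simp
  · rw [Set.mem_ofPred_eq] at hω ⊢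
    intro hcon
    exact hω (by rw [hcon])

/-- Covariance of `h (X i, X j)` and a term depending on the past up to `n + l` or on the future from
`n + 2 l` on, where `i ≤ n` and `n + 2 l ≤ j`. Although `X i` itself depends on the whole future of
`Z`, its cell is nearly a function of the past. -/
lemma CellApprox.abs_integral_mul_le (hca : CellApprox μ Z X η l c W) (hη : 0 < η)
    (hZ : ∀ n, Measurable (Z n))
    (hXm : ∀ n : ℕ, 1 ≤ n → Measurable[sigmaOf Z (Set.Ici (n : ℤ))] (X n))
    (hh : DegKernel F h δ M) {i j n : ℕ} (hi : 1 ≤ i) (hin : i ≤ n) (hnj : n + 2 * l ≤ j)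
    (hp : MomPair μ F h δ M (X i) (X j)) (hL0 : 0 ≤ L)
    (hL : LipOn h F (μ.map fun ω => (X i ω, X j ω)) L)
    (hK : 1 ≤ K) (hηK : η = K ^ (-(2 + δ))) {H : Ω → ℝ}
    (hH : Measurable[sigmaOf Z (Set.Iic ((n + l : ℕ) : ℤ))] H ∨
      Measurable[sigmaOf Z (Set.Ici ((n + l : ℕ) + l : ℤ))] H)
    (hHK : (∀ ω, |H ω| ≤ K) ∨ ∫⁻ ω, ENNReal.ofReal (|H ω| ^ (2 + δ)) ∂μ ≤ ENNReal.ofReal M) :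
    |∫ ω, H ω * h (X i ω) (X j ω) ∂μ| ≤ (2 * L + 16 + 6 * M) * K ^ (-δ) := by
  have hZle : ∀ S : Set ℤ, sigmaOf Z S ≤ ‹MeasurableSpace Ω› := fun S => sigmaOf_le fun i _ => hZ i
  have hXj : Measurable[sigmaOf Z (Set.Ici ((n + l : ℕ) + l : ℤ))] (X j) := by
    refine (hXm j (by omega)).mono (sigmaOf_mono (Set.Ici_subset_Ici.2 ?_)) le_rfl
    push_cast; omega
  have hηK1 : η ≤ 1 * K ^ (-(1 + δ)) := by
    rw [one_mul, hηK]
    exact Real.rpow_le_rpow_of_exponent_le hK (by linarith)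
  refine (hp.abs_integral_mul_le_of_cells hh (hZle _) (hZle _) hH (by linarith) hHK (P := 4)
    (by positivity : 0 ≤ 4 * η) (by rw [hηK]) hη hηK1 hL0 hL hca.measurable_cell hca.cell_le
    fun A B hA hB => hca.depLE hη hZ hi hin hp.measU hA (hXj.prodMk hB)).trans (le_of_eq (by ring))

/-- A bounded kernel that depends on the cells of its arguments only and is close to `h` in
`L¹(F ⊗ F)`. -/
lemma exists_window_kernel [IsProbabilityMeasure F] (hc : Measurable c)
    (hcη : ∀ x y, c x = c y → |x - y| ≤ η) (hη : 0 < η)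
    (hh : DegKernel F h δ M) (hL0 : 0 ≤ L) (hLF : LipOn h F (F.prod F) L)
    (hK : 1 ≤ K) (hηK : η = K ^ (-(2 + δ))) :
    ∃ G : ℤ → ℤ → ℝ, (∀ s t, |G s t| ≤ K) ∧ ∫⁻ z, ENNReal.ofReal |h z.1 z.2 - G (c z.1) (c z.2)|
      ∂(F.prod F) ≤ ENNReal.ofReal ((4 * L + M) * K ^ (-(1 + δ))) := by
  have hK0 : 0 < K := by linarith
  have hM := hh.M_nonneg
  have hδ := hh.δ_pos
  obtain ⟨u, hu⟩ := exists_step_kernel (F := F) hc hh.meas hh.symm hL0 hη hcη hLF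
  refine ⟨fun s t => clamp K (u s t), fun s t => abs_clamp_le hK0.le _, ?_⟩
  have hm : Measurable fun z : ℝ × ℝ => h z.1 z.2 := hh.meas
  have hmr : Measurable fun z : ℝ × ℝ => ENNReal.ofReal (|h z.1 z.2| ^ (2 + δ)) := by fun_prop
  have hηK1 : η ≤ K ^ (-(1 + δ)) := by
    rw [hηK]
    exact Real.rpow_le_rpow_of_exponent_le hK (by linarith)
  calc ∫⁻ z, ENNReal.ofReal |h z.1 z.2 - clamp K (u (c z.1) (c z.2))| ∂(F.prod F)
      ≤ ∫⁻ z, (ENNReal.ofReal (K ^ (-(1 + δ))) * ENNReal.ofReal (|h z.1 z.2| ^ (2 + δ))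
          + ENNReal.ofReal |h z.1 z.2 - u (c z.1) (c z.2)|) ∂(F.prod F) := by
        refine lintegral_mono fun z => ?_
        rw [← ENNReal.ofReal_mul (by positivity), ← ENNReal.ofReal_add (by positivity) (by positivity)]
        refine ENNReal.ofReal_le_ofReal ?_
        have h1 := abs_sub_le (h z.1 z.2) (clamp K (h z.1 z.2)) (clamp K (u (c z.1) (c z.2)))
        have h2 := abs_sub_clamp_le hK0 hδ (h z.1 z.2)
        have h3 := abs_clamp_sub_clamp_le K (h z.1 z.2) (u (c z.1) (c z.2))
        linarith
    _ = ENNReal.ofReal (K ^ (-(1 + δ))) * ∫⁻ z, ENNReal.ofReal (|h z.1 z.2| ^ (2 + δ)) ∂(F.prod F)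
          + ∫⁻ z, ENNReal.ofReal |h z.1 z.2 - u (c z.1) (c z.2)| ∂(F.prod F) := by
        rw [lintegral_add_left (hmr.const_mul _), lintegral_const_mul _ hmr]
    _ ≤ ENNReal.ofReal (K ^ (-(1 + δ))) * ENNReal.ofReal M + ENNReal.ofReal (4 * L * η) := by
        gcongr
        exact hh.mom
    _ ≤ _ := by
        rw [← ENNReal.ofReal_mul (by positivity), ← ENNReal.ofReal_add (by positivity) (by positivity)]
        refine ENNReal.ofReal_le_ofReal ?_
        have : 4 * L * η ≤ 4 * L * K ^ (-(1 + δ)) := by gcongr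
        linarith

/-- The kernel evaluated at distant members of the sequence is close in `L¹` to a bounded function of
windows of the underlying process. -/
lemma CellApprox.integral_abs_sub_le (hca : CellApprox μ Z X η l c W) (hη : 0 < η)
    (hZ : ∀ n, Measurable (Z n))
    (hXm : ∀ n : ℕ, 1 ≤ n → Measurable[sigmaOf Z (Set.Ici (n : ℤ))] (X n))
    (hh : DegKernel F h δ M) {i j : ℕ} (hi : 1 ≤ i) (hij : i + 2 * l ≤ j)
    (hp : MomPair μ F h δ M (X i) (X j)) (hL0 : 0 ≤ L)
    (hL : LipOn h F (μ.map fun ω => (X i ω, X j ω)) L)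
    (hK : 1 ≤ K) (hηK : η = K ^ (-(2 + δ))) {G : ℤ → ℤ → ℝ} (hGK : ∀ s t, |G s t| ≤ K)
    (hG : ∫⁻ z, ENNReal.ofReal |h z.1 z.2 - G (c z.1) (c z.2)| ∂(F.prod F)
      ≤ ENNReal.ofReal ((4 * L + M) * K ^ (-(1 + δ)))) :
    ∫ ω, |h (X i ω) (X j ω) - G (W i ω) (W j ω)| ∂μ
      ≤ (5 * L + 2 * M + 12) * K ^ (-(1 + δ)) := by
  have hK0 : 0 < K := by linarith
  have hM := hh.M_nonneg
  have hδ := hh.δ_pos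
  have hj : 1 ≤ j := by omega
  have hZle : ∀ S : Set ℤ, sigmaOf Z S ≤ ‹MeasurableSpace Ω› := fun S => sigmaOf_le fun i _ => hZ i
  have hc := hca.measurable_cell
  have hηK1 : η ≤ K ^ (-(1 + δ)) := by
    rw [hηK]
    exact Real.rpow_le_rpow_of_exponent_le hK (by linarith)
  have hKη : K * η = K ^ (-(1 + δ)) := by
    rw [hηK, ← Real.rpow_one_add' hK0.le (by linarith)]; congr 1; ring
  have hGm : Measurable fun z : ℤ × ℤ => G z.1 z.2 := measurable_of_countable _
  have hm : Measurable fun z : ℝ × ℝ => h z.1 z.2 := hh.meas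
  have hX := hp.measU.prodMk hp.measV
  set π := μ.map fun ω => (X i ω, X j ω) with hπ
  have hπp : IsProbabilityMeasure π := Measure.isProbabilityMeasure_map hX.aemeasurable
  have hfst : π.fst = F := by rw [hπ, Measure.fst_map_prodMk hp.measV, hp.lawU]
  have hsnd : π.snd = F := by rw [hπ, Measure.snd_map_prodMk hp.measU, hp.lawV]
  have hW : ∀ n, 1 ≤ n → Measurable (W n) := fun n hn =>
    (hca.measurable_window n hn).mono (hZle _) le_rfl
  -- coupling of `X i` with a variable independent of `X j`
  have hdep : DepLE μ (fun ω => c (X i ω)) (X j) (ENNReal.ofReal (4 * η)) := by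
    have hXj : Measurable[sigmaOf Z (Set.Ici ((i + l : ℕ) + l : ℤ))] (X j) := by
      refine (hXm j hj).mono (sigmaOf_mono (Set.Ici_subset_Ici.2 ?_)) le_rfl
      push_cast; omega
    have h1 := hca.depLE hη hZ hi le_rfl hp.measU (A := fun _ => ())
      (@measurable_const _ _ _ (sigmaOf Z _) _) hXj
    exact h1.comp ((hc.comp hp.measU).prodMk measurable_const) hp.measV measurable_fst measurable_id
  obtain ⟨ρ, hρ1, hρ2, hρ3⟩ := exists_cell_coupling π hc (p := ENNReal.ofReal (4 * η)) (by
    intro S hS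
    have h1 := hdep S hS
    have e1 : π.fst.map c = μ.map fun ω => c (X i ω) := by
      rw [hfst, ← hp.lawU, Measure.map_map hc hp.measU]; rfl
    have e2 : π.map (fun z => (c z.1, z.2)) = μ.map fun ω => (c (X i ω), X j ω) := by
      rw [hπ, Measure.map_map (by fun_prop) hX]; rfl
    rw [e1, e2, hsnd, ← hp.lawV]
    exact h1)
  rw [hfst, hsnd] at hρ2
  have hρp : IsProbabilityMeasure ρ := by
    refine ⟨?_⟩
    have h1 := congrArg (fun ν => ν Set.univ) hρ1
    simpa [Measure.map_apply (by fun_prop : Measurable fun t : ℝ × ℝ × ℝ => (t.1, t.2.2))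
      MeasurableSet.univ] using h1
  set E : Set (ℝ × ℝ × ℝ) := {t | c t.1 ≠ c t.2.1} with hE
  have hEm : MeasurableSet E := (measurableSet_eq_fun (hc.comp measurable_fst)
    (hc.comp measurable_snd.fst)).compl
  have hm1 : Measurable fun t : ℝ × ℝ × ℝ => h t.1 t.2.2 :=
    hm.comp (f := fun t : ℝ × ℝ × ℝ => (t.1, t.2.2)) (by fun_prop)
  have hmomρ : ∫⁻ t, ENNReal.ofReal (|h t.1 t.2.2| ^ (2 + δ)) ∂ρ ≤ ENNReal.ofReal M := by
    refine le_trans (le_of_eq ?_) hp.mom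
    have hmr : Measurable fun z : ℝ × ℝ => ENNReal.ofReal (|h z.1 z.2| ^ (2 + δ)) := by fun_prop
    have h1 : ∫⁻ z, ENNReal.ofReal (|h z.1 z.2| ^ (2 + δ)) ∂π
        = ∫⁻ ω, ENNReal.ofReal (|h (X i ω) (X j ω)| ^ (2 + δ)) ∂μ := lintegral_map hmr hX
    rw [← h1, ← hρ1, lintegral_map hmr (by fun_prop)]
  have hmd : Measurable fun z : ℝ × ℝ => ENNReal.ofReal |h z.1 z.2 - G (c z.1) (c z.2)| :=
    (hm.sub (hGm.comp ((hc.comp measurable_fst).prodMk (hc.comp measurable_snd)))).abs.ennreal_ofReal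
  have hcells : ∫⁻ ω, ENNReal.ofReal |h (X i ω) (X j ω) - G (c (X i ω)) (c (X j ω))| ∂μ
      ≤ ENNReal.ofReal (L * η + (4 * L + M) * K ^ (-(1 + δ)) + (K ^ (-(1 + δ)) * M + 8 * (K * η))) := by
    have h1 : ∫⁻ z, ENNReal.ofReal |h z.1 z.2 - G (c z.1) (c z.2)| ∂π
        = ∫⁻ ω, ENNReal.ofReal |h (X i ω) (X j ω) - G (c (X i ω)) (c (X j ω))| ∂μ :=
      lintegral_map hmd hX
    have h2 : ∫⁻ z, ENNReal.ofReal |h z.1 z.2 - G (c z.1) (c z.2)| ∂π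
        = ∫⁻ t, ENNReal.ofReal |h t.1 t.2.2 - G (c t.1) (c t.2.2)| ∂ρ := by
      rw [← hρ1, lintegral_map hmd (by fun_prop)]
    have h3 : ∫⁻ t, ENNReal.ofReal |h t.2.1 t.2.2 - G (c t.2.1) (c t.2.2)| ∂ρ
        ≤ ENNReal.ofReal ((4 * L + M) * K ^ (-(1 + δ))) := by
      refine le_trans (le_of_eq ?_) hG
      rw [← hρ2, lintegral_map hmd (by fun_prop)]
    have hme : Measurable fun t : ℝ × ℝ × ℝ => E.indicator
        (fun t => ENNReal.ofReal |h t.1 t.2.2| + ENNReal.ofReal K) t :=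
      (hm1.abs.ennreal_ofReal.add measurable_const).indicator hEm
    have hmd2 : Measurable fun t : ℝ × ℝ × ℝ =>
        ENNReal.ofReal |h t.2.1 t.2.2 - G (c t.2.1) (c t.2.2)| := hmd.comp measurable_snd
    rw [← h1, h2]
    calc ∫⁻ t, ENNReal.ofReal |h t.1 t.2.2 - G (c t.1) (c t.2.2)| ∂ρ
        ≤ ∫⁻ t, (Set.indicator {t : ℝ × ℝ × ℝ | |t.1 - t.2.1| ≤ η}
              (fun t => ENNReal.ofReal |h t.1 t.2.2 - h t.2.1 t.2.2|) t
            + ENNReal.ofReal |h t.2.1 t.2.2 - G (c t.2.1) (c t.2.2)|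
            + E.indicator (fun t => ENNReal.ofReal |h t.1 t.2.2| + ENNReal.ofReal K) t) ∂ρ := by
          refine lintegral_mono fun t => ?_
          by_cases ht : c t.1 = c t.2.1
          · have hmem : t ∈ {t : ℝ × ℝ × ℝ | |t.1 - t.2.1| ≤ η} := hca.cell_le _ _ ht
            rw [Set.indicator_of_mem hmem]
            refine le_trans ?_ le_self_add
            rw [← ENNReal.ofReal_add (abs_nonneg _) (abs_nonneg _), ht]
            exact ENNReal.ofReal_le_ofReal (abs_sub_le _ _ _)
          · rw [Set.indicator_of_mem (s := E) ht]
            refine le_trans ?_ le_add_self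
            rw [← ENNReal.ofReal_add (abs_nonneg _) hK0.le]
            refine ENNReal.ofReal_le_ofReal ?_
            have h4 := abs_sub (h t.1 t.2.2) (G (c t.1) (c t.2.2))
            have h5 := hGK (c t.1) (c t.2.2)
            linarith
      _ = ∫⁻ t, Set.indicator {t : ℝ × ℝ × ℝ | |t.1 - t.2.1| ≤ η}
              (fun t => ENNReal.ofReal |h t.1 t.2.2 - h t.2.1 t.2.2|) t ∂ρ
            + ∫⁻ t, ENNReal.ofReal |h t.2.1 t.2.2 - G (c t.2.1) (c t.2.2)| ∂ρ
            + (∫⁻ t in E, ENNReal.ofReal |h t.1 t.2.2| ∂ρ + ENNReal.ofReal K * ρ E) := by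
          rw [lintegral_add_right _ hme, lintegral_add_right _ hmd2, lintegral_indicator hEm,
            lintegral_add_left hm1.abs.ennreal_ofReal, setLIntegral_const]
      _ ≤ ENNReal.ofReal (L * η) + ENNReal.ofReal ((4 * L + M) * K ^ (-(1 + δ)))
            + (ENNReal.ofReal K * ENNReal.ofReal (4 * η) + ENNReal.ofReal (K ^ (-(1 + δ)) * M)
              + ENNReal.ofReal K * ENNReal.ofReal (4 * η)) := by
          gcongr
          · exact hL η hη ρ hρp hρ1 hρ2
          · refine (setLIntegral_abs_le_of_mom hm1 hδ hmomρ hK0 E).trans ?_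
            gcongr
      _ = _ := by
          rw [← ENNReal.ofReal_mul hK0.le, ← ENNReal.ofReal_add (by positivity) (by positivity),
            ← ENNReal.ofReal_add (by positivity) (by positivity),
            ← ENNReal.ofReal_add (by positivity) (by positivity),
            ← ENNReal.ofReal_add (by positivity) (by positivity)]
          congr 1; ring
  have hind : ∀ n, 1 ≤ n → Measurable (X n) → Measurable fun ω =>
      Set.indicator {ω | c (X n ω) ≠ W n ω} (fun _ => ENNReal.ofReal (2 * K)) ω :=
    fun n hn hXn => measurable_const.indicator
      (measurableSet_eq_fun (hc.comp hXn) (hW n hn)).compl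
  have hindle : ∀ n, 1 ≤ n → Measurable (X n) →
      ∫⁻ ω, Set.indicator {ω | c (X n ω) ≠ W n ω} (fun _ => ENNReal.ofReal (2 * K)) ω ∂μ
        ≤ ENNReal.ofReal (2 * (K * η)) := by
    intro n hn hXn
    have hs : MeasurableSet {ω | c (X n ω) ≠ W n ω} :=
      (measurableSet_eq_fun (hc.comp hXn) (hW n hn)).compl
    rw [lintegral_indicator_const hs]
    calc _ ≤ ENNReal.ofReal (2 * K) * ENNReal.ofReal η := by gcongr; exact hca.measure_ne_le n hn
      _ = _ := by rw [← ENNReal.ofReal_mul (by positivity), mul_assoc]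
  have hmW : Measurable fun ω => h (X i ω) (X j ω) - G (W i ω) (W j ω) :=
    (hm.comp hX).sub (hGm.comp ((hW i hi).prodMk (hW j hj)))
  have hmC : Measurable fun ω =>
      ENNReal.ofReal |h (X i ω) (X j ω) - G (c (X i ω)) (c (X j ω))| := hmd.comp hX
  rw [integral_eq_lintegral_of_nonneg_ae (Eventually.of_forall fun ω => abs_nonneg _)
    hmW.abs.aestronglyMeasurable]
  refine ENNReal.toReal_le_of_le_ofReal (by positivity) ?_
  calc ∫⁻ ω, ENNReal.ofReal |h (X i ω) (X j ω) - G (W i ω) (W j ω)| ∂μ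
      ≤ ∫⁻ ω, (ENNReal.ofReal |h (X i ω) (X j ω) - G (c (X i ω)) (c (X j ω))|
          + (Set.indicator {ω | c (X i ω) ≠ W i ω} (fun _ => ENNReal.ofReal (2 * K)) ω
            + Set.indicator {ω | c (X j ω) ≠ W j ω} (fun _ => ENNReal.ofReal (2 * K)) ω)) ∂μ := by
        refine lintegral_mono fun ω => ?_
        by_cases h1 : c (X i ω) = W i ω ∧ c (X j ω) = W j ω
        · rw [h1.1, h1.2]; exact le_self_add
        · have h2 : ENNReal.ofReal (2 * K)
              ≤ Set.indicator {ω | c (X i ω) ≠ W i ω} (fun _ => ENNReal.ofReal (2 * K)) ω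
            + Set.indicator {ω | c (X j ω) ≠ W j ω} (fun _ => ENNReal.ofReal (2 * K)) ω := by
            rcases not_and_or.1 h1 with h3 | h3
            · refine le_trans (le_of_eq ?_) le_self_add
              rw [Set.indicator_of_mem h3]
            · refine le_trans (le_of_eq ?_) le_add_self
              rw [Set.indicator_of_mem h3]
          refine le_trans ?_ (add_le_add le_rfl h2)
          rw [← ENNReal.ofReal_add (abs_nonneg _) (by positivity)]
          refine ENNReal.ofReal_le_ofReal ?_
          have h4 := abs_sub_le (h (X i ω) (X j ω)) (G (c (X i ω)) (c (X j ω))) (G (W i ω) (W j ω))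
          have h5 := abs_sub (G (c (X i ω)) (c (X j ω))) (G (W i ω) (W j ω))
          have h6 := hGK (c (X i ω)) (c (X j ω))
          have h7 := hGK (W i ω) (W j ω)
          linarith
    _ = ∫⁻ ω, ENNReal.ofReal |h (X i ω) (X j ω) - G (c (X i ω)) (c (X j ω))| ∂μ
          + (∫⁻ ω, Set.indicator {ω | c (X i ω) ≠ W i ω} (fun _ => ENNReal.ofReal (2 * K)) ω ∂μ
          + ∫⁻ ω, Set.indicator {ω | c (X j ω) ≠ W j ω} (fun _ => ENNReal.ofReal (2 * K)) ω ∂μ) := by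
        rw [lintegral_add_left hmC, lintegral_add_left (hind i hi hp.measU)]
    _ ≤ ENNReal.ofReal (L * η + (4 * L + M) * K ^ (-(1 + δ)) + (K ^ (-(1 + δ)) * M + 8 * (K * η)))
          + (ENNReal.ofReal (2 * (K * η)) + ENNReal.ofReal (2 * (K * η))) :=
        add_le_add hcells (add_le_add (hindle i hi hp.measU) (hindle j hj hp.measV))
    _ ≤ _ := by
        rw [← ENNReal.ofReal_add (by positivity) (by positivity),
            ← ENNReal.ofReal_add (by positivity) (by positivity)]
        refine ENNReal.ofReal_le_ofReal ?_
        have h1 : L * η ≤ L * K ^ (-(1 + δ)) := by gcongr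
        rw [hKη]
        linarith

end CellCovariance


lemma integrable_mul_of_bounded_left {Ω : Type*} [MeasurableSpace Ω] {μ : Measure Ω}
    {K : ℝ} {X₂ Y₁ : Ω → ℝ} (hX : Integrable X₂ μ) (hY : Measurable Y₁)
    (hYK : ∀ ω, |Y₁ ω| ≤ K) : Integrable (fun ω => Y₁ ω * X₂ ω) μ :=
  hX.bdd_mul hY.aestronglyMeasurable (Eventually.of_forall hYK)

/-! ### Bounded approximations in means of products -/

section BoundedApproximation
variable {Ω : Type*} [MeasurableSpace Ω] {μ : Measure Ω} [IsProbabilityMeasure μ]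
  {δ M D K K₁ K₂ : ℝ} {X₁ X₂ Y₁ Y₂ : Ω → ℝ}

lemma mul_rpow_neg_one_add (hK : 0 < K) (hδ : 0 < δ) : K * K ^ (-(1 + δ)) = K ^ (-δ) := by
  rw [← Real.rpow_one_add' hK.le (by linarith)]; congr 1; ring

/-- Replacing both factors of a mean of a product by bounded `L¹`-approximations. -/
lemma abs_integral_mul_le_of_approx (hδ : 0 < δ) (hM : 0 ≤ M) (hD : 0 ≤ D) (hK : 0 < K)
    (hK₁ : K ≤ K₁) (hK₂ : K ≤ K₂) (hX₁ : Measurable X₁) (hX₂ : Measurable X₂)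
    (hY₁ : Measurable Y₁) (hY₂ : Measurable Y₂)
    (hm₁ : ∫⁻ ω, ENNReal.ofReal (|X₁ ω| ^ (2 + δ)) ∂μ ≤ ENNReal.ofReal M)
    (hm₂ : ∫⁻ ω, ENNReal.ofReal (|X₂ ω| ^ (2 + δ)) ∂μ ≤ ENNReal.ofReal M)
    (hb₁ : ∀ ω, |Y₁ ω| ≤ K₁) (hb₂ : ∀ ω, |Y₂ ω| ≤ K₂)
    (hd₁ : ∫ ω, |X₁ ω - Y₁ ω| ∂μ ≤ D * K₁ ^ (-(1 + δ)))
    (hd₂ : ∫ ω, |X₂ ω - Y₂ ω| ∂μ ≤ D * K₂ ^ (-(1 + δ))) :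
    |∫ ω, Y₁ ω * Y₂ ω ∂μ| ≤ |∫ ω, X₁ ω * X₂ ω ∂μ| + (6 * D + 14 * M) * K ^ (-δ) := by
  have hK₁0 : 0 < K₁ := by linarith
  have hK₂0 : 0 < K₂ := by linarith
  have hk₁ : K₁ ^ (-δ) ≤ K ^ (-δ) := Real.rpow_le_rpow_of_nonpos hK hK₁ (by linarith)
  have hk₂ : K₂ ^ (-δ) ≤ K ^ (-δ) := Real.rpow_le_rpow_of_nonpos hK hK₂ (by linarith)
  have e₁ : K₁ * (D * K₁ ^ (-(1 + δ))) = D * K₁ ^ (-δ) := by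
    rw [← mul_rpow_neg_one_add hK₁0 hδ]; ring
  have e₂ : K₂ * (D * K₂ ^ (-(1 + δ))) = D * K₂ ^ (-δ) := by
    rw [← mul_rpow_neg_one_add hK₂0 hδ]; ring
  have a₁ := integral_abs_sub_mul_le hX₁ hY₁ hX₂ hδ hM hK₁0 hm₁ hm₂ hb₁ hd₁
  have a₂ := integral_abs_sub_mul_le hX₂ hY₂ hX₁ hδ hM hK₂0 hm₂ hm₁ hb₂ hd₂
  have s₁ := integral_sub_sq_le hX₁ hY₁ hδ hM hK₁0 hm₁ hb₁ hd₁
  have s₂ := integral_sub_sq_le hX₂ hY₂ hδ hM hK₂0 hm₂ hb₂ hd₂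
  rw [e₁] at a₁ s₁
  rw [e₂] at a₂ s₂
  have iX₁ := integrable_of_mom hX₁ hδ hm₁
  have iX₂ := integrable_of_mom hX₂ hδ hm₂
  have iXX := integrable_mul_of_mom hX₁ hX₂ hδ hm₁ hm₂
  have i₁ : Integrable (fun ω => (X₁ ω - Y₁ ω) * X₂ ω) μ := by
    simp only [sub_mul]
    exact iXX.sub (integrable_mul_of_bounded_left iX₂ hY₁ hb₁)
  have i₂ : Integrable (fun ω => (X₂ ω - Y₂ ω) * X₁ ω) μ := by
    have := iXX.sub (integrable_mul_of_bounded_left iX₁ hY₂ hb₂)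
    refine this.congr (Eventually.of_forall fun ω => ?_)
    simp only [Pi.sub_apply]; ring
  have i₃ : Integrable (fun ω => (X₁ ω - Y₁ ω) ^ 2 + (X₂ ω - Y₂ ω) ^ 2) μ := s₁.1.add s₂.1
  have hpt : ∀ ω, |Y₁ ω * Y₂ ω - X₁ ω * X₂ ω| ≤ |(X₁ ω - Y₁ ω) * X₂ ω| + |(X₂ ω - Y₂ ω) * X₁ ω|
      + ((X₁ ω - Y₁ ω) ^ 2 + (X₂ ω - Y₂ ω) ^ 2) := by
    intro ω
    have h1 : Y₁ ω * Y₂ ω - X₁ ω * X₂ ω = -((X₁ ω - Y₁ ω) * X₂ ω) - (X₂ ω - Y₂ ω) * X₁ ω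
      + (X₁ ω - Y₁ ω) * (X₂ ω - Y₂ ω) := by ring
    have h2 : |(X₁ ω - Y₁ ω) * (X₂ ω - Y₂ ω)| ≤ (X₁ ω - Y₁ ω) ^ 2 + (X₂ ω - Y₂ ω) ^ 2 := by
      rw [abs_le]
      constructor <;> nlinarith [sq_nonneg (X₁ ω - Y₁ ω + (X₂ ω - Y₂ ω)),
        sq_nonneg (X₁ ω - Y₁ ω - (X₂ ω - Y₂ ω)), sq_nonneg (X₁ ω - Y₁ ω), sq_nonneg (X₂ ω - Y₂ ω)]
    rw [h1]
    have h3 := abs_add_le (-((X₁ ω - Y₁ ω) * X₂ ω) - (X₂ ω - Y₂ ω) * X₁ ω)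
      ((X₁ ω - Y₁ ω) * (X₂ ω - Y₂ ω))
    have h4 := abs_sub (-((X₁ ω - Y₁ ω) * X₂ ω)) ((X₂ ω - Y₂ ω) * X₁ ω)
    rw [abs_neg] at h4
    linarith
  have iY : Integrable (fun ω => Y₁ ω * Y₂ ω) μ :=
    integrable_mul_of_bounded_left (Integrable.of_bound hY₂.aestronglyMeasurable K₂
      (Eventually.of_forall hb₂)) hY₁ hb₁
  have hdiff : |∫ ω, Y₁ ω * Y₂ ω ∂μ - ∫ ω, X₁ ω * X₂ ω ∂μ| ≤ (6 * D + 14 * M) * K ^ (-δ) := by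
    rw [← integral_sub iY iXX]
    calc _ ≤ ∫ ω, |Y₁ ω * Y₂ ω - X₁ ω * X₂ ω| ∂μ := abs_integral_le_integral_abs
      _ ≤ ∫ ω, (|(X₁ ω - Y₁ ω) * X₂ ω| + |(X₂ ω - Y₂ ω) * X₁ ω|
          + ((X₁ ω - Y₁ ω) ^ 2 + (X₂ ω - Y₂ ω) ^ 2)) ∂μ :=
        integral_mono (iY.sub iXX).abs ((i₁.abs.add i₂.abs).add i₃) hpt
      _ = ∫ ω, |(X₁ ω - Y₁ ω) * X₂ ω| ∂μ + ∫ ω, |(X₂ ω - Y₂ ω) * X₁ ω| ∂μ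
          + (∫ ω, (X₁ ω - Y₁ ω) ^ 2 ∂μ + ∫ ω, (X₂ ω - Y₂ ω) ^ 2 ∂μ) := by
        have j₁ : Integrable (fun ω => |(X₁ ω - Y₁ ω) * X₂ ω| + |(X₂ ω - Y₂ ω) * X₁ ω|) μ :=
          i₁.abs.add i₂.abs
        rw [integral_add j₁ i₃, integral_add i₁.abs i₂.abs, integral_add s₁.1 s₂.1]
      _ ≤ (D * K₁ ^ (-δ) + 3 * (K₁ ^ (-δ) * M)) + (D * K₂ ^ (-δ) + 3 * (K₂ ^ (-δ) * M))
          + ((2 * (D * K₁ ^ (-δ)) + 4 * (K₁ ^ (-δ) * M))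
          + (2 * (D * K₂ ^ (-δ)) + 4 * (K₂ ^ (-δ) * M))) := by
        gcongr
        exacts [s₁.2, s₂.2]
      _ = (3 * D + 7 * M) * K₁ ^ (-δ) + (3 * D + 7 * M) * K₂ ^ (-δ) := by ring
      _ ≤ (3 * D + 7 * M) * K ^ (-δ) + (3 * D + 7 * M) * K ^ (-δ) := by gcongr
      _ = (6 * D + 14 * M) * K ^ (-δ) := by ring
  have h1 := abs_sub_abs_le_abs_sub (∫ ω, Y₁ ω * Y₂ ω ∂μ) (∫ ω, X₁ ω * X₂ ω ∂μ)
  linarith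

/-- Replacing the first factor of a mean of a product by a bounded `L¹`-approximation, when the second
factor is bounded. -/
lemma abs_integral_mul_le_of_approx_of_bounded (hδ : 0 < δ) (hD : 0 ≤ D) (hK : 0 < K)
    (hK₁ : K ≤ K₁) (hX₁ : Measurable X₁) (hY₁ : Measurable Y₁) (hY₂ : Measurable Y₂)
    (hm₁ : ∫⁻ ω, ENNReal.ofReal (|X₁ ω| ^ (2 + δ)) ∂μ ≤ ENNReal.ofReal M)
    (hb₁ : ∀ ω, |Y₁ ω| ≤ K₁) (hb₂ : ∀ ω, |Y₂ ω| ≤ K)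
    (hd₁ : ∫ ω, |X₁ ω - Y₁ ω| ∂μ ≤ D * K₁ ^ (-(1 + δ))) :
    |∫ ω, Y₁ ω * Y₂ ω ∂μ| ≤ |∫ ω, X₁ ω * Y₂ ω ∂μ| + D * K ^ (-δ) := by
  have hK₁0 : 0 < K₁ := by linarith
  have iX₁ := integrable_of_mom hX₁ hδ hm₁
  have iY₁ : Integrable Y₁ μ :=
    Integrable.of_bound hY₁.aestronglyMeasurable K₁ (Eventually.of_forall hb₁)
  have i₁ : Integrable (fun ω => Y₂ ω * Y₁ ω) μ := integrable_mul_of_bounded_left iY₁ hY₂ hb₂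
  have i₂ : Integrable (fun ω => Y₂ ω * X₁ ω) μ := integrable_mul_of_bounded_left iX₁ hY₂ hb₂
  have hdiff : |∫ ω, Y₂ ω * Y₁ ω ∂μ - ∫ ω, Y₂ ω * X₁ ω ∂μ| ≤ D * K ^ (-δ) := by
    rw [← integral_sub i₁ i₂]
    calc _ ≤ ∫ ω, |Y₂ ω * Y₁ ω - Y₂ ω * X₁ ω| ∂μ := abs_integral_le_integral_abs
      _ ≤ ∫ ω, K * |X₁ ω - Y₁ ω| ∂μ := by
        refine integral_mono (i₁.sub i₂).abs ((iX₁.sub iY₁).abs.const_mul K) fun ω => ?_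
        simp only
        rw [← mul_sub, abs_mul, abs_sub_comm (Y₁ ω)]
        exact mul_le_mul_of_nonneg_right (hb₂ ω) (abs_nonneg _)
      _ = K * ∫ ω, |X₁ ω - Y₁ ω| ∂μ := integral_const_mul _ _
      _ ≤ K * (D * K ^ (-(1 + δ))) := by
        have : K₁ ^ (-(1 + δ)) ≤ K ^ (-(1 + δ)) :=
          Real.rpow_le_rpow_of_nonpos hK hK₁ (by linarith)
        gcongr
        exact hd₁.trans (by gcongr)
      _ = _ := by rw [← mul_rpow_neg_one_add hK hδ]; ring
  have h1 := abs_sub_abs_le_abs_sub (∫ ω, Y₂ ω * Y₁ ω ∂μ) (∫ ω, Y₂ ω * X₁ ω ∂μ)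
  simp only [mul_comm (Y₂ _)] at h1 hdiff
  linarith

lemma abs_integral_mul_le_of_mom (hδ : 0 < δ) (hM : 0 ≤ M) (hX₁ : Measurable X₁)
    (hX₂ : Measurable X₂)
    (hm₁ : ∫⁻ ω, ENNReal.ofReal (|X₁ ω| ^ (2 + δ)) ∂μ ≤ ENNReal.ofReal M)
    (hm₂ : ∫⁻ ω, ENNReal.ofReal (|X₂ ω| ^ (2 + δ)) ∂μ ≤ ENNReal.ofReal M) :
    |∫ ω, X₁ ω * X₂ ω ∂μ| ≤ 1 + 3 * M := by
  have hb : ∀ ω, |X₁ ω * X₂ ω| ≤ (1 + |X₂ ω| ^ (2 + δ)) + (|X₂ ω| ^ (2 + δ) + |X₁ ω| ^ (2 + δ)) := by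
    intro ω
    have h1 := abs_mul_le_add_rpow (x := X₁ ω) (y := X₂ ω) one_pos hδ
    have h2 := le_add_rpow one_pos (abs_nonneg (X₂ ω)) hδ
    simp only [Real.one_rpow, one_mul] at h1 h2
    linarith
  have r₁ := integrable_rpow_of_mom hX₁ hm₁
  have r₂ := integrable_rpow_of_mom hX₂ hm₂
  have j₁ : Integrable (fun ω => 1 + |X₂ ω| ^ (2 + δ)) μ := (integrable_const _).add r₂
  have j₂ : Integrable (fun ω => |X₂ ω| ^ (2 + δ) + |X₁ ω| ^ (2 + δ)) μ := r₂.add r₁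
  calc _ ≤ ∫ ω, |X₁ ω * X₂ ω| ∂μ := abs_integral_le_integral_abs
    _ ≤ ∫ ω, ((1 + |X₂ ω| ^ (2 + δ)) + (|X₂ ω| ^ (2 + δ) + |X₁ ω| ^ (2 + δ))) ∂μ :=
      integral_mono (integrable_mul_of_mom hX₁ hX₂ hδ hm₁ hm₂).abs (j₁.add j₂) hb
    _ = 1 + ∫ ω, |X₂ ω| ^ (2 + δ) ∂μ + (∫ ω, |X₂ ω| ^ (2 + δ) ∂μ + ∫ ω, |X₁ ω| ^ (2 + δ) ∂μ) := by
      rw [integral_add j₁ j₂, integral_add (integrable_const _) r₂, integral_add r₂ r₁]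
      simp
    _ ≤ _ := by
      have h1 := integral_rpow_le_of_mom hX₁ hM hm₁
      have h2 := integral_rpow_le_of_mom hX₂ hM hm₂
      linarith

end BoundedApproximation

/-- Each `l` equals `(m - 1) / 2` for at most two `m ≥ 1`, and `m + 1 ≤ 3 (l + 1)` for these. -/
lemma sum_half_le {f : ℕ → ℝ} (hf : ∀ m, 0 ≤ f m) {N : ℕ} (hN : 1 ≤ N) :
    ∑ m ∈ Finset.range N, ((m : ℝ) + 1) * f ((m - 1) / 2)
      ≤ 9 * ∑ l ∈ Finset.range N, ((l : ℝ) + 1) * f l := by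
  set g : ℕ → ℝ := fun l => ((l : ℝ) + 1) * f l with hg
  have hg0 : ∀ l, 0 ≤ g l := fun l => mul_nonneg (by positivity) (hf l)
  have h1 : ∀ m : ℕ, ((m : ℝ) + 1) * f ((m - 1) / 2) ≤ 3 * g ((m - 1) / 2) := by
    intro m
    have h2 : m + 1 ≤ 3 * ((m - 1) / 2 + 1) := by omega
    have h3 : (m : ℝ) + 1 ≤ 3 * (((m - 1) / 2 : ℕ) + 1) := by exact_mod_cast h2
    simp only [hg]
    rw [← mul_assoc]
    exact mul_le_mul_of_nonneg_right h3 (hf _)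
  have h2 : ∀ k : ℕ, ∑ m ∈ Finset.range (2 * k + 1), g ((m - 1) / 2)
      = g 0 + 2 * ∑ l ∈ Finset.range k, g l := by
    intro k
    induction k with
    | zero => simp
    | succ k ih =>
      rw [show 2 * (k + 1) + 1 = 2 * k + 1 + 1 + 1 by ring, Finset.sum_range_succ,
        Finset.sum_range_succ, ih, Finset.sum_range_succ]
      have e1 : (2 * k + 1 - 1) / 2 = k := by omega
      have e2 : (2 * k + 1 + 1 - 1) / 2 = k := by omega
      rw [e1, e2]; ring
  have h3 : g 0 ≤ ∑ l ∈ Finset.range N, g l :=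
    Finset.single_le_sum (f := g) (fun l _ => hg0 l) (Finset.mem_range.2 hN)
  have h4 : ∑ l ∈ Finset.range (N / 2), g l ≤ ∑ l ∈ Finset.range N, g l :=
    Finset.sum_le_sum_of_subset_of_nonneg (Finset.range_mono (Nat.div_le_self _ _)) fun l _ _ => hg0 l
  calc ∑ m ∈ Finset.range N, ((m : ℝ) + 1) * f ((m - 1) / 2)
      ≤ ∑ m ∈ Finset.range N, 3 * g ((m - 1) / 2) := Finset.sum_le_sum fun m _ => h1 m
    _ ≤ ∑ m ∈ Finset.range (2 * (N / 2) + 1), 3 * g ((m - 1) / 2) :=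
        Finset.sum_le_sum_of_subset_of_nonneg (Finset.range_mono (by omega)) fun m _ _ => by
          have := hg0 ((m - 1) / 2)
          positivity
    _ = 3 * (g 0 + 2 * ∑ l ∈ Finset.range (N / 2), g l) := by rw [← Finset.mul_sum, h2]
    _ ≤ _ := by linarith


/-! ### Functionals of absolutely regular processes -/

section FunctionalCase
variable {Ω : Type*} [MeasurableSpace Ω] {μ : Measure Ω} [IsProbabilityMeasure μ]
  {X : ℕ → Ω → ℝ} {Z : ℤ → Ω → ℝ} {F : Measure ℝ} {h : ℝ → ℝ → ℝ} {δ τ M L : ℝ}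

/-- Every pair `(i, j)` gets a window approximation `Y` of `h (X i) (X j)` whose resolution depends on
`j - i`. The error is negligible in `L²`, so it needs no covariance bound; the covariances of `Y`
are bounded because `Y` is bounded and measurable with respect to windows, or, for distant pairs,
because it can be exchanged for `h (X i) (X j)`. -/
lemma maxSqBound_of_cellApprox [IsProbabilityMeasure F] {η : ℕ → ℝ} {c : ℕ → ℝ → ℤ}
    {W : ℕ → ℕ → Ω → ℤ}
    (hZ : ∀ n, Measurable (Z n))
    (hXm : ∀ n : ℕ, 1 ≤ n → Measurable[sigmaOf Z (Set.Ici (n : ℤ))] (X n))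
    (hca : ∀ l, CellApprox μ Z X (η l) l (c l) (W l)) (hη : ∀ l, 0 < η l) (hη0 : η 0 = 1)
    (hanti : Antitone η) (hh : DegKernel F h δ M)
    (hp : ∀ i j, 1 ≤ i → i < j → MomPair μ F h δ M (X i) (X j)) (hL0 : 0 ≤ L)
    (hLF : LipOn h F (F.prod F) L)
    (hL : ∀ i j, 1 ≤ i → i < j → LipOn h F (μ.map fun ω => (X i ω, X j ω)) L) {C : ℝ} (hC : 0 ≤ C)
    (hsum : ∀ N : ℕ, 1 ≤ N →
      ∑ m ∈ Finset.range N, ((m : ℝ) + 1) * η ((m - 1) / 2) ^ (δ / (2 + δ)) ≤ C * (N : ℝ) ^ τ) :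
    MaxSqBound μ (fun n ω => ∑ i ∈ Finset.Icc 1 n, ∑ j ∈ Finset.Ioc i n, h (X i ω) (X j ω)) τ := by
  have hδ := hh.δ_pos
  have hM := hh.M_nonneg
  have hZle : ∀ S : Set ℤ, sigmaOf Z S ≤ ‹MeasurableSpace Ω› := fun S => sigmaOf_le fun i _ => hZ i
  set K : ℕ → ℝ := fun l => η l ^ (-(1 / (2 + δ))) with hKd
  have hη1 : ∀ l, η l ≤ 1 := fun l => hη0 ▸ hanti (Nat.zero_le l)
  have hexp : -(1 / (2 + δ)) ≤ 0 := by
    have : 0 < 1 / (2 + δ) := by positivity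
    linarith
  have hK1 : ∀ l, 1 ≤ K l := fun l =>
    Real.one_le_rpow_of_pos_of_le_one_of_nonpos (hη l) (hη1 l) hexp
  have hKpos : ∀ l, 0 < K l := fun l => by linarith [hK1 l]
  have hηK : ∀ l, η l = K l ^ (-(2 + δ)) := fun l => by
    simp only [hKd]
    rw [← Real.rpow_mul (hη l).le]
    have : -(1 / (2 + δ)) * -(2 + δ) = 1 := by field_simp
    rw [this, Real.rpow_one]
  have hKe : ∀ l, K l ^ (-δ) = η l ^ (δ / (2 + δ)) := fun l => by
    simp only [hKd]
    rw [← Real.rpow_mul (hη l).le]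
    congr 1; ring
  have hKmono : Monotone K := fun l l' hll =>
    Real.rpow_le_rpow_of_nonpos (hη l') (hanti hll) hexp
  have hK0 : K 0 ^ (-δ) = 1 := by rw [hKe, hη0, Real.one_rpow]
  choose G hGK hG using fun l => exists_window_kernel (hca l).measurable_cell (hca l).cell_le (hη l) hh
    hL0 hLF (hK1 l) (hηK l)
  have hGm : ∀ l, Measurable fun z : ℤ × ℤ => G l z.1 z.2 := fun l => measurable_of_countable _
  have hGW : ∀ (l p q : ℕ) (S : Set ℤ), 1 ≤ p → 1 ≤ q →
      Set.Icc ((p : ℤ) - 1) ((p : ℤ) - 1 + l) ⊆ S → Set.Icc ((q : ℤ) - 1) ((q : ℤ) - 1 + l) ⊆ S →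
      Measurable[sigmaOf Z S] fun ω => G l (W l p ω) (W l q ω) := fun l p q S hp1 hq1 hpS hqS =>
    (hGm l).comp ((((hca l).measurable_window p hp1).mono (sigmaOf_mono hpS) le_rfl).prodMk
      (((hca l).measurable_window q hq1).mono (sigmaOf_mono hqS) le_rfl))
  have hGW0 : ∀ l p q : ℕ, 1 ≤ p → 1 ≤ q → Measurable fun ω => G l (W l p ω) (W l q ω) :=
    fun l p q hp1 hq1 => (hGW l p q Set.univ hp1 hq1 (Set.subset_univ _) (Set.subset_univ _)).mono
      (hZle _) le_rfl
  set D := 5 * L + 2 * M + 12 with hDd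
  have hD0 : 0 ≤ D := by positivity
  have hclose : ∀ l p q : ℕ, 1 ≤ p → p < q → p + 2 * l ≤ q →
      ∫ ω, |h (X p ω) (X q ω) - G l (W l p ω) (W l q ω)| ∂μ ≤ D * K l ^ (-(1 + δ)) :=
    fun l p q hp1 hpq hlq => (hca l).integral_abs_sub_le (hη l) hZ hXm hh hp1 hlq (hp p q hp1 hpq) hL0
      (hL p q hp1 hpq) (hK1 l) (hηK l) (hGK l) (hG l)
  have hhm : ∀ p q, 1 ≤ p → p < q → Measurable fun ω => h (X p ω) (X q ω) := fun p q hp1 hpq =>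
    hh.meas.comp ((hp p q hp1 hpq).measU.prodMk (hp p q hp1 hpq).measV)
  -- the scale used at distance `r`; twice its window length `w r` stays below `r`
  set w : ℕ → ℕ := fun r => (r - 1) / 2 with hwd
  have hw : ∀ r, 1 ≤ r → 2 * w r + 1 ≤ r := fun r hr => by simp only [hwd]; omega
  have hwmono : ∀ {r s}, r ≤ s → w r ≤ w s := fun {r s} hrs => by simp only [hwd]; omega
  set Y : ℕ → ℕ → Ω → ℝ := fun p q ω => G (w (q - p)) (W (w (q - p)) p ω) (W (w (q - p)) q ω) with hYd
  have hYm : ∀ p q, 1 ≤ p → p < q → Measurable (Y p q) := fun p q hp1 hpq =>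
    hGW0 _ _ _ hp1 (by omega)
  have hYK : ∀ p q ω, |Y p q ω| ≤ K (w (q - p)) := fun p q ω => hGK _ _ _
  have hYd1 : ∀ p q, 1 ≤ p → p < q →
      ∫ ω, |h (X p ω) (X q ω) - Y p q ω| ∂μ ≤ D * K (w (q - p)) ^ (-(1 + δ)) := fun p q hp1 hpq =>
    hclose _ p q hp1 hpq (by have := hw (q - p) (by omega); omega)
  set B := 2 * L + 16 + 6 * M with hBd
  have hB0 : 0 ≤ B := by positivity
  have hcov : ∀ l i j n : ℕ, ∀ H : Ω → ℝ, 1 ≤ i → i ≤ n → n + 2 * l ≤ j → i < j →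
      (Measurable[sigmaOf Z (Set.Iic ((n + l : ℕ) : ℤ))] H ∨
        Measurable[sigmaOf Z (Set.Ici ((n + l : ℕ) + l : ℤ))] H) →
      ((∀ ω, |H ω| ≤ K l) ∨ ∫⁻ ω, ENNReal.ofReal (|H ω| ^ (2 + δ)) ∂μ ≤ ENNReal.ofReal M) →
      |∫ ω, H ω * h (X i ω) (X j ω) ∂μ| ≤ B * K l ^ (-δ) :=
    fun l i j n H hi hin hnj hij hH hHK => (hca l).abs_integral_mul_le (hη l) hZ hXm hh hi hin hnj
      (hp i j hi hij) hL0 (hL i j hi hij) (hK1 l) (hηK l) hH hHK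
  set A := (1 + 3 * M) + B + (6 * D + 14 * M) + (D + 3 * M) with hAd
  have hA0 : 0 ≤ A := by positivity
  set ψ : ℕ → ℝ := fun m => A * η (w m) ^ (δ / (2 + δ)) with hψd
  have hψ0 : ∀ m, 0 ≤ ψ m := fun m => mul_nonneg hA0 (Real.rpow_nonneg (hη _).le _)
  have hψK : ∀ m, ψ m = A * K (w m) ^ (-δ) := fun m => by simp only [hψd, hKe]
  have hKδ : ∀ l, 0 ≤ K l ^ (-δ) := fun l => Real.rpow_nonneg (hKpos l).le _
  have hψsum : ∀ N : ℕ, 1 ≤ N →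
      ∑ m ∈ Finset.range N, ((m : ℝ) + 1) * ψ m ≤ (A * C) * (N : ℝ) ^ τ := by
    intro N hN
    calc ∑ m ∈ Finset.range N, ((m : ℝ) + 1) * ψ m
        = A * ∑ m ∈ Finset.range N, ((m : ℝ) + 1) * η ((m - 1) / 2) ^ (δ / (2 + δ)) := by
          rw [Finset.mul_sum]
          refine Finset.sum_congr rfl fun m _ => ?_
          simp only [hψd, hwd]; ring
      _ ≤ A * (C * (N : ℝ) ^ τ) := by gcongr; exact hsum N hN
      _ = _ := by ring
  -- exchanging both factors
  have hboth : ∀ l p q i j : ℕ, 1 ≤ p → p < q → 1 ≤ i → i < j → l ≤ w (q - p) → l ≤ w (j - i) →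
      |∫ ω, Y p q ω * Y i j ω ∂μ| ≤ |∫ ω, h (X p ω) (X q ω) * h (X i ω) (X j ω) ∂μ|
        + (6 * D + 14 * M) * K l ^ (-δ) := fun l p q i j hp1 hpq hi hij hl1 hl2 =>
    abs_integral_mul_le_of_approx hδ hM hD0 (hKpos l) (hKmono hl1) (hKmono hl2) (hhm p q hp1 hpq)
      (hhm i j hi hij) (hYm p q hp1 hpq) (hYm i j hi hij) (hp p q hp1 hpq).mom (hp i j hi hij).mom
      (hYK p q) (hYK i j) (hYd1 p q hp1 hpq) (hYd1 i j hi hij)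
  -- exchanging the factor of the more distant pair
  have hone : ∀ l p q i j : ℕ, 1 ≤ p → p < q → 1 ≤ i → i < j → l ≤ w (q - p) → w (j - i) ≤ l →
      |∫ ω, Y p q ω * Y i j ω ∂μ| ≤ |∫ ω, Y i j ω * h (X p ω) (X q ω) ∂μ|
        + D * K l ^ (-δ) := fun l p q i j hp1 hpq hi hij hl1 hl2 => by
    have := abs_integral_mul_le_of_approx_of_bounded hδ hD0 (hKpos l) (hKmono hl1)
      (hhm p q hp1 hpq) (hYm p q hp1 hpq) (hYm i j hi hij) (hp p q hp1 hpq).mom (hYK p q)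
      (fun ω => (hYK i j ω).trans (hKmono hl2)) (hYd1 p q hp1 hpq)
    simpa only [mul_comm (h _ _)] using this
  have hzero : ∀ p q i j : ℕ, 1 ≤ p → p < q → 1 ≤ i → i < j →
      |∫ ω, Y p q ω * Y i j ω ∂μ| ≤ ψ 0 := by
    intro p q i j hp1 hpq hi hij
    have h1 := hboth 0 p q i j hp1 hpq hi hij (Nat.zero_le _) (Nat.zero_le _)
    have h2 := abs_integral_mul_le_of_mom hδ hM (hhm p q hp1 hpq) (hhm i j hi hij)
      (hp p q hp1 hpq).mom (hp i j hi hij).mom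
    have h3 : w 0 = 0 := rfl
    rw [hψK, h3, hK0, mul_one]
    rw [hK0, mul_one] at h1
    simp only [hAd]
    linarith
  have hYcov : MaxSqBound μ (fun n ω => ∑ i ∈ Finset.Icc 1 n, ∑ j ∈ Finset.Ioc i n, Y i j ω) τ := by
    refine maxSqBound_of_cov hψ0 (fun p q i j hp1 hpq hi hij => ?_) ?_ ?_ (mul_nonneg hA0 hC) hψsum
    · exact integrable_mul_of_bounded_left (Integrable.of_bound
        (hYm i j hi hij).aestronglyMeasurable _ (Eventually.of_forall (hYK i j))) (hYm p q hp1 hpq)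
        (hYK p q)
    · intro p q i j m hp1 hpq hij hmq hmi
      rcases Nat.eq_zero_or_pos m with rfl | hm
      · exact hzero p q i j hp1 hpq (by omega) hij
      have hwm := hw m hm
      have hl1 : w m ≤ w (q - p) := hwmono (by omega)
      have hk := hKδ (w m)
      rw [hψK]
      rcases le_or_gt m (j - i) with hr | hr
      · have h1 := hboth (w m) p q i j hp1 hpq (by omega) hij hl1 (hwmono hr)
        have hHm : Measurable[sigmaOf Z (Set.Ici ((p + w m : ℕ) + w m : ℤ))]
            fun ω => h (X i ω) (X j ω) :=
          hh.meas.comp (((hXm i (by omega)).mono (sigmaOf_mono (Set.Ici_subset_Ici.2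
            (by push_cast; omega))) le_rfl).prodMk ((hXm j (by omega)).mono (sigmaOf_mono
            (Set.Ici_subset_Ici.2 (by push_cast; omega))) le_rfl))
        have h2 := hcov (w m) p q p _ hp1 le_rfl (by omega) hpq (Or.inr hHm)
          (Or.inr (hp i j (by omega) hij).mom)
        simp only [mul_comm (h (X i _) _)] at h2
        simp only [hAd]
        nlinarith
      · have hl2 : w (j - i) ≤ w m := hwmono hr.le
        have h1 := hone (w m) p q i j hp1 hpq (by omega) hij hl1 hl2
        have hHm : Measurable[sigmaOf Z (Set.Ici ((p + w m : ℕ) + w m : ℤ))] (Y i j) := by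
          refine hGW _ _ _ _ (by omega) (by omega) (fun k hk => ?_) fun k hk => ?_
          · rw [Set.mem_Icc] at hk
            rw [Set.mem_Ici]; push_cast; omega
          · rw [Set.mem_Icc] at hk
            rw [Set.mem_Ici]; push_cast; omega
        have h2 := hcov (w m) p q p _ hp1 le_rfl (by omega) hpq (Or.inr hHm)
          (Or.inl fun ω => (hYK i j ω).trans (hKmono hl2))
        simp only [hAd]
        nlinarith
    · intro p q i j m hp1 hi hpq hij hmi hmq
      rcases Nat.eq_zero_or_pos m with rfl | hm
      · exact hzero p q i j hp1 hpq hi hij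
      have hwm := hw m hm
      have hl1 : w m ≤ w (j - i) := hwmono (by omega)
      have hk := hKδ (w m)
      have hpast : ∀ l, l ≤ w m → Measurable[sigmaOf Z (Set.Iic ((max i q + w m : ℕ) : ℤ))]
          fun ω => G l (W l p ω) (W l q ω) := by
        intro l hl
        refine hGW _ _ _ _ hp1 (by omega) (fun k hk => ?_) fun k hk => ?_
        · rw [Set.mem_Icc] at hk
          rw [Set.mem_Iic]; push_cast; omega
        · rw [Set.mem_Icc] at hk
          rw [Set.mem_Iic]; push_cast; omega
      rw [hψK]
      rcases le_or_gt m (q - p) with hr | hr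
      · have h1 := hboth (w m) p q i j hp1 hpq hi hij (hwmono hr) hl1
        have h2 := hcov (w m) i j (max i q) _ hi (le_max_left _ _) (by omega) hij
          (Or.inl (hpast (w m) le_rfl)) (Or.inl fun ω => hGK _ _ _)
        have h3 := integral_abs_sub_mul_le (hhm p q hp1 hpq) (hGW0 (w m) p q hp1 (by omega))
          (hhm i j hi hij) hδ hM (hKpos (w m)) (hp p q hp1 hpq).mom (hp i j hi hij).mom
          (fun ω => hGK (w m) _ _) (hclose (w m) p q hp1 hpq (by omega))
        have e1 : K (w m) * (D * K (w m) ^ (-(1 + δ))) = D * K (w m) ^ (-δ) := by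
          rw [← mul_rpow_neg_one_add (hKpos (w m)) hδ]; ring
        rw [e1] at h3
        have i1 := integrable_mul_of_mom (hhm p q hp1 hpq) (hhm i j hi hij) hδ (hp p q hp1 hpq).mom
          (hp i j hi hij).mom
        have i2 := integrable_mul_of_bounded_left (integrable_of_mom (hhm i j hi hij) hδ
          (hp i j hi hij).mom) (hGW0 (w m) p q hp1 (by omega)) fun ω => hGK (w m) _ _
        have h4 : |∫ ω, h (X p ω) (X q ω) * h (X i ω) (X j ω) ∂μ
            - ∫ ω, G (w m) (W (w m) p ω) (W (w m) q ω) * h (X i ω) (X j ω) ∂μ|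
            ≤ ∫ ω, |(h (X p ω) (X q ω) - G (w m) (W (w m) p ω) (W (w m) q ω))
              * h (X i ω) (X j ω)| ∂μ := by
          rw [← integral_sub i1 i2]
          simp only [sub_mul]
          exact abs_integral_le_integral_abs
        have h5 := abs_sub_abs_le_abs_sub (∫ ω, h (X p ω) (X q ω) * h (X i ω) (X j ω) ∂μ)
          (∫ ω, G (w m) (W (w m) p ω) (W (w m) q ω) * h (X i ω) (X j ω) ∂μ)
        simp only [hAd]
        nlinarith
      · have hl2 : w (q - p) ≤ w m := hwmono hr.le
        have h1 := hone (w m) i j p q hi hij hp1 hpq hl1 hl2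
        have h2 := hcov (w m) i j (max i q) _ hi (le_max_left _ _) (by omega) hij
          (Or.inl (hpast _ hl2)) (Or.inl fun ω => (hYK p q ω).trans (hKmono hl2))
        have e1 : ∫ ω, Y p q ω * Y i j ω ∂μ = ∫ ω, Y i j ω * Y p q ω ∂μ := by
          simp only [mul_comm (Y p q _)]
        rw [e1]
        simp only [hAd]
        nlinarith
  have hsq : ∀ i j, 1 ≤ i → i < j → Integrable (fun ω => (h (X i ω) (X j ω) - Y i j ω) ^ 2) μ ∧
      ∫ ω, (h (X i ω) (X j ω) - Y i j ω) ^ 2 ∂μ ≤ ψ (j - i) := by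
    intro i j hi hij
    have h1 := integral_sub_sq_le (hhm i j hi hij) (hYm i j hi hij) hδ hM (hKpos _)
      (hp i j hi hij).mom (hYK i j) (hYd1 i j hi hij)
    refine ⟨h1.1, h1.2.trans ?_⟩
    have e1 : K (w (j - i)) * (D * K (w (j - i)) ^ (-(1 + δ))) = D * K (w (j - i)) ^ (-δ) := by
      rw [← mul_rpow_neg_one_add (hKpos (w (j - i))) hδ]; ring
    have hk := hKδ (w (j - i))
    rw [e1, hψK]
    simp only [hAd]
    nlinarith [mul_nonneg hM hk, mul_nonneg hD0 hk, mul_nonneg hB0 hk]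
  have herr := maxSqBound_of_sq hψ0 (fun i j hi hij => (hsq i j hi hij).1)
    (fun i j hi hij => (hsq i j hi hij).2) (mul_nonneg hA0 hC) hψsum
  have := hYcov.add herr
  simpa only [← Finset.sum_add_distrib, add_sub_cancel] using this

end FunctionalCase


section FunctionalConclusion
variable {Ω : Type*} [MeasurableSpace Ω] {μ : Measure Ω} [IsProbabilityMeasure μ]
  {X : ℕ → Ω → ℝ} {h : ℝ → ℝ → ℝ} {δ τ M : ℝ}

/-- The bound is stated for an almost surely equal version `X'` of the process, which is measurable with
respect to the future of `Z`. -/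
lemma maxSqBound_of_condFunctional (hX : StationaryNat μ X) (hh : DegKernel (law μ X) h δ M)
    (hp : ∀ i j, 1 ≤ i → i < j → MomPair μ (law μ X) h δ M (X i) (X j)) (hτ : 0 ≤ τ)
    (hc : CondFunctional μ X h δ τ) :
    ∃ X' : ℕ → Ω → ℝ, (∀ n, 1 ≤ n → X n =ᵐ[μ] X' n) ∧
    MaxSqBound μ (fun n ω => ∑ i ∈ Finset.Icc 1 n, ∑ j ∈ Finset.Ioc i n, h (X' i ω) (X' j ω)) τ := by
  have hδ := hh.δ_pos
  obtain ⟨hlip, Z, a, hZ, -, hf, ha, hs, hO⟩ := hc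
  obtain ⟨L, hL0, hLF, hL⟩ := exists_lipOn hlip
  have hF : IsProbabilityMeasure (law μ X) :=
    Measure.isProbabilityMeasure_map (hX.1 1 le_rfl).aemeasurable
  have ha0 : ∀ l, 0 ≤ a l := fun l => (ha.2.2 l).1
  have hβ0 : ∀ l, 0 ≤ betaCoeffInt μ Z l := fun l => ENNReal.toReal_nonneg
  have hα0 : ∀ l, 0 ≤ approxAlpha a l := fun l => Real.sqrt_nonneg _
  set e := δ / (2 + δ) with he
  have he0 : 0 < e := by positivity
  -- capped at one so that the truncation levels are at least one; `η 0 = 1` since `2 ^ 0 = 1`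
  set η : ℕ → ℝ := fun l =>
    min 1 (max (max (betaCoeffInt μ Z l) (approxAlpha a l)) ((1 / 2) ^ l)) with hηd
  have hη : ∀ l, 0 < η l := fun l => lt_min one_pos (lt_max_of_lt_right (by positivity))
  have hη0 : η 0 = 1 := min_eq_left (le_max_of_le_right (by simp))
  have hanti : Antitone η := fun k l hkl => min_le_min le_rfl (max_le_max (max_le_max
    (betaCoeffInt_antitone hkl) (approxAlpha_antitone ha0 hs hkl))
    (pow_le_pow_of_le_one (by norm_num) (by norm_num) hkl))
  obtain ⟨X', c, W, hae, hX'm, hca⟩ := exists_cellApprox hZ hf ha hs hη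
    (fun l => min_le_min le_rfl (le_max_of_le_left (le_max_left _ _)))
    (fun l => min_le_min le_rfl (le_max_of_le_left (le_max_right _ _)))
  refine ⟨X', hae, ?_⟩
  have hpair : ∀ i j, 1 ≤ i → i < j →
      (fun ω => (X' i ω, X' j ω)) =ᵐ[μ] fun ω => (X i ω, X j ω) := by
    intro i j hi hij
    filter_upwards [hae i hi, hae j (by omega)] with ω h1 h2
    rw [h1, h2]
  have hX'm0 : ∀ n, 1 ≤ n → Measurable (X' n) := fun n hn =>
    (hX'm n hn).mono (sigmaOf_le fun i _ => hZ.1 i) le_rfl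
  have hp' : ∀ i j, 1 ≤ i → i < j → MomPair μ (law μ X) h δ M (X' i) (X' j) := by
    intro i j hi hij
    refine ⟨hX'm0 i hi, hX'm0 j (by omega), ?_, ?_, ?_⟩
    · rw [← Measure.map_congr (hae i hi), hX.map_eq hi]
    · rw [← Measure.map_congr (hae j (by omega)), hX.map_eq (by omega)]
    · refine le_trans (le_of_eq (lintegral_congr_ae ?_)) (hp i j hi hij).mom
      filter_upwards [hae i hi, hae j (by omega)] with ω h1 h2
      rw [h1, h2]
  have hL' : ∀ i j, 1 ≤ i → i < j →
      LipOn h (law μ X) (μ.map fun ω => (X' i ω, X' j ω)) L := by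
    intro i j hi hij
    rw [Measure.map_congr (hpair i j hi hij), hX.map_pair_eq hi hij.le]
    exact hL _ (by omega)
  have hbound : ∀ l, η l ^ e ≤ 1 * ((betaCoeffInt μ Z l ^ e + approxAlpha a l ^ e)
      + ((1 / 2 : ℝ) ^ e) ^ l) := by
    intro l
    rw [one_mul]
    refine (Real.rpow_le_rpow (hη l).le (min_le_right _ _) he0.le).trans
      ((max_half_pow_rpow_le (le_max_of_le_left (hβ0 l)) l).trans ?_)
    gcongr
    have h1 := Real.rpow_nonneg (hβ0 l) e
    have h2 := Real.rpow_nonneg (hα0 l) e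
    rcases max_choice (betaCoeffInt μ Z l) (approxAlpha a l) with h3 | h3 <;> rw [h3] <;> linarith
  obtain ⟨C, hC, hsum⟩ := exists_sum_le_of_isBigO (ψ := fun l => η l ^ e) hτ
    (fun l => add_nonneg (Real.rpow_nonneg (hβ0 l) e) (Real.rpow_nonneg (hα0 l) e)) hO zero_le_one
    (by positivity) (half_rpow_lt_one he0) hbound
  refine maxSqBound_of_cellApprox hZ.1 hX'm hca hη hη0 hanti hh hp' hL0 hLF hL'
    (C := 9 * C) (by positivity) fun N hN => ?_
  refine (sum_half_le (fun l => Real.rpow_nonneg (hη l).le e) hN).trans ?_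
  have := hsum N hN
  linarith

end FunctionalConclusion

end UStat

theorem theorem1 {Ω : Type*} [MeasurableSpace Ω] (μ : Measure Ω) [IsProbabilityMeasure μ]
    (X : ℕ → Ω → ℝ) (hX : UStat.StationaryNat μ X)
    (h₂ : ℝ → ℝ → ℝ) (hker : UStat.IsKernel h₂)
    (hdeg : UStat.Degenerate μ X h₂) (hcent : UStat.Centered μ X h₂)
    (δ : ℝ) (hδ : 0 < δ) (hmom : UStat.UniformMoments μ X h₂ (2 + δ))
    (τ : ℝ) (hτ : 0 ≤ τ)
    (hcond : UStat.CondAbsRegular μ X δ τ ∨ UStat.CondStrongMixing μ X h₂ δ τ ∨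
      UStat.CondFunctional μ X h₂ δ τ) :
    ∀ᵐ ω ∂μ, Tendsto (fun n : ℕ =>
        (n : ℝ) ^ (1 - τ / 2) / (Real.log n ^ (3 / 2 : ℝ) * Real.log (Real.log n)) *
          UStat.uStat X h₂ n ω) atTop (𝓝 0) := by
  obtain ⟨M, hh, hp⟩ := UStat.exists_degKernel_momPair hX hker hdeg hδ hmom
  rcases hcond with hc | hc | hc
  · exact UStat.ae_tendsto_uStat hτ (UStat.maxSqBound_of_condAbsRegular hX hh hp hτ hc)
  · exact UStat.ae_tendsto_uStat hτ (UStat.maxSqBound_of_condStrongMixing hX hh hp hτ hc)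
  · obtain ⟨X', hae, hb⟩ := UStat.maxSqBound_of_condFunctional hX hh hp hτ hc
    filter_upwards [UStat.ae_tendsto_uStat hτ hb, ae_all_iff.2 fun n : ℕ => hae (n + 1) (by omega)]
      with ω hω hXω
    have heq : ∀ n, 1 ≤ n → X n ω = X' n ω := fun n hn => by
      have := hXω (n - 1)
      rwa [Nat.sub_add_cancel hn] at this
    refine hω.congr fun n => ?_
    congr 1
    unfold UStat.uStat
    congr 1
    refine Finset.sum_congr rfl fun i hi => Finset.sum_congr rfl fun j hj => ?_
    rw [Finset.mem_Icc] at hi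
    rw [Finset.mem_Ioc] at hj
    rw [heq i hi.1, heq j (by omega)]
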